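/- **Setting.** Let $\mathbb B^3$ be the closed unit ball of $\mathbb R^3$ (coordinates $x,y,z$) and $\mathbb S^2=\partial\mathbb B^3$. All surfaces below are rotationally invariant around the $y$-axis; the parallel circle at latitude $\beta\in(0,\pi)$ is $\{y=\cos\beta\}\cap\mathbb S^2$. For $a>0$, $b\in\mathbb R$ let $\mathbb K_{a,b}=\{\sqrt{x^2+z^2}=a\cosh\frac{y-b}{a}\}$. If $\mathbb K=\mathbb K_{a,b}$ meets $\mathbb S^2$ in the circles at latitudes $\beta_{in}<\beta_{ex}$, then $\mathbb K\cap\mathbb B^3$ is the annulus between them; $\alpha_{in}$ (resp. $\alpha_{ex}$) denotes the angle, in the half-plane $\{z=0,x\ge0\}$, between its meridian arc and the arc of the unit circle towards the south pole (resp. north pole), at the point of latitude $\beta_{in}$ (resp. $\beta_{ex}$). A *catenoidal configuration of order* $k'\ge1$ consists of circles $\mathcal C_1,\dots,\mathcal C_{k'+1}$ at latitudes $0<\beta_1<\dots<\beta_{k'}<\pi/2$ and $\beta_{k'+1}>\beta_{k'}$, the flat disc $\mathcal A_0$ bounded by $\mathcal C_1$, and annuli $\mathcal A_i=\mathbb K_i\cap\mathbb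 B^3$, $\mathbb K_i=\mathbb K_{a_i,b_i}$, with $\partial\mathcal A_i=\mathcal C_i\cup\mathcal C_{i+1}$ ($1\le i\le k'$). For $1\le i\le k'$ let $\alpha_i^+$ and $\alpha_{i+1}^-$ be the angles $\alpha_{in}$ and $\alpha_{ex}$ of $\mathbb K_i$, and let $\alpha_1^-=\beta_1$. Its unbalancing parameters $\sigma_1,\dots,\sigma_{k'}$ are given by $e^{\sigma_i}=\alpha_i^+/\alpha_i^-$. It is *symmetrically extendible of total order* $k$ if either $\beta_{k'+1}=\pi/2$ and $k=2k'+1$, or $\beta_{k'}+\beta_{k'+1}=\pi$ and $k=2k'$. Given $k$ and $\underline\sigma=\{\sigma_i\}_{i\ge1}\in\ell^1$, $\mathcal W[\underline\sigma:k]$ is the union of a symmetrically extendible catenoidal configuration of total order $k$, with $\beta_1<2\pi/7$ and with unbalancing parameters $\sigma_1,\dots,\sigma_{k'}$, and its reflection $\mathsf R$ in the $xz$-plane. Extend the notation by $\mathcal A_j=\mathsf R\mathcal A_{k-j}$ for $k'<j\le k$, $\mathbb K_j=\mathsf R\mathbb K_{k-j}$ and $a_{\mathbb K_j}=a_{\mathbb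 K_{k-j}}$ for $k'<j\le k-1$, and $\alpha_i^\pm=\alpha_{k-i+1}^\mp$ for $k'<i\le k$ (for odd $k$ and $i=k'+1$ both angles are the angle $\alpha^-_{k'+1}=\alpha_{ex}$ of $\mathbb K_{k'}$). For a surface $\mathcal A$ let $\mathcal L_{\mathcal A}=\Delta_{\mathcal A}+|A|^2$; a real $\lambda$ is a Dirichlet eigenvalue of $\mathcal L_{\mathcal A}$ if there is $u\not\equiv0$ on $\mathcal A$, $C^2$ in the interior, continuous up to the boundary and zero on $\partial\mathcal A$, with $\mathcal L_{\mathcal A}u+\lambda u=0$. **Statement.** There is an absolute constant $\delta''_\sigma>0$ such that for all $k\ge3$ and all $\underline\sigma\in\ell^1$ with $\|\underline\sigma\|_{\ell^1}<\delta''_\sigma$ there is a unique $\widehat\beta\in(0,2\pi/7)$ for which a configuration as above defining $\mathcal W[\underline\sigma:k]$ exists with $\beta_1=\widehat\beta$; and, for all $k$ large enough in absolute terms, there are constants $\delta_\sigma=\delta_\sigma(k)\in(0,\delta''_\sigma)$, $c=c(k)>0$ and $\delta'_\theta=\delta'_\theta(k)>0$ such that the following hold for all $\underline\sigma$ with $\|\underline\sigma\|_{\ell^1}\le\delta_\sigma$.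 1. $\alpha_i^+[\underline\sigma:k]\in[30\delta'_\theta,\frac\pi2-30\delta'_\theta]$ and $|\alpha_i^-[\underline\sigma:k]-\alpha_i^+[\underline\sigma:k]|\le\delta'_\theta$ for $1\le i\le k$. 2. The catenoid $\mathbb K_i$ containing $\mathcal A_i[\underline\sigma:k]$ satisfies $a_{\mathbb K_i}>\delta'_\theta$ for $1\le i\le k-1$. 3. For $0\le i\le k$ no Dirichlet eigenvalue of $\mathcal L_{\mathcal A_i[\underline\sigma:k]}$ on $\mathcal A_i[\underline\sigma:k]$ lies in $[-c,c]$. -/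

import Mathlib

open scoped ContDiff Matrix

noncomputable section

namespace CatConf

/-- Euclidean three-space; the coordinates `x, y, z` are `p 0, p 1, p 2`. -/
abbrev E3 := EuclideanSpace ℝ (Fin 3)

/-! ### The Jacobi operator of a surface in Euclidean three-space -/

section Surface

/-- The `i`-th coordinate vector field of a parametrization `F`. -/
def tangentVec (F : (Fin 2 → ℝ) → E3) (i : Fin 2) (q : Fin 2 → ℝ) : E3 :=
  fderiv ℝ F q (Pi.single i 1)

/-- The second coordinate derivatives of a parametrization `F`. -/
def secondDeriv (F : (Fin 2 → ℝ) → E3) (i j : Fin 2) (q : Fin 2 → ℝ) : E3 :=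
  fderiv ℝ (tangentVec F j) q (Pi.single i 1)

/-- The first fundamental form (the induced metric) in the coordinates given by `F`. -/
def firstForm (F : (Fin 2 → ℝ) → E3) (q : Fin 2 → ℝ) : Matrix (Fin 2) (Fin 2) ℝ :=
  Matrix.of fun i j => inner ℝ (tangentVec F i q) (tangentVec F j q)

/-- The area density `√(det g)`. -/
def areaDensity (F : (Fin 2 → ℝ) → E3) (q : Fin 2 → ℝ) : ℝ :=
  Real.sqrt (firstForm F q).det

/-- The unit normal `(∂₀F × ∂₁F) / |∂₀F × ∂₁F|`. -/
def unitNormal (F : (Fin 2 → ℝ) → E3) (q : Fin 2 → ℝ) : E3 :=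
  let n : E3 :=
    WithLp.toLp 2 (crossProduct (WithLp.ofLp (tangentVec F 0 q)) (WithLp.ofLp (tangentVec F 1 q)))
  ‖n‖⁻¹ • n

/-- The second fundamental form in the coordinates given by `F`. -/
def secondForm (F : (Fin 2 → ℝ) → E3) (q : Fin 2 → ℝ) : Matrix (Fin 2) (Fin 2) ℝ :=
  Matrix.of fun i j => inner ℝ (secondDeriv F i j q) (unitNormal F q)

/-- The squared length `|A|² = g^{ik} g^{jl} h_{ij} h_{kl}` of the second fundamental form,
i.e. the trace of the square of the shape operator. -/
def normSqA (F : (Fin 2 → ℝ) → E3) (q : Fin 2 → ℝ) : ℝ :=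
  (((firstForm F q)⁻¹ * secondForm F q) * ((firstForm F q)⁻¹ * secondForm F q)).trace

/-- The Laplace-Beltrami operator of the induced metric in the coordinates given by `F`:
`Δ f = (√det g)⁻¹ ∂ᵢ (√det g g^{ij} ∂ⱼ f)`. -/
def laplaceBeltrami (F : (Fin 2 → ℝ) → E3) (f : (Fin 2 → ℝ) → ℝ) (q : Fin 2 → ℝ) : ℝ :=
  (areaDensity F q)⁻¹ * ∑ i : Fin 2,
    fderiv ℝ (fun p => areaDensity F p *
      ∑ j : Fin 2, (firstForm F p)⁻¹ i j * fderiv ℝ f p (Pi.single j 1)) q (Pi.single i 1)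

/-- The Jacobi operator `𝓛 = Δ + |A|²` in the coordinates given by `F`. -/
def jacobiOperator (F : (Fin 2 → ℝ) → E3) (f : (Fin 2 → ℝ) → ℝ) (q : Fin 2 → ℝ) : ℝ :=
  laplaceBeltrami F f q + normSqA F q * f q

/-- `F` restricted to the open set `U` is a smooth immersion with image in `S`. For a smooth
embedded surface `S` without boundary these are the local parametrizations of `S`. -/
structure IsLocalParam (S : Set E3) (U : Set (Fin 2 → ℝ)) (F : (Fin 2 → ℝ) → E3) : Prop where
  isOpen : IsOpen U
  smooth : ContDiffOn ℝ ∞ F U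
  immersion : ∀ q ∈ U, LinearIndependent ℝ fun i => tangentVec F i q
  mapsTo : Set.MapsTo F U S

/-- `lam` is a Dirichlet eigenvalue of the Jacobi operator on the compact surface `S` with
boundary curve(s) `B`: there is a nonzero function `u`, continuous on `S` and vanishing on `B`,
which is `C²` in the interior `S \ B` and satisfies `𝓛 u + lam u = 0` there (both read in local
parametrizations of `S \ B`). -/
def IsDirichletEigenvalue (S B : Set E3) (lam : ℝ) : Prop :=
  ∃ u : E3 → ℝ, ContinuousOn u S ∧ (∀ p ∈ B, u p = 0) ∧ (∃ p ∈ S, u p ≠ 0) ∧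
    ∀ (U : Set (Fin 2 → ℝ)) (F : (Fin 2 → ℝ) → E3), IsLocalParam (S \ B) U F →
      ContDiffOn ℝ 2 (fun q => u (F q)) U ∧
      ∀ q ∈ U, jacobiOperator F (fun q' => u (F q')) q + lam * u (F q) = 0

end Surface

/-! ### Catenoids around the `y`-axis -/

section Catenoid

/-- The closed unit ball. -/
def unitBall : Set E3 := Metric.closedBall 0 1

/-- The unit sphere. -/
def unitSphere : Set E3 := Metric.sphere 0 1

/-- The catenoid around the `y`-axis whose meridian is `x = a cosh ((y - b) / a)` (for `a > 0`). -/
def catenoid (a b : ℝ) : Set E3 :=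
  {p | Real.sqrt (p 0 ^ 2 + p 2 ^ 2) = a * Real.cosh ((p 1 - b) / a)}

/-- The meridian of the catenoid with parameters `a > 0` and `b` meets the unit circle at the
points `(sin β, cos β)` and `(sin β', cos β')`, `0 < β < β' < π`. Then `catenoid a b ∩ unitBall`
is the annulus bounded by the parallel circles at latitudes `β` (`= β_in`) and `β'` (`= β_ex`). -/
structure IsAnnulusBetween (a b β β' : ℝ) : Prop where
  neck_pos : 0 < a
  pos : 0 < β
  lt : β < β'
  lt_pi : β' < Real.pi
  mem_in : Real.sin β = a * Real.cosh ((Real.cos β - b) / a)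
  mem_ex : Real.sin β' = a * Real.cosh ((Real.cos β' - b) / a)

/-- The angle `α_in` at `(sin β, cos β)` between the part of the meridian
`x = a cosh ((y - b) / a)` below that point and the arc of the unit circle from that point to the
south pole (the angle between the two tangent vectors). -/
def angleIn (a b β : ℝ) : ℝ :=
  InnerProductGeometry.angle (!₂[-Real.sinh ((Real.cos β - b) / a), -1] : EuclideanSpace ℝ (Fin 2))
    !₂[Real.cos β, -Real.sin β]

/-- The angle `α_ex` at `(sin β, cos β)` between the part of the meridian
`x = a cosh ((y - b) / a)` above that point and the arc of the unit circle from that point to the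
north pole (the angle between the two tangent vectors). -/
def angleEx (a b β : ℝ) : ℝ :=
  InnerProductGeometry.angle (!₂[Real.sinh ((Real.cos β - b) / a), 1] : EuclideanSpace ℝ (Fin 2))
    !₂[-Real.cos β, Real.sin β]

end Catenoid

/-! ### Catenoidal configurations -/

/-- A catenoidal configuration of order `k'`: parallel circles at latitudes
`0 < β 1 < ⋯ < β k' < π / 2` and `β (k' + 1)`, the flat disc bounded by the first circle, and for
`1 ≤ i ≤ k'` an annulus of the catenoid with parameters `a i`, `b i` between the `i`-th and the
`(i + 1)`-st circle. Other values of the sequences carry no meaning. -/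
structure Configuration where
  order : ℕ
  β : ℕ → ℝ
  a : ℕ → ℝ
  b : ℕ → ℝ
  one_le_order : 1 ≤ order
  β_lt_half_pi : ∀ i, 1 ≤ i → i ≤ order → β i < Real.pi / 2
  annulus : ∀ i, 1 ≤ i → i ≤ order → IsAnnulusBetween (a i) (b i) (β i) (β (i + 1))

namespace Configuration

variable (W : Configuration)

/-- The angle `α_i⁺`, for `1 ≤ i ≤ k'`. -/
def αPlus (i : ℕ) : ℝ := angleIn (W.a i) (W.b i) (W.β i)

/-- The angle `α_i⁻`, for `1 ≤ i ≤ k' + 1`, where `α_1⁻ = β_1` is the angle made by the disc. -/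
def αMinus (i : ℕ) : ℝ :=
  if i = 1 then W.β 1 else angleEx (W.a (i - 1)) (W.b (i - 1)) (W.β i)

/-- The unbalancing parameters of the configuration are `σ_1, …, σ_{k'}`. -/
def HasUnbalancing (σ : ℕ+ → ℝ) : Prop :=
  ∀ i : ℕ+, (i : ℕ) ≤ W.order → Real.exp (σ i) = W.αPlus i / W.αMinus i

/-- The configuration is symmetrically extendible and has total order `k`. -/
def HasTotalOrder (k : ℕ) : Prop :=
  (W.β (W.order + 1) = Real.pi / 2 ∧ k = 2 * W.order + 1) ∨
    (W.β (W.order + 1) + W.β W.order = Real.pi ∧ k = 2 * W.order)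

/-- `W` generates the configuration `𝒲[σ : k]`, which is the union of `W` and its reflection. -/
def Generates (σ : ℕ+ → ℝ) (k : ℕ) : Prop :=
  W.β 1 < 2 * Real.pi / 7 ∧ W.HasUnbalancing σ ∧ W.HasTotalOrder k

/-- The disc (`j = 0`) or catenoidal annulus (`1 ≤ j ≤ k'`) of the configuration. -/
def piece (j : ℕ) : Set E3 :=
  if j = 0 then {p | p 1 = Real.cos (W.β 1)} ∩ unitBall else catenoid (W.a j) (W.b j) ∩ unitBall

/-! The symmetrically extended configuration of total order `k` (so `k' = k / 2`). -/

/-- The angle `α_i⁺[σ : k]`, `1 ≤ i ≤ k`. -/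
def extαPlus (k i : ℕ) : ℝ := if i ≤ k / 2 then W.αPlus i else W.αMinus (k + 1 - i)

/-- The angle `α_i⁻[σ : k]`, `1 ≤ i ≤ k`. On the equator (`k` odd, `i = k' + 1`) it is the
angle `α_{k'+1}⁻` of `W`, which is then also `α_i⁺[σ : k]`. -/
def extαMinus (k i : ℕ) : ℝ := if i ≤ (k + 1) / 2 then W.αMinus i else W.αPlus (k + 1 - i)

/-- The parameter `a` of the catenoid that contains `𝒜_i[σ : k]`, `1 ≤ i ≤ k - 1`
(a reflected catenoid has the same `a`). -/
def extNeck (k i : ℕ) : ℝ := if i ≤ k / 2 then W.a i else W.a (k - i)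

end Configuration

/-- The reflection with respect to the `xz`-plane. -/
def reflectY (p : E3) : E3 := !₂[p 0, -p 1, p 2]

/-- The disc or catenoidal annulus `𝒜_j[σ : k]`, `0 ≤ j ≤ k`, of the symmetrically extended
configuration of total order `k`. Its boundary consists of its points on the unit sphere. -/
def Configuration.extPiece (W : Configuration) (k j : ℕ) : Set E3 :=
  if j ≤ k / 2 then W.piece j else reflectY '' W.piece (k - j)

end CatConf

end

open CatConf

namespace CatConf

open Real Set

/-! ### The meridian `s ↦ (a cosh s, b + a s)` of a catenoid -/

/-! The configuration is found by shooting from the north pole. Parametrize the meridian of a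
catenoid by `s ↦ (a cosh s, b + a s)`. The normal part of its position vector, `support`, is the
cosine of the angle with the unit circle at the points where the meridian meets it. It is also the
Jacobi function generated by dilations. The tangential part is `radial / cosh`.

A latitude and an angle determine a catenoid, hence the next circle and the angle there; multiplying
that angle by the next `exp σ` gives new data. So a configuration is the `orbit` of its first
latitude `x`. Two facts control orbits in the northern hemisphere. The angle does not grow across an
annulus (`IsArc.support_right_le_left`), so all lower angles are at most `exp ‖σ‖ * x`, which is
acute since `x < 2π / 7` and `exp ‖σ‖ < 7 / 4`. And larger data give a lower next circle with an
angle that is no smaller (`exit_comparison`), so the orbit is monotone in `x`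
(`IsAdmissible.comparison`).

Existence is an intermediate value argument. For tiny `x` the circles stay near the pole
(`isAdmissible_of_small`), while from `baseLat` the second circle is already past the equator
(`exists_base`). Recursion on the number of circles puts the last one on the equator
(`exists_lat_eq_half_pi`, odd order); a further deformation makes the next annulus symmetric
(`exists_center_eq_zero`, even order). Uniqueness is strict monotonicity for odd order. For even
order, symmetric acute annuli with wider circles have smaller angles (`not_lt_of_center_eq_zero`),
against the monotonicity of the orbit.

For fixed `k` the first latitude cannot be too small, since otherwise the equator is not reached.
This yields explicit lower bounds for latitudes, necks and angles. Acute angles make `support`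
bounded below by some `m > 0` on each annulus (`Bounds.le_support`). Then `support - m / 2` is a
positive strict supersolution for the Jacobi operator plus `lam` with `|lam|` small, and the maximum
principle for the quotient `u / w` excludes eigenfunctions. On the disc `2 - x² - z²` plays that
role. -/

/-- The height of the meridian point with parameter `s`. -/
noncomputable def height (a b s : ℝ) : ℝ := b + a * s

/-- The squared distance from the origin of the meridian point with parameter `s`. -/
noncomputable def distSq (a b s : ℝ) : ℝ := (a * cosh s) ^ 2 + height a b s ^ 2

/-- Up to the factor `2 * a`, the derivative of `distSq a b`. -/
noncomputable def radial (a b s : ℝ) : ℝ := a * (sinh s * cosh s) + height a b s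

/-- The support function of the catenoid along its meridian. -/
noncomputable def support (a b s : ℝ) : ℝ := a - height a b s * (sinh s / cosh s)

theorem cosh_sq_eq (s : ℝ) : cosh s ^ 2 = 1 + sinh s ^ 2 := by
  rw [Real.cosh_sq]; ring

theorem hasDerivAt_height (a b s : ℝ) : HasDerivAt (height a b) a s := by
  refine (((hasDerivAt_id s).const_mul a).const_add b).congr_deriv (mul_one a)

theorem hasDerivAt_distSq (a b s : ℝ) :
    HasDerivAt (distSq a b) (2 * a * radial a b s) s := by
  have h := (((Real.hasDerivAt_cosh s).const_mul a).pow 2).add ((hasDerivAt_height a b s).pow 2)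
  refine h.congr_deriv ?_
  simp only [radial, height]; push_cast; ring

theorem hasDerivAt_radial (a b s : ℝ) :
    HasDerivAt (radial a b) (2 * a * cosh s ^ 2) s := by
  have h := (((Real.hasDerivAt_sinh s).mul (Real.hasDerivAt_cosh s)).const_mul a).add
    (hasDerivAt_height a b s)
  refine h.congr_deriv ?_
  have := cosh_sq_eq s
  linear_combination -a * this

theorem hasDerivAt_sinh_div_cosh (s : ℝ) :
    HasDerivAt (fun s => sinh s / cosh s) (1 / cosh s ^ 2) s := by
  have h := (Real.hasDerivAt_sinh s).div (Real.hasDerivAt_cosh s) (cosh_pos s).ne'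
  refine h.congr_deriv ?_
  have := cosh_sq_eq s
  congr 1
  linear_combination this

theorem strictMono_sinh_div_cosh : StrictMono fun s => sinh s / cosh s :=
  strictMono_of_hasDerivAt_pos hasDerivAt_sinh_div_cosh fun s => by
    have := cosh_pos s; positivity

theorem hasDerivAt_support (a b s : ℝ) :
    HasDerivAt (support a b) (-(radial a b s / cosh s ^ 2)) s := by
  have h := ((hasDerivAt_height a b s).mul (hasDerivAt_sinh_div_cosh s)).const_sub a
  refine h.congr_deriv ?_
  have := (cosh_pos s).ne'
  simp only [radial]
  field_simp

theorem continuous_distSq (a b : ℝ) : Continuous (distSq a b) := by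
  unfold distSq height; fun_prop

theorem continuous_radial (a b : ℝ) : Continuous (radial a b) := by
  unfold radial height; fun_prop

theorem continuous_support (a b : ℝ) : Continuous (support a b) :=
  continuous_iff_continuousAt.2 fun s => (hasDerivAt_support a b s).continuousAt

theorem strictMono_radial {a : ℝ} (b : ℝ) (ha : 0 < a) : StrictMono (radial a b) :=
  strictMono_of_hasDerivAt_pos (hasDerivAt_radial a b) fun s => by
    have := cosh_pos s; positivity

theorem strictMono_height {a : ℝ} (b : ℝ) (ha : 0 < a) : StrictMono (height a b) := by
  intro s s' h; unfold height; nlinarith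

/-- The decomposition of the position vector into its normal and tangential parts. -/
theorem support_sq_add_radial_sq (a b s : ℝ) :
    support a b s ^ 2 + (radial a b s / cosh s) ^ 2 = distSq a b s := by
  have hc := (cosh_pos s).ne'
  have := cosh_sq_eq s
  simp only [support, radial, distSq]
  generalize height a b s = y
  field_simp
  have h2 : sinh s ^ 2 = cosh s ^ 2 - 1 := by linarith
  ring_nf
  simp only [h2]
  ring

theorem strictMonoOn_distSq {a b z : ℝ} (ha : 0 < a) (hz : 0 ≤ radial a b z) :
    StrictMonoOn (distSq a b) (Ici z) := by
  refine strictMonoOn_of_hasDerivWithinAt_pos (f' := fun s => 2 * a * radial a b s) (convex_Ici z)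
    (continuous_distSq a b).continuousOn
    (fun s _ => (hasDerivAt_distSq a b s).hasDerivWithinAt) fun s hs => ?_
  rw [interior_Ici] at hs
  have := strictMono_radial b ha hs
  have : 0 < radial a b s := by linarith
  positivity

theorem strictAntiOn_distSq {a b z : ℝ} (ha : 0 < a) (hz : radial a b z ≤ 0) :
    StrictAntiOn (distSq a b) (Iic z) := by
  refine strictAntiOn_of_hasDerivWithinAt_neg (f' := fun s => 2 * a * radial a b s) (convex_Iic z)
    (continuous_distSq a b).continuousOn
    (fun s _ => (hasDerivAt_distSq a b s).hasDerivWithinAt) fun s hs => ?_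
  rw [interior_Iic] at hs
  have := strictMono_radial b ha hs
  have : radial a b s < 0 := by linarith
  nlinarith

/-! ### Arcs of the meridian inside the unit disc -/

/-- The part of the meridian with parameters between `s₁ < s₀` is an arc in the unit disc with
end points on the unit circle. -/
structure IsArc (a b s₁ s₀ : ℝ) : Prop where
  pos : 0 < a
  lt : s₁ < s₀
  left : distSq a b s₁ = 1
  right : distSq a b s₀ = 1

namespace IsArc

variable {a b s₁ s₀ : ℝ}

theorem exists_radial_eq_zero (h : IsArc a b s₁ s₀) : ∃ z ∈ Ioo s₁ s₀, radial a b z = 0 := by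
  obtain ⟨z, hz, hz'⟩ := exists_hasDerivAt_eq_zero h.lt (continuous_distSq a b).continuousOn
    (h.left.trans h.right.symm) fun s _ => hasDerivAt_distSq a b s
  refine ⟨z, hz, ?_⟩
  have := h.pos
  have : 2 * a ≠ 0 := by positivity
  exact (mul_eq_zero.1 hz').resolve_left this

theorem radial_left_neg (h : IsArc a b s₁ s₀) : radial a b s₁ < 0 := by
  obtain ⟨z, hz, hz'⟩ := h.exists_radial_eq_zero
  rw [← hz']; exact strictMono_radial b h.pos hz.1

theorem radial_right_pos (h : IsArc a b s₁ s₀) : 0 < radial a b s₀ := by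
  obtain ⟨z, hz, hz'⟩ := h.exists_radial_eq_zero
  rw [← hz']; exact strictMono_radial b h.pos hz.2

/-- Since `radial` is strictly increasing, `distSq` first decreases and then increases along the
whole meridian, so its sublevel set is an interval. -/
theorem mem_Icc_iff (h : IsArc a b s₁ s₀) (s : ℝ) : distSq a b s ≤ 1 ↔ s ∈ Icc s₁ s₀ := by
  obtain ⟨z, hz, hz'⟩ := h.exists_radial_eq_zero
  have hm := strictMonoOn_distSq h.pos hz'.ge
  have ha := strictAntiOn_distSq h.pos hz'.le
  rcases le_total z s with hs | hs
  · rw [← h.right, hm.le_iff_le hs hz.2.le]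
    exact ⟨fun h' => ⟨hz.1.le.trans hs, h'⟩, fun h' => h'.2⟩
  · rw [← h.left, ha.le_iff_ge hs hz.1.le]
    exact ⟨fun h' => ⟨h', hs.trans hz.2.le⟩, fun h' => h'.1⟩

theorem eq_or_eq (h : IsArc a b s₁ s₀) {s : ℝ} (hs : distSq a b s = 1) : s = s₁ ∨ s = s₀ := by
  obtain ⟨z, hz, hz'⟩ := h.exists_radial_eq_zero
  rcases le_total z s with hs' | hs'
  · exact Or.inr ((strictMonoOn_distSq h.pos hz'.ge).injOn hs' hz.2.le (hs.trans h.right.symm))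
  · exact Or.inl ((strictAntiOn_distSq h.pos hz'.le).injOn hs' hz.1.le (hs.trans h.left.symm))

theorem support_left_sq (h : IsArc a b s₁ s₀) :
    support a b s₁ ^ 2 + (radial a b s₁ / cosh s₁) ^ 2 = 1 := by
  rw [support_sq_add_radial_sq, h.left]

theorem support_right_sq (h : IsArc a b s₁ s₀) :
    support a b s₀ ^ 2 + (radial a b s₀ / cosh s₀) ^ 2 = 1 := by
  rw [support_sq_add_radial_sq, h.right]

theorem height_lt (h : IsArc a b s₁ s₀) : height a b s₁ < height a b s₀ :=
  strictMono_height b h.pos h.lt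

theorem sinh_left_neg (h : IsArc a b s₁ s₀) (hy : 0 ≤ height a b s₁) : sinh s₁ < 0 := by
  have h1 := h.radial_left_neg
  have h2 := h.pos
  have h3 := cosh_pos s₁
  by_contra! h4
  have : 0 ≤ radial a b s₁ := by unfold radial; positivity
  linarith

theorem left_neg (h : IsArc a b s₁ s₀) (hy : 0 ≤ height a b s₁) : s₁ < 0 :=
  sinh_neg_iff.1 (h.sinh_left_neg hy)

theorem height_nonneg (h : IsArc a b s₁ s₀) (hy : 0 ≤ height a b s₁) {s : ℝ} (hs : s₁ ≤ s) :
    0 ≤ height a b s :=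
  hy.trans ((strictMono_height b h.pos).monotone hs)

/-- In the northern half-disc the support function of an arc is bounded below. -/
theorem min_le_support (h : IsArc a b s₁ s₀) (hy : 0 ≤ height a b s₁) {s : ℝ}
    (hs : s ∈ Icc s₁ s₀) : min a (support a b s₀) ≤ support a b s := by
  have hc := cosh_pos s
  rcases le_total s 0 with h0 | h0
  · refine (min_le_left _ _).trans ?_
    have h1 := h.height_nonneg hy hs.1
    have h2 : sinh s / cosh s ≤ 0 := div_nonpos_of_nonpos_of_nonneg (sinh_nonpos_iff.2 h0) hc.le
    unfold support
    nlinarith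
  · refine (min_le_right _ _).trans ?_
    -- For `s ≥ 0` and nonnegative height both terms of `radial` are nonnegative, and `support' =
    -- -radial / cosh ^ 2`.
    have hanti : AntitoneOn (support a b) (Icc 0 s₀) := by
      refine antitoneOn_of_hasDerivWithinAt_nonpos (f' := fun s => -(radial a b s / cosh s ^ 2))
        (convex_Icc _ _) (continuous_support a b).continuousOn
        (fun s _ => (hasDerivAt_support a b s).hasDerivWithinAt) fun s hs' => ?_
      rw [interior_Icc] at hs'
      have h1 := h.height_nonneg hy ((h.left_neg hy).le.trans hs'.1.le)
      have h2 : 0 ≤ sinh s := sinh_nonneg_iff.2 hs'.1.le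
      have h3 := cosh_pos s
      have h4 := h.pos
      have : 0 ≤ radial a b s := by unfold radial; positivity
      simp only [Left.neg_nonpos_iff]
      positivity
    exact hanti ⟨h0, hs.2⟩ ⟨h0.trans hs.2, le_rfl⟩ hs.2

theorem support_pos (h : IsArc a b s₁ s₀) (hy : 0 ≤ height a b s₁) (hα : 0 < support a b s₀)
    {s : ℝ} (hs : s ∈ Icc s₁ s₀) : 0 < support a b s :=
  (lt_min h.pos hα).trans_le (h.min_le_support hy hs)

/-- In the northern half-disc the angle at the lower end point is at most the angle at the upper
one. -/
theorem support_right_le_left (h : IsArc a b s₁ s₀) (hy : 0 ≤ height a b s₁)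
    (hα : 0 < support a b s₀) : support a b s₀ ≤ support a b s₁ := by
  -- Multiplying by `distSq`, which is one at both ends, changes nothing there and turns `support ^
  -- 2` into a monotone quantity in the northern half, although `support` itself is not monotone.
  have hd : ∀ s, HasDerivAt (fun s => distSq a b s * support a b s ^ 2)
      (-(2 * height a b s * support a b s * (radial a b s / cosh s) ^ 2)) s := by
    intro s
    have := (hasDerivAt_distSq a b s).mul ((hasDerivAt_support a b s).pow 2)
    refine this.congr_deriv ?_
    have hc := (cosh_pos s).ne'
    have h2 : sinh s ^ 2 = cosh s ^ 2 - 1 := by linarith [cosh_sq_eq s]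
    simp only [← support_sq_add_radial_sq, Pi.pow_apply]
    simp only [radial, support]
    generalize height a b s = y
    push_cast
    field_simp
    ring_nf
    have h3 : sinh s ^ 3 = sinh s * (cosh s ^ 2 - 1) := by rw [← h2]; ring
    have h4 : sinh s ^ 4 = (cosh s ^ 2 - 1) ^ 2 := by rw [← h2]; ring
    simp only [h2, h3, h4]
    ring
  have hanti : AntitoneOn (fun s => distSq a b s * support a b s ^ 2) (Icc s₁ s₀) := by
    refine antitoneOn_of_hasDerivWithinAt_nonpos (convex_Icc _ _)
      (fun s _ => (hd s).continuousAt.continuousWithinAt)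
      (fun s _ => (hd s).hasDerivWithinAt) fun s hs => ?_
    rw [interior_Icc] at hs
    have h1 := h.height_nonneg hy hs.1.le
    have h2 := h.support_pos hy hα (Ioo_subset_Icc_self hs)
    simp only [Left.neg_nonpos_iff]
    positivity
  have := hanti ⟨le_rfl, h.lt.le⟩ ⟨h.lt.le, le_rfl⟩ h.lt.le
  simp only [h.left, h.right, one_mul] at this
  exact (pow_le_pow_iff_left₀ hα.le (h.support_pos hy hα ⟨le_rfl, h.lt.le⟩).le two_ne_zero).1 this

theorem neck_mul_cosh_le (h : IsArc a b s₁ s₀) {s : ℝ} (hs : s ∈ Icc s₁ s₀) : a * cosh s ≤ 1 := by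
  have h1 := (h.mem_Icc_iff s).2 hs
  have h2 := h.pos
  have h3 := cosh_pos s
  unfold distSq at h1
  nlinarith [sq_nonneg (height a b s), mul_pos h2 h3]

/-- The angle at the lower end point is bounded below in terms of the angle at the upper one. -/
theorem neck_mul_radial_le (h : IsArc a b s₁ s₀) : a * radial a b s₀ ≤ -radial a b s₁ := by
  obtain ⟨z, hz, hz'⟩ := h.exists_radial_eq_zero
  have ha := h.pos
  -- The factor `1 - c cosh ^ 2` has a constant sign for `c = a ^ 2` (as `a cosh ≤ 1` on the arc)
  -- and for `c = 1`. These are used to the right and to the left of the zero `z` of `radial`, and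
  -- the two resulting bounds on `distSq a b z` are compared.
  have hd : ∀ c s, HasDerivAt (fun s => distSq a b s - c / 2 * radial a b s ^ 2)
      (2 * a * radial a b s * (1 - c * cosh s ^ 2)) s := by
    intro c s
    have := (hasDerivAt_distSq a b s).sub (((hasDerivAt_radial a b s).pow 2).const_mul (c / 2))
    refine this.congr_deriv ?_
    push_cast; ring
  have h1 : MonotoneOn (fun s => distSq a b s - a ^ 2 / 2 * radial a b s ^ 2) (Icc z s₀) := by
    refine monotoneOn_of_hasDerivWithinAt_nonneg (convex_Icc _ _)
      (fun s _ => (hd _ s).continuousAt.continuousWithinAt)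
      (fun s _ => (hd _ s).hasDerivWithinAt) fun s hs => ?_
    rw [interior_Icc] at hs
    have h2 : 0 < radial a b s := hz' ▸ strictMono_radial b ha hs.1
    have h3 := h.neck_mul_cosh_le (s := s) ⟨(hz.1.trans hs.1).le, hs.2.le⟩
    have h4 := cosh_pos s
    have h5 : a ^ 2 * cosh s ^ 2 ≤ 1 := by
      rw [← mul_pow]; exact pow_le_one₀ (by positivity) h3
    have : 0 ≤ 1 - a ^ 2 * cosh s ^ 2 := by linarith
    positivity
  have h2 : MonotoneOn (fun s => distSq a b s - 1 / 2 * radial a b s ^ 2) (Icc s₁ z) := by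
    refine monotoneOn_of_hasDerivWithinAt_nonneg (convex_Icc _ _)
      (fun s _ => (hd _ s).continuousAt.continuousWithinAt)
      (fun s _ => (hd _ s).hasDerivWithinAt) fun s hs => ?_
    rw [interior_Icc] at hs
    have h2 : radial a b s < 0 := hz' ▸ strictMono_radial b ha hs.2
    have h4 := one_le_cosh s
    have h5 : 1 ≤ cosh s ^ 2 := one_le_pow₀ h4
    have h6 : 2 * a * radial a b s ≤ 0 := by nlinarith
    exact mul_nonneg_of_nonpos_of_nonpos h6 (by linarith)
  have h3 := h1 ⟨le_rfl, hz.2.le⟩ ⟨hz.2.le, le_rfl⟩ hz.2.le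
  have h4 := h2 ⟨le_rfl, hz.1.le⟩ ⟨hz.1.le, le_rfl⟩ hz.1.le
  simp only [hz', h.left, h.right] at h3 h4
  have h5 := h.radial_left_neg
  have h6 := h.radial_right_pos
  have h7 : (a * radial a b s₀) ^ 2 ≤ (-radial a b s₁) ^ 2 := by nlinarith
  exact (pow_le_pow_iff_left₀ (by positivity) (by linarith) two_ne_zero).1 h7

end IsArc

end CatConf

namespace CatConf

open Real Set Filter Topology

/-! ### The lower end point of an arc as a function of the catenoid -/

theorem sq_le_sinh_sq (s : ℝ) : s ^ 2 ≤ sinh s ^ 2 := by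
  rcases le_total 0 s with h | h
  · have := self_le_sinh_iff.2 h; nlinarith
  · have := sinh_le_self_iff.2 h; nlinarith

theorem one_lt_distSq_of_large {a b s : ℝ} (ha : 0 < a) (hs : 1 ≤ a ^ 2 * s ^ 2) :
    1 < distSq a b s := by
  have h1 := cosh_sq_eq s
  have h2 := mul_le_mul_of_nonneg_left (sq_le_sinh_sq s) (sq_nonneg a)
  have h3 : 0 < a ^ 2 := by positivity
  have h4 : (a * cosh s) ^ 2 = a ^ 2 + a ^ 2 * sinh s ^ 2 := by rw [mul_pow, h1]; ring
  unfold distSq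
  nlinarith [sq_nonneg (height a b s)]

/-- Since `radial` is positive at `t`, the meridian followed backwards enters the open disc; it
leaves it again because `distSq` exceeds one far out. -/
theorem exists_isArc {a b t : ℝ} (ha : 0 < a) (ht : distSq a b t = 1) (hr : 0 < radial a b t) :
    ∃ s, IsArc a b s t := by
  obtain ⟨u, hu, hu'⟩ : ∃ u < t, 0 ≤ radial a b u := by
    have h1 : ∀ᶠ u in 𝓝 t, 0 < radial a b u :=
      (continuous_radial a b).continuousAt.eventually (lt_mem_nhds hr)
    obtain ⟨u, hu, hu'⟩ := ((h1.filter_mono nhdsWithin_le_nhds).and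
      (self_mem_nhdsWithin (s := Iio t))).exists
    exact ⟨u, hu', hu.le⟩
  have hlt : distSq a b u < 1 := by
    rw [← ht]; exact strictMonoOn_distSq ha hu' self_mem_Ici hu.le hu
  obtain ⟨w, hw, hw'⟩ : ∃ w < u, 1 < distSq a b w := by
    refine ⟨min (u - 1) (-(1 / a)), (min_le_left _ _).trans_lt (by linarith),
      one_lt_distSq_of_large ha ?_⟩
    have h1 : 1 / a ≤ -min (u - 1) (-(1 / a)) := by linarith [min_le_right (u - 1) (-(1 / a))]
    rw [div_le_iff₀ ha] at h1
    nlinarith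
  obtain ⟨s, hs, hs'⟩ := intermediate_value_Ioo' hw.le (continuous_distSq a b).continuousOn
    (show (1 : ℝ) ∈ Ioo (distSq a b u) (distSq a b w) from ⟨hlt, hw'⟩)
  exact ⟨s, ha, hs.2.trans hu, hs', ht⟩

/-- The parameter of the lower end point of the arc of the meridian in the unit disc. -/
noncomputable def leftRoot (a b : ℝ) : ℝ := sInf {s | distSq a b s ≤ 1}

theorem IsArc.leftRoot_eq {a b s₁ s₀ : ℝ} (h : IsArc a b s₁ s₀) : leftRoot a b = s₁ := by
  have : {s | distSq a b s ≤ 1} = Icc s₁ s₀ := by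
    ext s; exact h.mem_Icc_iff s
  rw [leftRoot, this, csInf_Icc h.lt.le]

/-- The signs of `distSq - 1` at `s₁ - η`, `s₁ + η`, `s₀ + η` are positive, negative, positive.
Strict signs survive a small change of the catenoid, and the intermediate value theorem locates the
new end points. -/
theorem IsArc.eventually_exists {X : Type*} [TopologicalSpace X] {a b : X → ℝ} {p : X}
    {s₁ s₀ : ℝ} (ha : ContinuousAt a p) (hb : ContinuousAt b p) (h : IsArc (a p) (b p) s₁ s₀)
    {ε : ℝ} (hε : 0 < ε) :
    ∀ᶠ x in 𝓝 p, ∃ u v, IsArc (a x) (b x) u v ∧ |u - s₁| < ε := by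
  obtain ⟨η, hη, hη', hηε⟩ : ∃ η, 0 < η ∧ s₁ + η < s₀ ∧ η < ε := by
    have := h.lt
    refine ⟨min ε (s₀ - s₁) / 2, half_pos (lt_min hε (by linarith)), ?_, ?_⟩
    · have := min_le_right ε (s₀ - s₁); linarith
    · have := min_le_left ε (s₀ - s₁); linarith
  have hc : ∀ s, ContinuousAt (fun x => distSq (a x) (b x) s) p := by
    intro s
    unfold distSq height
    fun_prop
  have h1 : 1 < distSq (a p) (b p) (s₁ - η) := by
    by_contra! hle; have := ((h.mem_Icc_iff _).1 hle).1; linarith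
  have h3 : 1 < distSq (a p) (b p) (s₀ + η) := by
    by_contra! hle; have := ((h.mem_Icc_iff _).1 hle).2; linarith
  have h2 : distSq (a p) (b p) (s₁ + η) < 1 := by
    refine lt_of_le_of_ne ((h.mem_Icc_iff _).2 ⟨by linarith, hη'.le⟩) fun he => ?_
    rcases h.eq_or_eq he with h' | h' <;> linarith
  filter_upwards [(hc _).eventually (lt_mem_nhds h1), (hc _).eventually (gt_mem_nhds h2),
    (hc _).eventually (lt_mem_nhds h3), ha.eventually (lt_mem_nhds h.pos)] with x e1 e2 e3 e4
  obtain ⟨u, hu, hu'⟩ := intermediate_value_Ioo' (show s₁ - η ≤ s₁ + η by linarith)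
    (continuous_distSq (a x) (b x)).continuousOn (show (1 : ℝ) ∈ Ioo _ _ from ⟨e2, e1⟩)
  obtain ⟨v, hv, hv'⟩ := intermediate_value_Ioo (show s₁ + η ≤ s₀ + η by linarith)
    (continuous_distSq (a x) (b x)).continuousOn (show (1 : ℝ) ∈ Ioo _ _ from ⟨e2, e3⟩)
  refine ⟨u, v, ⟨e4, hu.2.trans hv.1, hu', hv'⟩, ?_⟩
  rw [abs_lt]; exact ⟨by linarith [hu.1], by linarith [hu.2]⟩

theorem IsArc.continuousAt_leftRoot {X : Type*} [TopologicalSpace X] {a b : X → ℝ} {p : X}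
    {s₁ s₀ : ℝ} (ha : ContinuousAt a p) (hb : ContinuousAt b p) (h : IsArc (a p) (b p) s₁ s₀) :
    ContinuousAt (fun x => leftRoot (a x) (b x)) p := by
  rw [Metric.continuousAt_iff']
  intro ε hε
  filter_upwards [h.eventually_exists ha hb hε] with x ⟨u, v, huv, hu⟩
  rwa [huv.leftRoot_eq, h.leftRoot_eq, Real.dist_eq]

theorem IsArc.eventually_distSq_leftRoot {X : Type*} [TopologicalSpace X] {a b : X → ℝ} {p : X}
    {s₁ s₀ : ℝ} (ha : ContinuousAt a p) (hb : ContinuousAt b p) (h : IsArc (a p) (b p) s₁ s₀) :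
    ∀ᶠ x in 𝓝 p, distSq (a x) (b x) (leftRoot (a x) (b x)) = 1 := by
  filter_upwards [h.eventually_exists ha hb one_pos] with x ⟨u, v, huv, hu⟩
  rw [huv.leftRoot_eq, huv.left]

/-- A continuous solution of an implicit equation is differentiable. -/
theorem differentiableAt_of_implicit {Φ : ℝ × ℝ → ℝ} {L : ℝ → ℝ} {p m c : ℝ}
    (hΦ : DifferentiableAt ℝ Φ (p, L p)) (hL : ContinuousAt L p)
    (hc : ∀ᶠ x in 𝓝 p, Φ (x, L x) = c) (hm : HasDerivAt (fun s => Φ (p, s)) m (L p))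
    (hm0 : m ≠ 0) : DifferentiableAt ℝ L p := by
  set Φ' := fderiv ℝ Φ (p, L p) with hΦ'
  have hd : HasFDerivAt Φ Φ' (p, L p) := hΦ.hasFDerivAt
  have hm' : Φ' (0, 1) = m := by
    have h1 : HasDerivAt (fun s : ℝ => ((p, s) : ℝ × ℝ)) (0, 1) (L p) :=
      (hasDerivAt_const _ _).prodMk (hasDerivAt_id _)
    exact (hd.comp_hasDerivAt (L p) h1).unique hm
  set l := -Φ' (1, 0) / m with hl
  have hlin : ∀ x s : ℝ, Φ' (x, s) = m * (s - l * x) := by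
    intro x s
    have : ((x, s) : ℝ × ℝ) = x • ((1, 0) : ℝ × ℝ) + s • ((0, 1) : ℝ × ℝ) := by simp
    rw [this, map_add, map_smul, map_smul, hm', hl]
    simp only [smul_eq_mul]
    field_simp
    ring
  have hT : Tendsto (fun x => ((x, L x) : ℝ × ℝ)) (𝓝 p) (𝓝 (p, L p)) :=
    (continuousAt_id.prodMk hL)
  have ho := (hasFDerivAt_iff_isLittleO.1 hd).comp_tendsto hT
  -- The error is padded to a vector so that it can be subtracted from the full increment. Being
  -- negligible against that increment, it leaves a remainder of the same order, namely `(x - p, l *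
  -- (x - p))`; hence the increment of `L` is `O(x - p)` and the error is `o(x - p)`.
  have hw : (fun x => ((0, L x - L p - l * (x - p)) : ℝ × ℝ)) =o[𝓝 p]
      fun x => ((x - p, L x - L p) : ℝ × ℝ) := by
    have h2 : (fun x => m * (L x - L p - l * (x - p))) =o[𝓝 p]
        fun x => ((x - p, L x - L p) : ℝ × ℝ) := by
      refine ho.neg_left.congr' ?_ ?_
      · filter_upwards [hc] with x hx
        simp only [Function.comp, hx, hc.self_of_nhds, Prod.mk_sub_mk, hlin]
        ring
      · exact Eventually.of_forall fun x => by simp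
    have h3 := (h2.const_mul_left m⁻¹)
    rw [← Asymptotics.isLittleO_norm_left] at h3 ⊢
    refine h3.congr_left fun x => ?_
    rw [← mul_assoc, inv_mul_cancel₀ hm0, one_mul, Prod.norm_mk, norm_zero,
      max_eq_right (norm_nonneg _)]
  have hO := hw.right_isBigO_sub
  have hO' : (fun x => ((x - p, L x - L p) : ℝ × ℝ)) =O[𝓝 p] fun x => x - p := by
    refine hO.trans ?_
    refine (Asymptotics.IsBigO.of_bound (1 + |l|) (Eventually.of_forall fun x => ?_))
    simp only [Prod.mk_sub_mk, Prod.norm_mk, Real.norm_eq_abs, sub_zero]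
    have h4 : L x - L p - (L x - L p - l * (x - p)) = l * (x - p) := by ring
    rw [h4, abs_mul]
    have := abs_nonneg (x - p)
    have := abs_nonneg l
    refine max_le ?_ ?_ <;> nlinarith
  have hfin := hw.trans_isBigO hO'
  have : HasDerivAt L l p := by
    rw [hasDerivAt_iff_isLittleO]
    refine Asymptotics.IsLittleO.of_norm_left
      ((Asymptotics.isLittleO_norm_left.2 hfin).congr_left fun x => ?_)
    rw [Prod.norm_mk, norm_zero, max_eq_right (norm_nonneg _), smul_eq_mul, mul_comm l]
  exact this.differentiableAt

theorem IsArc.differentiableAt_leftRoot {a b : ℝ → ℝ} {p s₁ s₀ : ℝ}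
    (ha : DifferentiableAt ℝ a p) (hb : DifferentiableAt ℝ b p) (h : IsArc (a p) (b p) s₁ s₀) :
    DifferentiableAt ℝ (fun x => leftRoot (a x) (b x)) p := by
  refine differentiableAt_of_implicit (Φ := fun q => distSq (a q.1) (b q.1) q.2) (c := 1)
    ?_ (h.continuousAt_leftRoot ha.continuousAt hb.continuousAt)
    (h.eventually_distSq_leftRoot ha.continuousAt hb.continuousAt)
    (hasDerivAt_distSq (a p) (b p) (leftRoot (a p) (b p))) ?_
  · have ha' : DifferentiableAt ℝ (fun q : ℝ × ℝ => a q.1) (p, leftRoot (a p) (b p)) :=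
      DifferentiableAt.comp (p, leftRoot (a p) (b p)) (g := a) ha differentiableAt_fst
    have hb' : DifferentiableAt ℝ (fun q : ℝ × ℝ => b q.1) (p, leftRoot (a p) (b p)) :=
      DifferentiableAt.comp (p, leftRoot (a p) (b p)) (g := b) hb differentiableAt_fst
    unfold distSq height
    fun_prop
  · rw [h.leftRoot_eq]
    have h1 := h.radial_left_neg
    have h2 := h.pos
    exact mul_ne_zero (by positivity) h1.ne

end CatConf

namespace CatConf

open Real Set Filter Topology

/-! ### The catenoid with prescribed upper end point and direction -/

/-- The parameter of the meridian point at which the downward tangent makes the angle `φ` with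
the outward horizontal direction. -/
noncomputable def startParam (φ : ℝ) : ℝ := -arsinh (cos φ / sin φ)

/-- The parameter `a` of the catenoid through the circle at latitude `β` in direction `φ`. -/
noncomputable def neck (β φ : ℝ) : ℝ := sin β * sin φ

/-- The parameter `b` of the catenoid through the circle at latitude `β` in direction `φ`. -/
noncomputable def center (β φ : ℝ) : ℝ := cos β - neck β φ * startParam φ

theorem sinh_startParam (φ : ℝ) : sinh (startParam φ) = -(cos φ / sin φ) := by
  rw [startParam, sinh_neg, sinh_arsinh]

theorem cosh_startParam {φ : ℝ} (h : 0 < sin φ) : cosh (startParam φ) = 1 / sin φ := by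
  rw [startParam, cosh_neg, cosh_arsinh]
  have : 1 + (cos φ / sin φ) ^ 2 = (1 / sin φ) ^ 2 := by
    field_simp
    linarith [sin_sq_add_cos_sq φ]
  rw [this, sqrt_sq (by positivity)]

theorem hasDerivAt_startParam {φ : ℝ} (h : 0 < sin φ) :
    HasDerivAt startParam (1 / sin φ) φ := by
  have h1 := (((hasDerivAt_cos φ).div (hasDerivAt_sin φ) h.ne').arsinh).neg
  refine h1.congr_deriv ?_
  have : 1 + (cos φ / sin φ) ^ 2 = (1 / sin φ) ^ 2 := by
    field_simp
    linarith [sin_sq_add_cos_sq φ]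
  simp only [Pi.div_apply, this, sqrt_sq (show 0 ≤ 1 / sin φ by positivity), smul_eq_mul]
  field_simp
  linarith [sin_sq_add_cos_sq φ]

theorem height_startParam (β φ : ℝ) :
    height (neck β φ) (center β φ) (startParam φ) = cos β := by
  simp [height, center]

theorem neck_mul_cosh_startParam {β φ : ℝ} (h : 0 < sin φ) :
    neck β φ * cosh (startParam φ) = sin β := by
  rw [cosh_startParam h, neck]; field_simp

theorem distSq_startParam {β φ : ℝ} (h : 0 < sin φ) :
    distSq (neck β φ) (center β φ) (startParam φ) = 1 := by
  rw [distSq, neck_mul_cosh_startParam h, height_startParam, sin_sq_add_cos_sq]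

theorem radial_startParam {β φ : ℝ} (h : 0 < sin φ) :
    radial (neck β φ) (center β φ) (startParam φ) = sin (φ - β) / sin φ := by
  rw [radial, height_startParam, sinh_startParam, cosh_startParam h, neck, sin_sub]
  field_simp
  ring

/-- The angle between the meridian and the unit circle at the upper end point is thus `φ - β`. -/
theorem support_startParam {β φ : ℝ} (h : 0 < sin φ) :
    support (neck β φ) (center β φ) (startParam φ) = cos (φ - β) := by
  rw [support, height_startParam, sinh_startParam, cosh_startParam h, neck, cos_sub]
  field_simp
  ring

/-- Admissible initial data of a catenoidal annulus. -/
structure IsStart (β φ : ℝ) : Prop where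
  pos : 0 < β
  lt : β < φ
  lt_pi : φ < π

namespace IsStart

variable {β φ : ℝ}

theorem sin_lat_pos (h : IsStart β φ) : 0 < sin β :=
  sin_pos_of_pos_of_lt_pi h.pos (h.lt.trans h.lt_pi)

theorem sin_dir_pos (h : IsStart β φ) : 0 < sin φ :=
  sin_pos_of_pos_of_lt_pi (h.pos.trans h.lt) h.lt_pi

theorem neck_pos (h : IsStart β φ) : 0 < neck β φ := mul_pos h.sin_lat_pos h.sin_dir_pos

theorem sin_sub_pos (h : IsStart β φ) : 0 < sin (φ - β) :=
  sin_pos_of_pos_of_lt_pi (by linarith [h.lt]) (by linarith [h.pos, h.lt_pi])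

end IsStart

/-- The parameter of the lower end point of the arc with the given initial data. -/
noncomputable def exitParam (β φ : ℝ) : ℝ := leftRoot (neck β φ) (center β φ)

/-- The height of the lower end point of the arc with the given initial data. -/
noncomputable def exitHeight (β φ : ℝ) : ℝ := height (neck β φ) (center β φ) (exitParam β φ)

/-- The cosine of the angle at the lower end point of the arc with the given initial data. -/
noncomputable def exitSupport (β φ : ℝ) : ℝ := support (neck β φ) (center β φ) (exitParam β φ)

theorem IsStart.isArc {β φ : ℝ} (h : IsStart β φ) :
    IsArc (neck β φ) (center β φ) (exitParam β φ) (startParam φ) := by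
  obtain ⟨s, hs⟩ := exists_isArc h.neck_pos (distSq_startParam (β := β) h.sin_dir_pos) (by
    rw [radial_startParam h.sin_dir_pos]
    exact div_pos h.sin_sub_pos h.sin_dir_pos)
  rw [exitParam, hs.leftRoot_eq]; exact hs

/-! ### Comparison of the two end points of an arc -/

namespace IsArc

variable {a b s₁ s₀ : ℝ}

/-- Along an arc, `s + 2 r / sin (θ + φ)` is monotone, where `φ` is the
direction of the tangent and `(r, y) = (sin θ, cos θ)` at the end points. -/
theorem tangent_comparison (h : IsArc a b s₁ s₀)
    (hv : 0 < height a b s₀ - a * (sinh s₀ * cosh s₀)) :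
    2 * (a * cosh s₁ ^ 2) * (height a b s₀ - a * (sinh s₀ * cosh s₀)) ≤
      (height a b s₁ - a * (sinh s₁ * cosh s₁)) *
        (2 * (a * cosh s₀ ^ 2) + (s₀ - s₁) * (height a b s₀ - a * (sinh s₀ * cosh s₀))) := by
  set v : ℝ → ℝ := fun s => height a b s - a * (sinh s * cosh s) with hvdef
  have ha := h.pos
  have hd : ∀ s, HasDerivAt v (-(2 * a * sinh s ^ 2)) s := by
    intro s
    have h1 := (hasDerivAt_height a b s).sub
      (((Real.hasDerivAt_sinh s).mul (Real.hasDerivAt_cosh s)).const_mul a)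
    refine h1.congr_deriv ?_
    have := cosh_sq_eq s
    linear_combination -a * this
  have hanti : Antitone v := antitone_of_hasDerivAt_nonpos hd fun s => by
    have : 0 ≤ 2 * a * sinh s ^ 2 := by positivity
    simpa using this
  have hpos : ∀ s ∈ Icc s₁ s₀, 0 < v s := fun s hs => hv.trans_le (hanti hs.2)
  -- The derivative is a perfect square because `radial = v + 2 a sinh cosh` and `v' = -2 a sinh ^
  -- 2`.
  have hd2 : ∀ s ∈ Icc s₁ s₀, HasDerivAt (fun s => s + 2 * (a * cosh s ^ 2) / v s)
      ((radial a b s / v s) ^ 2) s := by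
    intro s hs
    have h0 := (hpos s hs).ne'
    have h1 := (hasDerivAt_id s).add
      (((((Real.hasDerivAt_cosh s).pow 2).const_mul a).const_mul 2).div (hd s) h0)
    refine h1.congr_deriv ?_
    have hc := cosh_sq_eq s
    have h2 : sinh s ^ 2 = cosh s ^ 2 - 1 := by linarith
    have h3 : radial a b s ^ 2 = v s ^ 2 + 4 * a * (sinh s * cosh s) * height a b s := by
      simp only [hvdef, radial]; ring
    rw [div_pow, h3]
    push_cast
    simp only [Pi.pow_apply]
    field_simp
    simp only [hvdef]
    ring_nf
  have hmono : MonotoneOn (fun s => s + 2 * (a * cosh s ^ 2) / v s) (Icc s₁ s₀) := by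
    refine monotoneOn_of_hasDerivWithinAt_nonneg (convex_Icc _ _)
      (fun s hs => (hd2 s hs).continuousAt.continuousWithinAt)
      (fun s hs => (hd2 s (interior_subset hs)).hasDerivWithinAt) fun s hs => ?_
    positivity
  have hfin := hmono ⟨le_rfl, h.lt.le⟩ ⟨h.lt.le, le_rfl⟩ h.lt.le
  have h1 := hpos s₁ ⟨le_rfl, h.lt.le⟩
  have h2 := hpos s₀ ⟨h.lt.le, le_rfl⟩
  change 2 * (a * cosh s₁ ^ 2) * v s₀ ≤ v s₁ * (2 * (a * cosh s₀ ^ 2) + (s₀ - s₁) * v s₀)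
  simp only at hfin
  have h3 : 2 * (a * cosh s₁ ^ 2) / v s₁ ≤ s₀ - s₁ + 2 * (a * cosh s₀ ^ 2) / v s₀ := by linarith
  rw [div_le_iff₀ h1] at h3
  calc _ ≤ ((s₀ - s₁ + 2 * (a * cosh s₀ ^ 2) / v s₀) * v s₁) * v s₀ :=
        mul_le_mul_of_nonneg_right h3 h2.le
    _ = _ := by field_simp; ring

theorem height_sub_left_pos (h : IsArc a b s₁ s₀) (hy : 0 ≤ height a b s₁) :
    0 < height a b s₁ - a * (sinh s₁ * cosh s₁) := by
  have h1 := h.sinh_left_neg hy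
  have h2 := mul_pos h.pos (mul_pos (neg_pos.2 h1) (cosh_pos s₁))
  linarith

/-- The acute upper angle gives `y₀ sinh s₀ < a cosh s₀`, and a lower end point in the northern half
gives `a (s₀ - s₁) ≤ y₀`. This keeps the coefficients in `variation_ineq` positive. -/
theorem param_sub_mul_lt (h : IsArc a b s₁ s₀) (hy : 0 ≤ height a b s₁)
    (hα : 0 < support a b s₀) : (s₀ - s₁) * sinh s₀ < cosh s₀ := by
  have hc := cosh_pos s₀
  rcases le_total (sinh s₀) 0 with h0 | h0
  · nlinarith [h.lt]
  · have ha := h.pos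
    have h1 : height a b s₀ * sinh s₀ < a * cosh s₀ := by
      have h2 : 0 < support a b s₀ * cosh s₀ := mul_pos hα hc
      have h3 : support a b s₀ * cosh s₀ = a * cosh s₀ - height a b s₀ * sinh s₀ := by
        unfold support; field_simp
      linarith
    have h2 : a * (s₀ - s₁) ≤ height a b s₀ := by
      have : a * (s₀ - s₁) = height a b s₀ - height a b s₁ := by unfold height; ring
      linarith
    have h3 : a * (s₀ - s₁) * sinh s₀ ≤ height a b s₀ * sinh s₀ :=
      mul_le_mul_of_nonneg_right h2 h0
    have h4 : a * ((s₀ - s₁) * sinh s₀) < a * cosh s₀ := by linarith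
    exact lt_of_mul_lt_mul_left h4 ha.le

/-- The inequality behind the monotonicity of the lower end point in the initial data. -/
theorem variation_ineq (h : IsArc a b s₁ s₀) (hy : 0 ≤ height a b s₁)
    (hα : 0 < support a b s₀) {p q d R : ℝ} (hp : 0 ≤ p) (hq : 0 ≤ q) (hpq : 0 < p + q)
    (hd : d = p * ((height a b s₀ - a * (sinh s₀ * cosh s₀)) / cosh s₀) - q * (a * sinh s₀))
    (hR : R = a * cosh s₀ * (2 * p + q) + (s₀ - s₁) * d) :
    0 < R ∧ 2 * (a * cosh s₁ ^ 2) * d ≤ (height a b s₁ - a * (sinh s₁ * cosh s₁)) * R := by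
  have ha := h.pos
  have hc := cosh_pos s₀
  have hlt := h.lt
  have hv1 := h.height_sub_left_pos hy
  have hτ := h.param_sub_mul_lt hy hα
  have hm := h.tangent_comparison
  have hQ := h.radial_right_pos
  have hy0 := h.height_nonneg hy h.lt.le
  have hC1 := cosh_pos s₁
  unfold radial at hQ
  set v₀ := height a b s₀ - a * (sinh s₀ * cosh s₀) with hv₀
  set v₁ := height a b s₁ - a * (sinh s₁ * cosh s₁) with hv₁
  -- Both `d` and `R` are linear in `p, q ≥ 0`, so coefficients can be treated separately: `hα1`,
  -- `hα2` handle those of `q`, while `hβ1`, `hβ2` handle those of `p`, up to the factor `cosh s₀`.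
  have hα1 : 0 < a * cosh s₀ + (s₀ - s₁) * (-(a * sinh s₀)) := by nlinarith
  have hβ1 : 0 < 2 * (a * cosh s₀ ^ 2) + (s₀ - s₁) * v₀ := by
    have h1 : 0 ≤ (s₀ - s₁) * height a b s₀ := mul_nonneg (by linarith) hy0
    have h2 : (s₀ - s₁) * v₀ =
        (s₀ - s₁) * height a b s₀ - a * cosh s₀ * ((s₀ - s₁) * sinh s₀) := by
      rw [hv₀]; ring
    nlinarith [mul_pos ha hc]
  have hβ2 : 2 * (a * cosh s₁ ^ 2) * v₀ ≤ v₁ * (2 * (a * cosh s₀ ^ 2) + (s₀ - s₁) * v₀) := by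
    rcases le_or_gt v₀ 0 with h0 | h0
    · have h1 : 2 * (a * cosh s₁ ^ 2) * v₀ ≤ 0 :=
        mul_nonpos_of_nonneg_of_nonpos (by positivity) h0
      exact h1.trans (mul_pos hv1 hβ1).le
    · exact hm h0
  have hα2 : 2 * (a * cosh s₁ ^ 2) * (-(a * sinh s₀)) ≤
      v₁ * (a * cosh s₀ + (s₀ - s₁) * (-(a * sinh s₀))) := by
    rcases le_or_gt 0 (sinh s₀) with h0 | h0
    · have h1 : 2 * (a * cosh s₁ ^ 2) * (-(a * sinh s₀)) ≤ 0 :=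
        mul_nonpos_of_nonneg_of_nonpos (by positivity) (by nlinarith)
      exact h1.trans (mul_pos hv1 hα1).le
    -- For `sinh s₀ < 0` the tangent comparison is multiplied by `-a sinh s₀`; the surplus is `v₁ a
    -- cosh s₀` times the positive `radial a b s₀`.
    · have h1 : 0 < v₀ := by
        have := mul_pos ha (mul_pos (neg_pos.2 h0) hc)
        rw [hv₀]; linarith
      have h2 := mul_le_mul_of_nonneg_right (hm h1) (mul_pos ha (neg_pos.2 h0)).le
      have h3 : 0 < v₁ * (a * cosh s₀) * (a * (sinh s₀ * cosh s₀) + height a b s₀) := by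
        positivity
      have h4 : 2 * (a * cosh s₁ ^ 2) * (-(a * sinh s₀)) * v₀ ≤
          v₁ * (a * cosh s₀ + (s₀ - s₁) * (-(a * sinh s₀))) * v₀ := by
        have h5 : v₁ * (a * cosh s₀ + (s₀ - s₁) * (-(a * sinh s₀))) * v₀ -
            v₁ * (2 * (a * cosh s₀ ^ 2) + (s₀ - s₁) * v₀) * (a * -sinh s₀) =
            v₁ * (a * cosh s₀) * (a * (sinh s₀ * cosh s₀) + height a b s₀) := by
          rw [hv₀]; ring
        linarith
      exact le_of_mul_le_mul_right h4 h1
  have hRe : R = p * ((2 * (a * cosh s₀ ^ 2) + (s₀ - s₁) * v₀) / cosh s₀) +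
      q * (a * cosh s₀ + (s₀ - s₁) * (-(a * sinh s₀))) := by
    rw [hR, hd]; field_simp; ring
  have hβ1' := div_pos hβ1 hc
  refine ⟨?_, ?_⟩
  · rw [hRe]
    rcases hp.eq_or_lt with rfl | hp'
    · have hq' : 0 < q := by linarith
      have := mul_pos hq' hα1
      linarith
    · have h1 := mul_pos hp' hβ1'
      have h2 := mul_nonneg hq hα1.le
      linarith
  · rw [hRe, hd]
    have h1 := mul_le_mul_of_nonneg_left (div_le_div_of_nonneg_right hβ2 hc.le) hp
    have h2 := mul_le_mul_of_nonneg_left hα2 hq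
    calc _ = p * (2 * (a * cosh s₁ ^ 2) * v₀ / cosh s₀) +
          q * (2 * (a * cosh s₁ ^ 2) * (-(a * sinh s₀))) := by ring
      _ ≤ _ := add_le_add h1 h2
      _ = _ := by ring

/-- The resulting signs of the derivatives of the height `D` of the lower end point and of the
cosine of its angle. -/
theorem variation_sign (h : IsArc a b s₁ s₀) {d R D l : ℝ} (hR : 0 < R)
    (hV : 2 * (a * cosh s₁ ^ 2) * d ≤ (height a b s₁ - a * (sinh s₁ * cosh s₁)) * R)
    (hD : D = -R + a * l)
    (hE : a * cosh s₁ * (d * cosh s₁ + a * (sinh s₁ * l)) + height a b s₁ * D = 0) :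
    D < 0 ∧ d - (D * (sinh s₁ / cosh s₁) + height a b s₁ * (l / cosh s₁ ^ 2)) ≤ 0 := by
  have ha := h.pos
  have hc := cosh_pos s₁
  have hQ := h.radial_left_neg
  unfold radial at hQ
  set C := cosh s₁
  set S := sinh s₁
  set y := height a b s₁
  have hl : l = (D + R) / a := by rw [hD]; field_simp; ring
  -- This eliminates `l` from the differentiated end point condition. The factor of `D` is `radial`
  -- at the lower end, which is negative.
  have hDQ : D * (a * (S * C) + y) = -(a * C) * (S * R + C * d) := by
    rw [hl] at hE
    field_simp at hE
    linarith
  have hneg : S * R + C * d < 0 := by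
    have h1 : 2 * (a * C) * (S * R + C * d) ≤ R * (a * (S * C) + y) := by nlinarith
    have h2 : R * (a * (S * C) + y) < 0 := mul_neg_of_pos_of_neg hR hQ
    by_contra! h3
    have : 0 ≤ 2 * (a * C) * (S * R + C * d) := by positivity
    linarith
  constructor
  · by_contra! h3
    have h4 : D * (a * (S * C) + y) ≤ 0 := mul_nonpos_of_nonneg_of_nonpos h3 hQ.le
    have h5 : 0 < -(a * C) * (S * R + C * d) := by
      have := mul_pos (mul_pos ha hc) (neg_pos.2 hneg); linarith
    linarith
  · have h1 : (d - (D * (S / C) + y * (l / C ^ 2))) * (a * C ^ 2) * (a * (S * C) + y) =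
        (a * (S * C) + y) * (2 * (a * C ^ 2) * d - (y - a * (S * C)) * R) := by
      rw [hl]
      have h2 : (d - (D * (S / C) + y * ((D + R) / a / C ^ 2))) * (a * C ^ 2) =
          d * (a * C ^ 2) - D * (a * (S * C) + y) - y * R := by
        field_simp; ring
      rw [h2, hDQ]
      ring
    have h3 : (d - (D * (S / C) + y * (l / C ^ 2))) * (a * C ^ 2) =
        2 * (a * C ^ 2) * d - (y - a * (S * C)) * R := by
      apply mul_right_cancel₀ hQ.ne
      rw [h1]; ring
    have h4 : (d - (D * (S / C) + y * (l / C ^ 2))) * (a * C ^ 2) ≤ 0 := by linarith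
    by_contra! h5
    have := mul_pos h5 (mul_pos ha (pow_pos hc 2))
    linarith

end IsArc

end CatConf

namespace CatConf

open Real Set Filter Topology

/-! ### Monotone dependence of the lower end point on the initial data -/

theorem continuousAt_neck {X : Type*} [TopologicalSpace X] {β φ : X → ℝ} {x : X}
    (hβ : ContinuousAt β x) (hφ : ContinuousAt φ x) :
    ContinuousAt (fun x => neck (β x) (φ x)) x := by
  unfold neck; fun_prop

theorem continuousAt_center {X : Type*} [TopologicalSpace X] {β φ : X → ℝ} {x : X}
    (hβ : ContinuousAt β x) (hφ : ContinuousAt φ x) (hs : 0 < sin (φ x)) :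
    ContinuousAt (fun x => center (β x) (φ x)) x := by
  have h1 : ContinuousAt (fun x => startParam (φ x)) x :=
    ContinuousAt.comp (f := φ) (hasDerivAt_startParam hs).continuousAt hφ
  have h2 := continuousAt_neck hβ hφ
  unfold center
  fun_prop

theorem IsStart.continuousAt_exitParam {X : Type*} [TopologicalSpace X] {β φ : X → ℝ} {x : X}
    (hβ : ContinuousAt β x) (hφ : ContinuousAt φ x) (h : IsStart (β x) (φ x)) :
    ContinuousAt (fun x => exitParam (β x) (φ x)) x :=
  h.isArc.continuousAt_leftRoot (a := fun x => neck (β x) (φ x))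
    (b := fun x => center (β x) (φ x)) (continuousAt_neck hβ hφ)
    (continuousAt_center hβ hφ h.sin_dir_pos)

theorem IsStart.continuousAt_exitHeight {X : Type*} [TopologicalSpace X] {β φ : X → ℝ} {x : X}
    (hβ : ContinuousAt β x) (hφ : ContinuousAt φ x) (h : IsStart (β x) (φ x)) :
    ContinuousAt (fun x => exitHeight (β x) (φ x)) x := by
  have h1 := h.continuousAt_exitParam hβ hφ
  have h2 := continuousAt_neck hβ hφ
  have h3 := continuousAt_center hβ hφ h.sin_dir_pos
  unfold exitHeight height
  fun_prop

theorem IsStart.continuousAt_exitSupport {X : Type*} [TopologicalSpace X] {β φ : X → ℝ} {x : X}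
    (hβ : ContinuousAt β x) (hφ : ContinuousAt φ x) (h : IsStart (β x) (φ x)) :
    ContinuousAt (fun x => exitSupport (β x) (φ x)) x := by
  have h1 := h.continuousAt_exitParam hβ hφ
  have h2 := continuousAt_neck hβ hφ
  have h3 := h.continuousAt_exitHeight hβ hφ
  have h4 : ContinuousAt (fun x => sinh (exitParam (β x) (φ x)) / cosh (exitParam (β x) (φ x))) x :=
    (Real.continuous_sinh.continuousAt.comp h1).div (Real.continuous_cosh.continuousAt.comp h1)
      (cosh_pos _).ne'
  exact h2.sub (h3.mul h4)

/-- Here `p` and `q` are the velocities of the latitude and of the angle `φ - β`, `d` is the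
velocity of the neck, and `-R` that of the height at a fixed parameter. Differentiating `distSq = 1`
at the lower end determines the motion of that end; the signs then come from `variation_ineq` and
`variation_sign`. -/
theorem IsStart.hasDerivAt_exit {β φ : ℝ → ℝ} {s p q : ℝ} (hβ : HasDerivAt β p s)
    (hφ : HasDerivAt φ (p + q) s) (h : IsStart (β s) (φ s)) (hy : 0 ≤ exitHeight (β s) (φ s))
    (hα : 0 < cos (φ s - β s)) (hp : 0 ≤ p) (hq : 0 ≤ q) (hpq : 0 < p + q) :
    ∃ D e, HasDerivAt (fun s => exitHeight (β s) (φ s)) D s ∧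
      HasDerivAt (fun s => exitSupport (β s) (φ s)) e s ∧ D < 0 ∧ e ≤ 0 := by
  have hsin := h.sin_dir_pos
  have harc := h.isArc
  set d := cos (β s) * p * sin (φ s) + sin (β s) * (cos (φ s) * (p + q)) with hd
  have ha : HasDerivAt (fun s => neck (β s) (φ s)) d s := hβ.sin.mul hφ.sin
  have ht : HasDerivAt (fun s => startParam (φ s)) (1 / sin (φ s) * (p + q)) s :=
    (hasDerivAt_startParam hsin).comp s hφ
  have hb : HasDerivAt (fun s => center (β s) (φ s))
      (-sin (β s) * p - (d * startParam (φ s) + neck (β s) (φ s) * (1 / sin (φ s) * (p + q)))) s :=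
    hβ.cos.sub (ha.mul ht)
  obtain ⟨l, hl⟩ : ∃ l, HasDerivAt (fun s => exitParam (β s) (φ s)) l s :=
    ⟨_, (harc.differentiableAt_leftRoot (a := fun s => neck (β s) (φ s))
      (b := fun s => center (β s) (φ s)) ha.differentiableAt hb.differentiableAt).hasDerivAt⟩
  have hev : (fun s => distSq (neck (β s) (φ s)) (center (β s) (φ s)) (exitParam (β s) (φ s)))
      =ᶠ[𝓝 s] fun _ => 1 :=
    harc.eventually_distSq_leftRoot (a := fun s => neck (β s) (φ s))
      (b := fun s => center (β s) (φ s)) ha.continuousAt hb.continuousAt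
  set R := neck (β s) (φ s) * cosh (startParam (φ s)) * (2 * p + q) +
    (startParam (φ s) - exitParam (β s) (φ s)) * d with hR
  set D := -R + neck (β s) (φ s) * l with hD
  have hH : HasDerivAt (fun s => exitHeight (β s) (φ s)) D s := by
    refine (hb.add (ha.mul hl)).congr_deriv ?_
    rw [hD, hR, cosh_startParam hsin, neck]
    field_simp
    ring
  have hE : neck (β s) (φ s) * cosh (exitParam (β s) (φ s)) *
      (d * cosh (exitParam (β s) (φ s)) +
        neck (β s) (φ s) * (sinh (exitParam (β s) (φ s)) * l)) +
      exitHeight (β s) (φ s) * D = 0 := by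
    have h1 := ((ha.mul hl.cosh).pow 2).add (hH.pow 2)
    have h2 := (h1.congr_of_eventuallyEq hev.symm).unique (hasDerivAt_const s (1 : ℝ))
    push_cast at h2
    simp only [Pi.mul_apply] at h2
    linarith
  have hS : HasDerivAt (fun s => exitSupport (β s) (φ s))
      (d - (D * (sinh (exitParam (β s) (φ s)) / cosh (exitParam (β s) (φ s))) +
        exitHeight (β s) (φ s) * (l / cosh (exitParam (β s) (φ s)) ^ 2))) s := by
    have h1 := (hasDerivAt_sinh_div_cosh (exitParam (β s) (φ s))).comp s hl
    refine (ha.sub (hH.mul h1)).congr_deriv ?_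
    simp only [Function.comp]
    ring
  obtain ⟨hRpos, hV⟩ := harc.variation_ineq hy (by rwa [support_startParam hsin]) hp hq hpq
    (d := d) (R := R) (by
      rw [height_startParam, sinh_startParam, cosh_startParam hsin, hd, neck]
      field_simp
      ring) hR
  obtain ⟨h1, h2⟩ := harc.variation_sign hRpos hV hD hE
  exact ⟨_, _, hH, hS, h1, h2⟩

/-- In the northern half-disc both the latitude and the angle at the lower end point of an arc
depend monotonically on the latitude and the angle at the upper one. -/
theorem exit_comparison {β₀ φ₀ β₁ φ₁ : ℝ} (h0 : IsStart β₀ φ₀) (h1 : IsStart β₁ φ₁)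
    (hβ : β₀ ≤ β₁) (hα : φ₀ - β₀ ≤ φ₁ - β₁) (hlt : φ₀ < φ₁) (hα1 : φ₁ - β₁ < π / 2)
    (hy : 0 ≤ exitHeight β₁ φ₁) :
    exitHeight β₁ φ₁ < exitHeight β₀ φ₀ ∧ exitSupport β₁ φ₁ ≤ exitSupport β₀ φ₀ := by
  -- The segment starts at the larger data, because only there the exit height is known to be
  -- nonnegative.
  set β : ℝ → ℝ := fun s => β₁ + s * (β₀ - β₁) with hβd
  set φ : ℝ → ℝ := fun s => φ₁ + s * (φ₀ - φ₁) with hφd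
  have hst : ∀ s ∈ Icc (0 : ℝ) 1, IsStart (β s) (φ s) := by
    intro s hs
    have e1 : β s = (1 - s) * β₁ + s * β₀ := by simp only [hβd]; ring
    have e2 : φ s = (1 - s) * φ₁ + s * φ₀ := by simp only [hφd]; ring
    have hs1 : 0 ≤ 1 - s := by linarith [hs.2]
    have k1 := h0.pos
    have k2 := h1.pos
    have k3 := h0.lt
    have k4 := h1.lt
    have k5 := h0.lt_pi
    have k6 := h1.lt_pi
    constructor
    · simp only [hβd]; nlinarith [hs.2, hs.1]
    · simp only [hβd, hφd]; nlinarith [hs.2, hs.1]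
    · simp only [hφd]; nlinarith [hs.2, hs.1]
  have hcos : ∀ s ∈ Icc (0 : ℝ) 1, 0 < cos (φ s - β s) := by
    intro s hs
    have k1 := (hst s hs).lt
    have k3 := h0.lt
    refine cos_pos_of_mem_Ioo ⟨by linarith [pi_pos], ?_⟩
    simp only [hβd, hφd]; nlinarith [hs.2, hs.1]
  have hdβ : ∀ s, HasDerivAt β (β₀ - β₁) s := fun s =>
    (((hasDerivAt_id s).mul_const (β₀ - β₁)).const_add β₁).congr_deriv (one_mul _)
  have hdφ : ∀ s, HasDerivAt φ (φ₀ - φ₁) s := fun s =>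
    (((hasDerivAt_id s).mul_const (φ₀ - φ₁)).const_add φ₁).congr_deriv (one_mul _)
  have hder : ∀ s ∈ Icc (0 : ℝ) 1, 0 ≤ exitHeight (β s) (φ s) →
      ∃ D e, HasDerivAt (fun s => exitHeight (β s) (φ s)) D s ∧
        HasDerivAt (fun s => exitSupport (β s) (φ s)) e s ∧ 0 < D ∧ 0 ≤ e := by
    intro s hs hys
    -- `IsStart.hasDerivAt_exit` asks for nonnegative velocities, so the segment is traversed
    -- backwards.
    have hn : HasDerivAt (fun u : ℝ => -u) (-1) (-s) := (hasDerivAt_neg (-s))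
    have hβ' : HasDerivAt (fun u => β (-u)) (β₁ - β₀) (-s) := by
      have := (show HasDerivAt β (β₀ - β₁) (-(-s)) from hdβ _).comp (-s) hn
      exact this.congr_deriv (by ring)
    have hφ' : HasDerivAt (fun u => φ (-u)) ((β₁ - β₀) + ((φ₁ - φ₀) - (β₁ - β₀))) (-s) := by
      have := (show HasDerivAt φ (φ₀ - φ₁) (-(-s)) from hdφ _).comp (-s) hn
      exact this.congr_deriv (by ring)
    obtain ⟨D, e, hD, he, hD0, he0⟩ := IsStart.hasDerivAt_exit (β := fun u => β (-u))
      (φ := fun u => φ (-u)) hβ' hφ' (by simpa using hst s hs) (by simpa using hys)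
      (by simpa using hcos s hs) (by linarith) (by linarith) (by linarith)
    refine ⟨-D, -e, ?_, ?_, by linarith, by linarith⟩
    · have := hD.comp s (hasDerivAt_neg s)
      simpa [Function.comp_def] using this
    · have := he.comp s (hasDerivAt_neg s)
      simpa [Function.comp_def] using this
  have hcontH : ContinuousOn (fun s => exitHeight (β s) (φ s)) (Icc 0 1) := fun s hs =>
    ((hst s hs).continuousAt_exitHeight (hdβ s).continuousAt
      (hdφ s).continuousAt).continuousWithinAt
  have hcontS : ContinuousOn (fun s => exitSupport (β s) (φ s)) (Icc 0 1) := fun s hs =>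
    ((hst s hs).continuousAt_exitSupport (hdβ s).continuousAt
      (hdφ s).continuousAt).continuousWithinAt
  -- The derivative signs are available only while the exit height is nonnegative. The set of such
  -- `s` is closed, contains `0`, and extends to the right of each of its points because the height
  -- increases there; so it is the whole segment.
  have hnonneg : Icc (0 : ℝ) 1 ⊆ {s | 0 ≤ exitHeight (β s) (φ s)} := by
    refine IsClosed.Icc_subset_of_forall_mem_nhdsWithin ?_ ?_ fun x hx => ?_
    · rw [inter_comm]
      exact hcontH.preimage_isClosed_of_isClosed isClosed_Icc isClosed_Ici
    · simpa [hβd, hφd] using hy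
    · obtain ⟨D, -, hD, -, hD0, -⟩ := hder x (Ico_subset_Icc_self hx.2) hx.1
      have h2 := (hasDerivAt_iff_tendsto_slope.1 hD).eventually (lt_mem_nhds hD0)
      have h3 : 𝓝[>] x ≤ 𝓝[≠] x := nhdsWithin_mono _ fun y hy => ne_of_gt hy
      filter_upwards [h2.filter_mono h3, self_mem_nhdsWithin] with y hy1 hy2
      rw [slope_def_field, div_pos_iff_of_pos_right (sub_pos.2 hy2)] at hy1
      have := hx.1
      simp only [mem_ofPred_eq] at this ⊢
      linarith
  have hH : StrictMonoOn (fun s => exitHeight (β s) (φ s)) (Icc 0 1) := by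
    refine strictMonoOn_of_deriv_pos (convex_Icc _ _) hcontH fun s hs => ?_
    have hs' := interior_subset hs
    obtain ⟨D, -, hD, -, hD0, -⟩ := hder s hs' (hnonneg hs')
    rwa [hD.deriv]
  have hS : MonotoneOn (fun s => exitSupport (β s) (φ s)) (Icc 0 1) := by
    refine monotoneOn_of_deriv_nonneg (convex_Icc _ _) hcontS (fun s hs => ?_) fun s hs => ?_
    all_goals
      have hs' := interior_subset hs
      obtain ⟨-, e, -, he, -, he0⟩ := hder s hs' (hnonneg hs')
    · exact he.differentiableAt.differentiableWithinAt
    · rwa [he.deriv]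
  have m0 : (0 : ℝ) ∈ Icc (0 : ℝ) 1 := ⟨le_rfl, zero_le_one⟩
  have m1 : (1 : ℝ) ∈ Icc (0 : ℝ) 1 := ⟨zero_le_one, le_rfl⟩
  have r1 := hH m0 m1 one_pos
  have r2 := hS m0 m1 zero_le_one
  simpa [hβd, hφd] using And.intro r1 r2

end CatConf

namespace CatConf

open Real Set Filter Topology

/-! ### Annuli and arcs -/

theorem norm_vec2 (x y : ℝ) : ‖(!₂[x, y] : EuclideanSpace ℝ (Fin 2))‖ = √(x ^ 2 + y ^ 2) := by
  rw [EuclideanSpace.norm_eq, Fin.sum_univ_two]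
  simp

theorem inner_vec2 (x y z w : ℝ) :
    inner ℝ (!₂[x, y] : EuclideanSpace ℝ (Fin 2)) !₂[z, w] = x * z + y * w := by
  simp [PiLp.inner_apply, Fin.sum_univ_two, mul_comm]

theorem angleEx_eq_arccos {a b β : ℝ} (hβ : sin β = a * cosh ((cos β - b) / a)) (ha : 0 < a) :
    angleEx a b β = arccos (support a b ((cos β - b) / a)) := by
  have hh : height a b ((cos β - b) / a) = cos β := by unfold height; field_simp; ring
  rw [angleEx, InnerProductGeometry.angle, inner_vec2, norm_vec2, norm_vec2, support, hh]
  have h1 : √((-cos β) ^ 2 + sin β ^ 2) = 1 := by rw [neg_sq, cos_sq_add_sin_sq, sqrt_one]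
  have hc := cosh_pos ((cos β - b) / a)
  have h2 : √(sinh ((cos β - b) / a) ^ 2 + 1 ^ 2) = cosh ((cos β - b) / a) := by
    rw [one_pow, ← Real.cosh_sq, sqrt_sq hc.le]
  rw [h1, h2, mul_one, hβ]
  congr 1
  field_simp
  ring

theorem angleIn_eq_angleEx (a b β : ℝ) : angleIn a b β = angleEx a b β := by
  rw [angleIn, angleEx, InnerProductGeometry.angle, InnerProductGeometry.angle]
  simp only [inner_vec2, norm_vec2]
  congr 1
  simp only [neg_sq]
  ring

namespace IsAnnulusBetween

variable {a b β β' : ℝ}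

theorem isArc (h : IsAnnulusBetween a b β β') :
    IsArc a b ((cos β' - b) / a) ((cos β - b) / a) := by
  have ha := h.neck_pos
  have hh : ∀ y, height a b ((y - b) / a) = y := fun y => by unfold height; field_simp; ring
  refine ⟨ha, ?_, ?_, ?_⟩
  · have := cos_lt_cos_of_nonneg_of_le_pi h.pos.le h.lt_pi.le h.lt
    exact div_lt_div_of_pos_right (by linarith) ha
  · rw [distSq, ← h.mem_ex, hh, sin_sq_add_cos_sq]
  · rw [distSq, ← h.mem_in, hh, sin_sq_add_cos_sq]

theorem height_in (h : IsAnnulusBetween a b β β') : height a b ((cos β - b) / a) = cos β := by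
  have ha := h.neck_pos
  unfold height; field_simp; ring

theorem height_ex (h : IsAnnulusBetween a b β β') : height a b ((cos β' - b) / a) = cos β' := by
  have ha := h.neck_pos
  unfold height; field_simp; ring

theorem angleIn_eq (h : IsAnnulusBetween a b β β') :
    angleIn a b β = arccos (support a b ((cos β - b) / a)) := by
  rw [angleIn_eq_angleEx, angleEx_eq_arccos h.mem_in h.neck_pos]

theorem angleEx_eq (h : IsAnnulusBetween a b β β') :
    angleEx a b β' = arccos (support a b ((cos β' - b) / a)) :=
  angleEx_eq_arccos h.mem_ex h.neck_pos

end IsAnnulusBetween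

namespace IsArc

variable {a b s₁ s₀ : ℝ}

theorem cos_arccos_right (h : IsArc a b s₁ s₀) : cos (arccos (support a b s₀)) = support a b s₀ := by
  have h1 := h.support_right_sq
  rw [cos_arccos] <;> nlinarith [sq_nonneg (radial a b s₀ / cosh s₀)]

theorem cos_arccos_left (h : IsArc a b s₁ s₀) : cos (arccos (support a b s₁)) = support a b s₁ := by
  have h1 := h.support_left_sq
  rw [cos_arccos] <;> nlinarith [sq_nonneg (radial a b s₁ / cosh s₁)]

theorem sin_arccos_right (h : IsArc a b s₁ s₀) :
    sin (arccos (support a b s₀)) = radial a b s₀ / cosh s₀ := by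
  have h1 := h.support_right_sq
  rw [sin_arccos, show 1 - support a b s₀ ^ 2 = (radial a b s₀ / cosh s₀) ^ 2 by linarith,
    sqrt_sq (div_pos h.radial_right_pos (cosh_pos _)).le]

theorem sin_arccos_left (h : IsArc a b s₁ s₀) :
    sin (arccos (support a b s₁)) = -radial a b s₁ / cosh s₁ := by
  have h1 := h.support_left_sq
  rw [sin_arccos, show 1 - support a b s₁ ^ 2 = (-radial a b s₁ / cosh s₁) ^ 2 by
    rw [neg_div, neg_sq]; linarith, sqrt_sq (div_pos (neg_pos.2 h.radial_left_neg)
      (cosh_pos _)).le]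

theorem angle_right_pos (h : IsArc a b s₁ s₀) : 0 < arccos (support a b s₀) := by
  refine lt_of_le_of_ne (arccos_nonneg _) fun h0 => ?_
  have h1 := h.sin_arccos_right
  rw [← h0, sin_zero] at h1
  exact (div_pos h.radial_right_pos (cosh_pos _)).ne h1

theorem angle_left_pos (h : IsArc a b s₁ s₀) : 0 < arccos (support a b s₁) := by
  refine lt_of_le_of_ne (arccos_nonneg _) fun h0 => ?_
  have h1 := h.sin_arccos_left
  rw [← h0, sin_zero] at h1
  exact (div_pos (neg_pos.2 h.radial_left_neg) (cosh_pos _)).ne h1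

theorem angle_right_lt_pi (h : IsArc a b s₁ s₀) : arccos (support a b s₀) < π := by
  refine lt_of_le_of_ne (arccos_le_pi _) fun h0 => ?_
  have h1 := h.sin_arccos_right
  rw [h0, sin_pi] at h1
  exact (div_pos h.radial_right_pos (cosh_pos _)).ne h1

end IsArc

namespace IsAnnulusBetween

variable {a b β β' : ℝ}

theorem angleIn_pos (h : IsAnnulusBetween a b β β') : 0 < angleIn a b β := by
  rw [h.angleIn_eq]; exact h.isArc.angle_right_pos

theorem angleEx_pos (h : IsAnnulusBetween a b β β') : 0 < angleEx a b β' := by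
  rw [h.angleEx_eq]; exact h.isArc.angle_left_pos

/-- The angle `β + α` is the direction of the downward tangent `(-sinh, -1) / cosh`, measured from
the outward horizontal. This and `sin_dir` identify an annulus with its initial data. -/
theorem cos_dir (h : IsAnnulusBetween a b β β') :
    cos (β + angleIn a b β) = -(sinh ((cos β - b) / a) / cosh ((cos β - b) / a)) := by
  have h1 := h.isArc.cos_arccos_right
  have h2 := h.isArc.sin_arccos_right
  rw [← h.angleIn_eq] at h1 h2
  have hc := (cosh_pos ((cos β - b) / a)).ne'
  have h4 := h.mem_in
  rw [cos_add, h1, h2, support, radial, h.height_in, div_eq_mul_inv, h4]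
  have h5 := sin_sq_add_cos_sq β
  rw [h4] at h5
  field_simp
  linear_combination -sinh ((cos β - b) / a) * h5

theorem sin_dir (h : IsAnnulusBetween a b β β') :
    sin (β + angleIn a b β) = 1 / cosh ((cos β - b) / a) := by
  have h1 := h.isArc.cos_arccos_right
  have h2 := h.isArc.sin_arccos_right
  rw [← h.angleIn_eq] at h1 h2
  have hc := (cosh_pos ((cos β - b) / a)).ne'
  have h4 := h.mem_in
  rw [sin_add, h1, h2, support, radial, h.height_in, h4]
  have h5 := sin_sq_add_cos_sq β
  rw [h4] at h5
  field_simp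
  linear_combination h5

theorem cos_dir_ex (h : IsAnnulusBetween a b β β') :
    cos (β' - angleEx a b β') = -(sinh ((cos β' - b) / a) / cosh ((cos β' - b) / a)) := by
  have h1 := h.isArc.cos_arccos_left
  have h2 := h.isArc.sin_arccos_left
  rw [← h.angleEx_eq] at h1 h2
  have hc := (cosh_pos ((cos β' - b) / a)).ne'
  have h4 := h.mem_ex
  rw [cos_sub, h1, h2, support, radial, h.height_ex, div_eq_mul_inv, h4]
  have h5 := sin_sq_add_cos_sq β'
  rw [h4] at h5
  field_simp
  linear_combination -sinh ((cos β' - b) / a) * h5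

theorem sin_dir_ex (h : IsAnnulusBetween a b β β') :
    sin (β' - angleEx a b β') = 1 / cosh ((cos β' - b) / a) := by
  have h1 := h.isArc.cos_arccos_left
  have h2 := h.isArc.sin_arccos_left
  rw [← h.angleEx_eq] at h1 h2
  have hc := (cosh_pos ((cos β' - b) / a)).ne'
  have h4 := h.mem_ex
  rw [sin_sub, h1, h2, support, radial, h.height_ex, h4]
  have h5 := sin_sq_add_cos_sq β'
  rw [h4] at h5
  field_simp
  linear_combination h5

/-- A priori the direction is only below `2π`; its sine is positive, so it is below `π`. -/
theorem isStart (h : IsAnnulusBetween a b β β') : IsStart β (β + angleIn a b β) := by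
  refine ⟨h.pos, by linarith [h.angleIn_pos], ?_⟩
  have h1 := h.sin_dir
  have h2 := cosh_pos ((cos β - b) / a)
  have h3 : angleIn a b β < π := by rw [h.angleIn_eq]; exact h.isArc.angle_right_lt_pi
  by_contra! h4
  have h5 : 0 < sin (β + angleIn a b β) := by rw [h1]; positivity
  have h6 : 0 ≤ sin (β + angleIn a b β - π) :=
    sin_nonneg_of_nonneg_of_le_pi (by linarith) (by linarith [h.lt, h.lt_pi])
  rw [sin_sub_pi] at h6
  linarith

/-- The width of an annulus is less than the sum of its two angles. -/
theorem sub_lt_add_angle (h : IsAnnulusBetween a b β β') :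
    β' < β + (angleIn a b β + angleEx a b β') := by
  have h1 : 0 < sin (β' - angleEx a b β') := by
    rw [h.sin_dir_ex]; have := cosh_pos ((cos β' - b) / a); positivity
  have hpos : 0 < β' := h.pos.trans h.lt
  have h2 : angleEx a b β' ≤ π := by rw [h.angleEx_eq]; exact arccos_le_pi _
  have h3 : 0 < β' - angleEx a b β' := by
    by_contra! h4
    have := sin_nonpos_of_nonpos_of_neg_pi_le h4 (by linarith)
    linarith
  by_contra! h4
  -- `β + α_in` and `β' - α_ex` are the tangent directions at the two ends, and they are strictly
  -- ordered because `tanh` increases along the meridian.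
  have h5 : cos (β' - angleEx a b β') ≤ cos (β + angleIn a b β) :=
    cos_le_cos_of_nonneg_of_le_pi (by linarith [h.isStart.pos, h.isStart.lt])
      (by linarith [h.lt_pi, h.angleEx_pos]) (by linarith)
  rw [h.cos_dir_ex, h.cos_dir] at h5
  have h7 := strictMono_sinh_div_cosh h.isArc.lt
  simp only at h7
  linarith

theorem startParam_eq (h : IsAnnulusBetween a b β β') :
    startParam (β + angleIn a b β) = (cos β - b) / a := by
  apply Real.sinh_injective
  have hc := (cosh_pos ((cos β - b) / a)).ne'
  rw [sinh_startParam, h.cos_dir, h.sin_dir]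
  field_simp

theorem neck_eq (h : IsAnnulusBetween a b β β') : neck β (β + angleIn a b β) = a := by
  have hc := (cosh_pos ((cos β - b) / a)).ne'
  rw [neck, h.sin_dir, h.mem_in]
  field_simp

theorem center_eq (h : IsAnnulusBetween a b β β') : center β (β + angleIn a b β) = b := by
  have ha := h.neck_pos.ne'
  rw [center, h.neck_eq, h.startParam_eq]
  field_simp
  ring

theorem exitParam_eq (h : IsAnnulusBetween a b β β') :
    exitParam β (β + angleIn a b β) = (cos β' - b) / a := by
  rw [exitParam, h.neck_eq, h.center_eq, h.isArc.leftRoot_eq]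

theorem exitHeight_eq (h : IsAnnulusBetween a b β β') :
    exitHeight β (β + angleIn a b β) = cos β' := by
  rw [exitHeight, h.neck_eq, h.center_eq, h.exitParam_eq, h.height_ex]

theorem arccos_exitHeight (h : IsAnnulusBetween a b β β') :
    arccos (exitHeight β (β + angleIn a b β)) = β' := by
  rw [h.exitHeight_eq, arccos_cos (h.pos.trans h.lt).le h.lt_pi.le]

theorem arccos_exitSupport (h : IsAnnulusBetween a b β β') :
    arccos (exitSupport β (β + angleIn a b β)) = angleEx a b β' := by
  rw [exitSupport, h.neck_eq, h.center_eq, h.exitParam_eq, h.angleEx_eq]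

end IsAnnulusBetween

namespace IsStart

variable {β φ : ℝ}

theorem startParam_eq (h : IsStart β φ) :
    (cos β - center β φ) / neck β φ = startParam φ := by
  have := h.neck_pos
  rw [center]; field_simp; ring

theorem sin_arccos_exitHeight (h : IsStart β φ) :
    sin (arccos (exitHeight β φ)) = neck β φ * cosh (exitParam β φ) := by
  have h1 := h.isArc.left
  have h2 : 0 < neck β φ * cosh (exitParam β φ) := mul_pos h.neck_pos (cosh_pos _)
  rw [distSq] at h1
  rw [sin_arccos, exitHeight, show 1 - height (neck β φ) (center β φ) (exitParam β φ) ^ 2 =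
    (neck β φ * cosh (exitParam β φ)) ^ 2 by linarith, sqrt_sq h2.le]

theorem abs_exitHeight_lt (h : IsStart β φ) : |exitHeight β φ| < 1 := by
  have h1 := h.isArc.left
  have h2 : 0 < neck β φ * cosh (exitParam β φ) := mul_pos h.neck_pos (cosh_pos _)
  rw [← sq_lt_one_iff_abs_lt_one]
  unfold exitHeight
  unfold distSq at h1
  nlinarith

theorem cos_arccos_exitHeight (h : IsStart β φ) : cos (arccos (exitHeight β φ)) = exitHeight β φ := by
  have := abs_lt.1 h.abs_exitHeight_lt
  exact cos_arccos this.1.le this.2.le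

theorem isAnnulusBetween (h : IsStart β φ) :
    IsAnnulusBetween (neck β φ) (center β φ) β (arccos (exitHeight β φ)) := by
  have ha := h.neck_pos
  have h1 := abs_lt.1 h.abs_exitHeight_lt
  have h2 : exitHeight β φ < cos β := by
    rw [← height_startParam β φ]; exact h.isArc.height_lt
  refine ⟨ha, h.pos, ?_, ?_, ?_, ?_⟩
  · have h3 := strictAntiOn_arccos ⟨h1.1.le, h1.2.le⟩ ⟨neg_one_le_cos _, cos_le_one _⟩ h2
    rwa [arccos_cos h.pos.le (h.lt.trans h.lt_pi).le] at h3
  · refine lt_of_le_of_ne (arccos_le_pi _) fun h3 => ?_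
    rw [arccos_eq_pi] at h3; linarith
  · rw [h.startParam_eq, neck_mul_cosh_startParam h.sin_dir_pos]
  · rw [h.cos_arccos_exitHeight, h.sin_arccos_exitHeight]
    congr 2
    unfold exitHeight height
    field_simp
    ring

theorem angleIn_eq (h : IsStart β φ) : angleIn (neck β φ) (center β φ) β = φ - β := by
  rw [h.isAnnulusBetween.angleIn_eq, h.startParam_eq, support_startParam h.sin_dir_pos,
    arccos_cos (by linarith [h.lt]) (by linarith [h.pos, h.lt_pi])]

theorem angleEx_eq (h : IsStart β φ) :
    angleEx (neck β φ) (center β φ) (arccos (exitHeight β φ)) = arccos (exitSupport β φ) := by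
  have h1 := h.isAnnulusBetween.arccos_exitSupport
  rw [h.angleIn_eq] at h1
  rw [← h1]; congr 2; ring

end IsStart

end CatConf

namespace CatConf

open Real Set Filter Topology

/-! ### The sequence of circles and angles determined by the first latitude -/

/-- The latitudes and lower angles `(β_{n+1}, α_{n+1}⁺)` of the configuration with first latitude
`x` and unbalancing parameters `s 0, s 1, …`. -/
noncomputable def orbit (s : ℕ → ℝ) (x : ℝ) : ℕ → ℝ × ℝ
  | 0 => (x, exp (s 0) * x)
  | n + 1 =>
    (arccos (exitHeight (orbit s x n).1 ((orbit s x n).1 + (orbit s x n).2)),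
      exp (s (n + 1)) *
        arccos (exitSupport (orbit s x n).1 ((orbit s x n).1 + (orbit s x n).2)))

/-- The parameters `s` are summable with sum less than `log (7 / 4)`. -/
def IsSmall (s : ℕ → ℝ) : Prop :=
  ∃ M, exp M < 7 / 4 ∧ ∀ n, ∑ j ∈ Finset.range n, |s j| ≤ M

/-- The first `n + 1` circles lie in the closed northern hemisphere. -/
structure IsAdmissible (s : ℕ → ℝ) (n : ℕ) (x : ℝ) : Prop where
  pos : 0 < x
  lt : x < 2 * π / 7
  le : ∀ i ≤ n, (orbit s x i).1 ≤ π / 2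

theorem IsAdmissible.of_le {s : ℕ → ℝ} {n m : ℕ} {x : ℝ} (h : IsAdmissible s n x) (hm : m ≤ n) :
    IsAdmissible s m x :=
  ⟨h.pos, h.lt, fun i hi => h.le i (hi.trans hm)⟩

/-- The next angle does not exceed the given one in the northern half-disc. -/
theorem IsStart.arccos_exitSupport_le {β φ : ℝ} (h : IsStart β φ) (hα : φ - β < π / 2)
    (hy : 0 ≤ exitHeight β φ) : arccos (exitSupport β φ) ≤ φ - β := by
  have h1 : 0 < cos (φ - β) := cos_pos_of_mem_Ioo ⟨by linarith [h.lt, pi_pos], hα⟩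
  have h2 := h.isArc.support_right_le_left hy (by rwa [support_startParam h.sin_dir_pos])
  rw [support_startParam h.sin_dir_pos] at h2
  have h3 := antitone_arccos h2
  rwa [arccos_cos (by linarith [h.lt]) (by linarith [pi_pos])] at h3

theorem IsStart.arccos_exitSupport_pos {β φ : ℝ} (h : IsStart β φ) :
    0 < arccos (exitSupport β φ) := h.isArc.angle_left_pos

namespace IsAdmissible

variable {s : ℕ → ℝ} {n : ℕ} {x : ℝ}

/-- Crossing an annulus does not increase the angle, and passing a circle multiplies it by `exp (s
n)`, so the growth is controlled by the sum of the `|s j|`. -/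
theorem orbit_bounds (hs : IsSmall s) (h : IsAdmissible s n x) :
    x ≤ (orbit s x n).1 ∧ 0 < (orbit s x n).2 ∧
      (orbit s x n).2 ≤ exp (∑ j ∈ Finset.range (n + 1), |s j|) * x ∧
      (orbit s x n).2 ≤ 7 / 4 * x ∧ (orbit s x n).2 < π / 2 ∧
      IsStart (orbit s x n).1 ((orbit s x n).1 + (orbit s x n).2) := by
  obtain ⟨M, hM, hsM⟩ := hs
  have hx := h.pos
  have key : x ≤ (orbit s x n).1 ∧ 0 < (orbit s x n).2 ∧
      (orbit s x n).2 ≤ exp (∑ j ∈ Finset.range (n + 1), |s j|) * x →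
      (orbit s x n).2 ≤ 7 / 4 * x ∧ (orbit s x n).2 < π / 2 ∧
      IsStart (orbit s x n).1 ((orbit s x n).1 + (orbit s x n).2) := by
    rintro ⟨h1, h2, h3⟩
    have h4 : exp (∑ j ∈ Finset.range (n + 1), |s j|) ≤ 7 / 4 :=
      (exp_le_exp.2 (hsM _)).trans hM.le
    have h5 : (orbit s x n).2 ≤ 7 / 4 * x := h3.trans (mul_le_mul_of_nonneg_right h4 hx.le)
    -- The bounds `7 / 4` and `2π / 7` are matched: their product is `π / 2`.
    have h6 : (orbit s x n).2 < π / 2 := by linarith [h.lt]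
    exact ⟨h5, h6, by linarith, by linarith, by linarith [h.le n le_rfl]⟩
  suffices h0 : x ≤ (orbit s x n).1 ∧ 0 < (orbit s x n).2 ∧
      (orbit s x n).2 ≤ exp (∑ j ∈ Finset.range (n + 1), |s j|) * x from
    ⟨h0.1, h0.2.1, h0.2.2, key h0⟩
  clear key
  induction n with
  | zero =>
    refine ⟨le_rfl, mul_pos (exp_pos _) hx, ?_⟩
    simp only [zero_add, Finset.sum_range_one, orbit]
    exact mul_le_mul_of_nonneg_right (exp_le_exp.2 (le_abs_self _)) hx.le
  | succ n ih =>
    obtain ⟨h1, h2, h3⟩ := ih (h.of_le n.le_succ)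
    have h4 : exp (∑ j ∈ Finset.range (n + 1), |s j|) ≤ 7 / 4 :=
      (exp_le_exp.2 (hsM _)).trans hM.le
    have h5 : (orbit s x n).2 ≤ 7 / 4 * x := h3.trans (mul_le_mul_of_nonneg_right h4 hx.le)
    have h6 : (orbit s x n).2 < π / 2 := by linarith [h.lt]
    have hst : IsStart (orbit s x n).1 ((orbit s x n).1 + (orbit s x n).2) :=
      ⟨by linarith, by linarith, by linarith [h.le n n.le_succ]⟩
    have hy := h.le (n + 1) le_rfl
    simp only [orbit] at hy
    rw [arccos_le_pi_div_two] at hy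
    have h7 := hst.arccos_exitSupport_le (by linarith) hy
    have h8 := hst.arccos_exitSupport_pos
    have h9 := hst.isAnnulusBetween.lt
    simp only [add_sub_cancel_left] at h7
    simp only [orbit]
    refine ⟨by linarith, mul_pos (exp_pos _) h8, ?_⟩
    rw [Finset.sum_range_succ, Real.exp_add]
    calc _ ≤ exp |s (n + 1)| * (exp (∑ j ∈ Finset.range (n + 1), |s j|) * x) :=
          mul_le_mul (exp_le_exp.2 (le_abs_self _)) (h7.trans h3) h8.le (exp_pos _).le
      _ = _ := by ring

theorem isStart (hs : IsSmall s) (h : IsAdmissible s n x) :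
    IsStart (orbit s x n).1 ((orbit s x n).1 + (orbit s x n).2) :=
  (h.orbit_bounds hs).2.2.2.2.2

theorem lat_lt_succ (hs : IsSmall s) (h : IsAdmissible s n x) :
    (orbit s x n).1 < (orbit s x (n + 1)).1 :=
  (h.isStart hs).isAnnulusBetween.lt

theorem lat_succ_lt (hs : IsSmall s) (h : IsAdmissible s (n + 1) x) :
    (orbit s x (n + 1)).1 < (orbit s x n).1 + 2 * (orbit s x n).2 := by
  have hn := h.of_le n.le_succ
  have hst := hn.isStart hs
  obtain ⟨-, -, -, -, h6, -⟩ := hn.orbit_bounds hs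
  have hy := h.le (n + 1) le_rfl
  simp only [orbit] at hy
  rw [arccos_le_pi_div_two] at hy
  have h1 := hst.isAnnulusBetween.sub_lt_add_angle
  rw [hst.angleIn_eq, hst.angleEx_eq] at h1
  have h7 := hst.arccos_exitSupport_le (by linarith) hy
  simp only [orbit]
  linarith

theorem lat_lt (hs : IsSmall s) (h : IsAdmissible s n x) {i : ℕ} (hi : i < n) :
    (orbit s x i).1 < π / 2 :=
  ((h.of_le hi.le).lat_lt_succ hs).trans_le (h.le (i + 1) hi)

/-- Induction with `exit_comparison`: the larger orbit exits in the northern half, and the smaller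
one lies above it, hence is admissible too. -/
theorem comparison (hs : IsSmall s) {x' : ℝ} (hx : 0 < x) (hlt : x < x')
    (h : IsAdmissible s n x') :
    IsAdmissible s n x ∧ (orbit s x n).1 < (orbit s x' n).1 ∧
      (orbit s x n).2 ≤ (orbit s x' n).2 := by
  induction n with
  | zero =>
    have h1 := h.le 0 le_rfl
    simp only [orbit] at h1 ⊢
    refine ⟨⟨hx, hlt.trans h.lt, fun i hi => ?_⟩, hlt,
      mul_le_mul_of_nonneg_left hlt.le (exp_pos _).le⟩
    obtain rfl : i = 0 := by omega
    simp only [orbit]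
    linarith
  | succ n ih =>
    have hn' := h.of_le n.le_succ
    obtain ⟨hn, h1, h2⟩ := ih hn'
    have hy := h.le (n + 1) le_rfl
    simp only [orbit] at hy
    rw [arccos_le_pi_div_two] at hy
    obtain ⟨-, -, -, -, h6, hst'⟩ := hn'.orbit_bounds hs
    have hst := hn.isStart hs
    obtain ⟨r1, r2⟩ := exit_comparison hst hst' h1.le (by linarith) (by linarith)
      (by linarith) hy
    have k1 := abs_lt.1 hst.abs_exitHeight_lt
    have k2 := abs_lt.1 hst'.abs_exitHeight_lt
    have h3 : (orbit s x (n + 1)).1 < (orbit s x' (n + 1)).1 :=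
      strictAntiOn_arccos ⟨k2.1.le, k2.2.le⟩ ⟨k1.1.le, k1.2.le⟩ r1
    refine ⟨⟨hx, hlt.trans h.lt, fun i hi => ?_⟩, h3, ?_⟩
    · rcases Nat.le_succ_iff.1 hi with hi' | rfl
      · exact hn.le i hi'
      · exact h3.le.trans (h.le _ le_rfl)
    · simp only [orbit]
      exact mul_le_mul_of_nonneg_left (antitone_arccos r2) (exp_pos _).le

/-- One index beyond the admissible range is included: the next circle varies continuously even when
it has passed the equator, as the intermediate value argument requires. -/
theorem continuousAt_succ (hs : IsSmall s) (h : IsAdmissible s n x) :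
    ContinuousAt (fun x => (orbit s x (n + 1)).1) x ∧
      ContinuousAt (fun x => (orbit s x (n + 1)).2) x := by
  suffices h0 : ∀ m ≤ n + 1, ContinuousAt (fun x => (orbit s x m).1) x ∧
      ContinuousAt (fun x => (orbit s x m).2) x from h0 _ le_rfl
  intro m
  induction m with
  | zero => intro _; simp only [orbit]; constructor <;> fun_prop
  | succ m ih =>
    intro hm
    obtain ⟨h1, h2⟩ := ih (by omega)
    have hst := (h.of_le (show m ≤ n by omega)).isStart hs
    have h3 := hst.continuousAt_exitHeight (β := fun x => (orbit s x m).1)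
      (φ := fun x => (orbit s x m).1 + (orbit s x m).2) h1 (h1.add h2)
    have h4 := hst.continuousAt_exitSupport (β := fun x => (orbit s x m).1)
      (φ := fun x => (orbit s x m).1 + (orbit s x m).2) h1 (h1.add h2)
    have h5 := continuous_arccos
    simp only [orbit]
    exact ⟨h5.continuousAt.comp h3, continuousAt_const.mul (h5.continuousAt.comp h4)⟩

end IsAdmissible

/-! ### Exit side of the equator and orbits with small first latitude -/

theorem one_add_sq_div_two_le_cosh (u : ℝ) : 1 + u ^ 2 / 2 ≤ cosh u := by
  have h1 := sq_le_sinh_sq (u / 2)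
  have h2 := Real.cosh_two_mul (u / 2)
  have h3 := Real.cosh_sq (u / 2)
  rw [mul_div_cancel₀ _ two_ne_zero] at h2
  rw [h2, h3]; nlinarith

/-- The meridian crosses height zero at parameter `-(b / a)`, at distance `a cosh (b / a)` from the
axis. If this exceeds one, the arc must end before reaching the equatorial plane. -/
theorem IsArc.height_left_pos {a b s₁ s₀ : ℝ} (h : IsArc a b s₁ s₀) (h0 : 0 < height a b s₀)
    (h1 : 1 < a * cosh (b / a)) : 0 < height a b s₁ := by
  have ha := h.pos
  have hz : height a b (-(b / a)) = 0 := by unfold height; field_simp; ring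
  by_contra! h2
  have h3 : s₁ ≤ -(b / a) := by
    rw [← (strictMono_height b ha).le_iff_le, hz]; exact h2
  have h4 : -(b / a) ≤ s₀ := by
    rw [← (strictMono_height b ha).le_iff_le, hz]; exact h0.le
  have h5 := h.neck_mul_cosh_le ⟨h3, h4⟩
  rw [cosh_neg] at h5
  linarith

theorem IsArc.height_left_neg {a b s₁ s₀ : ℝ} (h : IsArc a b s₁ s₀)
    (h1 : a * cosh (b / a) < 1) : height a b s₁ < 0 := by
  have ha := h.pos
  have hz : height a b (-(b / a)) = 0 := by unfold height; field_simp; ring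
  have h2 : distSq a b (-(b / a)) < 1 := by
    rw [distSq, hz, cosh_neg]
    have : 0 < a * cosh (b / a) := mul_pos ha (cosh_pos _)
    nlinarith
  have h3 := ((h.mem_Icc_iff _).1 h2.le).1
  have h4 : s₁ ≠ -(b / a) := by
    rintro rfl; rw [h.left] at h2; exact lt_irrefl _ h2
  rw [← hz]
  exact strictMono_height b ha (lt_of_le_of_ne h3 h4)

theorem startParam_nonpos {φ : ℝ} (h0 : 0 < φ) (h1 : φ ≤ π / 2) : startParam φ ≤ 0 := by
  rw [← sinh_nonpos_iff, sinh_startParam]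
  have h2 := cos_nonneg_of_mem_Icc (x := φ) ⟨by linarith [pi_pos], h1⟩
  have h3 := sin_pos_of_pos_of_lt_pi h0 (by linarith [pi_pos])
  have : 0 ≤ cos φ / sin φ := by positivity
  linarith

theorem IsStart.cos_le_center {β φ : ℝ} (h : IsStart β φ) (h1 : φ ≤ π / 2) :
    cos β ≤ center β φ := by
  have h2 := startParam_nonpos (h.pos.trans h.lt) h1
  have h3 := h.neck_pos
  unfold center
  nlinarith

theorem cos_of_le_quarter {β : ℝ} (h0 : 0 < β) (h : β ≤ 1 / 4) : 15 / 16 ≤ cos β ∧ sin β ≤ 1 / 4 := by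
  have h1 := Real.one_sub_sq_div_two_le_cos (x := β)
  have h2 := sin_le h0.le
  constructor <;> nlinarith

/-- Here `a ≤ 1 / 4` and `b ≥ 15 / 16`, so `a cosh (b / a) ≥ a + b ^ 2 / (2 a) > 1`. -/
theorem IsStart.exitHeight_pos {β φ : ℝ} (h : IsStart β φ) (hβ : β ≤ 1 / 4) (h1 : φ ≤ π / 2) :
    0 < exitHeight β φ := by
  obtain ⟨h2, h3⟩ := cos_of_le_quarter h.pos hβ
  have h4 := h.cos_le_center h1
  have ha := h.neck_pos
  refine h.isArc.height_left_pos (by rw [height_startParam]; linarith) ?_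
  have h5 : neck β φ ≤ 1 / 4 := by
    have := sin_le_one φ
    have := h.sin_lat_pos
    have := h.sin_dir_pos
    unfold neck; nlinarith
  have h6 := one_add_sq_div_two_le_cosh (center β φ / neck β φ)
  have h7 : neck β φ * (1 + (center β φ / neck β φ) ^ 2 / 2) =
      neck β φ + center β φ ^ 2 / (2 * neck β φ) := by field_simp
  have h8 : 1 ≤ center β φ ^ 2 / (2 * neck β φ) := by
    rw [le_div_iff₀ (by positivity)]; nlinarith
  have h9 := mul_le_mul_of_nonneg_left h6 ha.le
  linarith

/-- Each latitude increment is less than twice an angle of size at most `7 / 4 * x`, hence less than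
`4 * x`; up to latitude `1 / 4` the next circle is still in the north. -/
theorem isAdmissible_of_small {s : ℕ → ℝ} (hs : IsSmall s) (n : ℕ) {x : ℝ} (hx : 0 < x)
    (h : (4 * n + 1) * x ≤ 1 / 4) :
    IsAdmissible s n x ∧ (orbit s x n).1 ≤ (4 * n + 1) * x := by
  induction n with
  | zero =>
    have h1 : x ≤ 1 / 4 := by simpa using h
    have h2 : (orbit s x 0).1 = x := rfl
    have h3 := pi_gt_three
    refine ⟨⟨hx, by linarith, fun i hi => ?_⟩, by simp [h2]⟩
    obtain rfl : i = 0 := by omega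
    linarith
  | succ n ih =>
    push_cast at h ⊢
    obtain ⟨h1, h2⟩ := ih (by nlinarith)
    obtain ⟨-, h4, -, h5, -, hst⟩ := h1.orbit_bounds hs
    have h3 := pi_gt_three
    have hn : (0 : ℝ) ≤ n := n.cast_nonneg
    have h6 : (orbit s x n).1 ≤ 1 / 4 := by nlinarith
    have h7 : x ≤ 1 / 4 := by nlinarith
    have h8 := hst.exitHeight_pos h6 (by linarith)
    have h9 : (orbit s x (n + 1)).1 ≤ π / 2 := by
      simp only [orbit]; rw [arccos_le_pi_div_two]; exact h8.le
    have h10 : IsAdmissible s (n + 1) x := by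
      refine ⟨hx, h1.lt, fun i hi => ?_⟩
      rcases Nat.le_succ_iff.1 hi with hi' | rfl
      · exact h1.le i hi'
      · exact h9
    refine ⟨h10, ?_⟩
    have := h10.lat_succ_lt hs
    linarith

end CatConf

namespace CatConf

open Real Set Filter Topology

/-! ### Existence -/

theorem sinh_le_mul_cosh {t : ℝ} (ht : 0 ≤ t) : sinh t ≤ t * cosh t := by
  have hd : ∀ t, HasDerivAt (fun t => t * cosh t - sinh t) (t * sinh t) t := fun t =>
    (((hasDerivAt_id t).mul (Real.hasDerivAt_cosh t)).sub (Real.hasDerivAt_sinh t)).congr_deriv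
      (by simp)
  have hm : MonotoneOn (fun t => t * cosh t - sinh t) (Ici 0) := by
    refine monotoneOn_of_hasDerivWithinAt_nonneg (convex_Ici _)
      (fun t _ => (hd t).continuousAt.continuousWithinAt)
      (fun t _ => (hd t).hasDerivWithinAt) fun t ht => ?_
    rw [interior_Ici] at ht
    exact mul_nonneg (le_of_lt ht) (sinh_nonneg_iff.2 (le_of_lt ht))
  have := hm self_mem_Ici ht ht
  simp at this
  linarith

/-- A first latitude for which the second circle lies in the southern hemisphere when the
unbalancing is small. -/
noncomputable def baseLat : ℝ := arccos (16 / 25)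

theorem cos_baseLat : cos baseLat = 16 / 25 := cos_arccos (by norm_num) (by norm_num)

theorem sin_baseLat_sq : sin baseLat ^ 2 = 369 / 625 := by
  rw [sin_sq, cos_baseLat]; norm_num

theorem baseLat_pos : 0 < baseLat := by
  rw [baseLat, arccos_pos]; norm_num

theorem baseLat_lt : baseLat < 2 * π / 7 := by
  have h1 := pi_gt_d2
  have h0 := pi_le_four
  have h2 : cos (2 * π / 7) < 16 / 25 := by
    -- `0.897` is just below `2 * 3.14 / 7`, and the Taylor bound for its cosine is already below
    -- `16 / 25`.
    have h3 : cos (2 * π / 7) ≤ cos (0.897 : ℝ) :=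
      cos_le_cos_of_nonneg_of_le_pi (by norm_num) (by linarith) (by linarith)
    have h4 := abs_le.1 (cos_bound (x := 0.897) (by norm_num [abs_le]))
    have h5 : |(0.897 : ℝ)| = 0.897 := abs_of_pos (by norm_num)
    rw [h5] at h4
    have := h4.2
    norm_num at this ⊢
    linarith
  have h3 := strictAntiOn_arccos (a := cos (2 * π / 7)) (b := 16 / 25)
    ⟨neg_one_le_cos _, cos_le_one _⟩ ⟨by norm_num, by norm_num⟩ h2
  rwa [arccos_cos (by linarith) (by linarith)] at h3

/-- Without unbalancing, the first direction is twice the latitude. By `IsArc.height_left_neg` the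
inequality puts the second circle in the southern hemisphere. The value `cos baseLat = 16 / 25`
makes the neck rational. -/
theorem neck_mul_cosh_baseLat :
    neck baseLat (2 * baseLat) *
      cosh (center baseLat (2 * baseLat) / neck baseLat (2 * baseLat)) < 1 := by
  have hlt := baseLat_lt
  have hpos := baseLat_pos
  have h1 : 0 < sin baseLat := sin_pos_of_pos_of_lt_pi hpos (by linarith [pi_pos])
  have h2 := sin_baseLat_sq
  have h3 : sin (2 * baseLat) = 32 / 25 * sin baseLat := by
    rw [sin_two_mul, cos_baseLat]; ring
  have h4 : cos (2 * baseLat) = -(113 / 625) := by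
    rw [cos_two_mul, cos_baseLat]; norm_num
  have h5 : 0.768 < sin baseLat := by nlinarith
  have h6 : 0 < sin (2 * baseLat) := by rw [h3]; positivity
  have ha : neck baseLat (2 * baseLat) = 11808 / 15625 := by
    rw [neck, h3]; nlinarith
  set t := startParam (2 * baseLat) with ht
  have h7 : sinh t = 113 / 625 / sin (2 * baseLat) := by
    rw [ht, sinh_startParam, h4]; ring
  have h8 : cosh t = 1 / sin (2 * baseLat) := cosh_startParam h6
  have h9 : 0 ≤ t := by
    rw [← sinh_nonneg_iff, h7]; positivity
  -- This is `tanh t ≤ t`, since `tanh t = -cos (2 * baseLat)`.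
  have h10 : 113 / 625 ≤ t := by
    have := sinh_le_mul_cosh h9
    rw [h7, h8, mul_one_div, div_le_div_iff_of_pos_right h6] at this
    exact this
  have h11 : t ≤ 1 / 5 := by
    have h12 := self_le_sinh_iff.2 h9
    rw [h7, h3, le_div_iff₀ (by positivity)] at h12
    nlinarith
  have hb : center baseLat (2 * baseLat) = 16 / 25 - 11808 / 15625 * t := by
    rw [center, ha, cos_baseLat]
  rw [ha, hb]
  have h13 := cosh_le_exp_half_sq ((16 / 25 - 11808 / 15625 * t) / (11808 / 15625))
  have h14 : ((16 / 25 - 11808 / 15625 * t) / (11808 / 15625)) ^ 2 / 2 ≤ 1 / 4 := by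
    have h15 : (16 / 25 - 11808 / 15625 * t) / (11808 / 15625) ≤ 0.7 := by
      rw [div_le_iff₀ (by norm_num)]; norm_num; linarith
    have h16 : 0 ≤ (16 / 25 - 11808 / 15625 * t) / (11808 / 15625) :=
      div_nonneg (by linarith) (by norm_num)
    nlinarith
  have h15 : exp (1 / 4) < 1.3 := by
    have h16 : exp (1 / 4) ^ 4 = exp 1 := by rw [← Real.exp_nat_mul]; norm_num
    have h17 := Real.exp_one_lt_d9
    by_contra! h18
    have : (1.3 : ℝ) ^ 4 ≤ exp (1 / 4) ^ 4 := pow_le_pow_left₀ (by norm_num) h18 4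
    rw [h16] at this
    norm_num at this
    linarith
  have h16 := h13.trans (exp_le_exp.2 h14)
  nlinarith

/-- The strict inequality at `baseLat` is an open condition, and the second circle depends on the
unbalancing only through `s 0`. -/
theorem exists_base : ∃ δ : ℝ, 0 < δ ∧ ∀ s : ℕ → ℝ, IsSmall s → |s 0| < δ →
    IsAdmissible s 0 baseLat ∧ π / 2 ≤ (orbit s baseLat 1).1 := by
  set φ : ℝ → ℝ := fun u => baseLat + exp u * baseLat with hφ
  have hc : ContinuousAt φ 0 := by simp only [hφ]; fun_prop
  have hφ0 : φ 0 = 2 * baseLat := by simp only [hφ, Real.exp_zero]; ring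
  have hlt := baseLat_lt
  have hpos := baseLat_pos
  have hpi := pi_pos
  have hst : IsStart baseLat (φ 0) := by rw [hφ0]; exact ⟨hpos, by linarith, by linarith⟩
  have hn := continuousAt_neck (β := fun _ => baseLat) continuousAt_const hc
  have hce := continuousAt_center (β := fun _ => baseLat) continuousAt_const hc hst.sin_dir_pos
  have hcont : ContinuousAt (fun u => neck baseLat (φ u) *
      cosh (center baseLat (φ u) / neck baseLat (φ u))) 0 :=
    hn.mul (Real.continuous_cosh.continuousAt.comp (hce.div hn hst.neck_pos.ne'))
  have h1 : neck baseLat (φ 0) * cosh (center baseLat (φ 0) / neck baseLat (φ 0)) < 1 := by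
    rw [hφ0]; exact neck_mul_cosh_baseLat
  obtain ⟨δ, hδ, hδ'⟩ := Metric.eventually_nhds_iff.1 (hcont.eventually (gt_mem_nhds h1))
  refine ⟨δ, hδ, fun s hs h => ?_⟩
  have h2 := hδ' (y := s 0) (by simpa using h)
  have hadm : IsAdmissible s 0 baseLat := by
    refine ⟨hpos, hlt, fun i hi => ?_⟩
    obtain rfl : i = 0 := by omega
    simp only [orbit]; linarith
  refine ⟨hadm, ?_⟩
  have h3 := (hadm.isStart hs).isArc.height_left_neg h2
  simp only [orbit]
  rw [← not_lt, arccos_lt_pi_div_two, not_lt]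
  exact h3.le

namespace IsAdmissible

variable {s : ℕ → ℝ} {n : ℕ} {X : ℝ}

/-- The interval on which the intermediate value theorem is applied. -/
theorem exists_small (hs : IsSmall s) (h : IsAdmissible s n X) (m : ℕ) :
    ∃ ε, 0 < ε ∧ ε ≤ X ∧ (4 * m + 1) * ε ≤ 1 / 4 ∧ ∀ x ∈ Icc ε X, IsAdmissible s n x := by
  have hm : (0 : ℝ) < 4 * m + 1 := by positivity
  refine ⟨min X (1 / 4 / (4 * m + 1)), lt_min h.pos (by positivity), min_le_left _ _, ?_,
    fun x hx => ?_⟩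
  · have := min_le_right X (1 / 4 / (4 * m + 1))
    rwa [le_div_iff₀ hm, mul_comm] at this
  · rcases hx.2.eq_or_lt with rfl | hlt
    · exact h
    · exact (h.comparison hs ((lt_min h.pos (by positivity)).trans_le hx.1) hlt).1

theorem exists_threshold (hs : IsSmall s) (h : IsAdmissible s n X)
    (hX : π / 2 ≤ (orbit s X (n + 1)).1) :
    ∃ T, IsAdmissible s (n + 1) T ∧ (orbit s T (n + 1)).1 = π / 2 := by
  obtain ⟨ε, hε, hεX, hsm, hI⟩ := h.exists_small hs (n + 1)
  have hcont : ContinuousOn (fun x => (orbit s x (n + 1)).1) (Icc ε X) := fun x hx =>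
    ((hI x hx).continuousAt_succ hs).1.continuousWithinAt
  have hle := (isAdmissible_of_small hs (n + 1) hε hsm).1.le (n + 1) le_rfl
  obtain ⟨T, hT, hT'⟩ := intermediate_value_Icc hεX hcont ⟨hle, hX⟩
  have hadm := hI T hT
  refine ⟨T, ⟨hadm.pos, hadm.lt, fun i hi => ?_⟩, hT'⟩
  rcases Nat.le_succ_iff.1 hi with hi' | rfl
  · exact hadm.le i hi'
  · exact hT'.le

end IsAdmissible

/-- A first latitude that puts one circle on the equator sends the next one strictly beyond it,
which is the hypothesis of `exists_threshold` at the next index. -/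
theorem exists_lat_eq_half_pi {s : ℕ → ℝ} (hs : IsSmall s) {X : ℝ} (h : IsAdmissible s 0 X)
    (hX : π / 2 ≤ (orbit s X 1).1) (n : ℕ) :
    ∃ T, IsAdmissible s (n + 1) T ∧ (orbit s T (n + 1)).1 = π / 2 := by
  induction n with
  | zero => exact h.exists_threshold hs hX
  | succ n ih =>
    obtain ⟨T, hT, hT'⟩ := ih
    exact hT.exists_threshold hs (hT' ▸ (hT.lat_lt_succ hs).le)

/-- A zero of `center` makes the next annulus symmetric about the equatorial plane. For tiny `x` the
downward tangent does not point inwards and `center ≥ cos β > 0`; at `T` the circle is on the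
equator, `cos β = 0`, and the tangent points inwards, so `center < 0`. -/
theorem exists_center_eq_zero {s : ℕ → ℝ} (hs : IsSmall s) {n : ℕ} {T : ℝ}
    (h : IsAdmissible s (n + 1) T) (hT : (orbit s T (n + 1)).1 = π / 2) :
    ∃ x, IsAdmissible s (n + 1) x ∧ (orbit s x (n + 1)).1 < π / 2 ∧
      center (orbit s x (n + 1)).1 ((orbit s x (n + 1)).1 + (orbit s x (n + 1)).2) = 0 := by
  obtain ⟨ε, hε, hεX, hsm, hI⟩ := h.exists_small hs (n + 1)
  have hcont : ContinuousOn (fun x => center (orbit s x (n + 1)).1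
      ((orbit s x (n + 1)).1 + (orbit s x (n + 1)).2)) (Icc ε T) := fun x hx => by
    obtain ⟨h1, h2⟩ := ((hI x hx).of_le n.le_succ).continuousAt_succ hs
    exact (continuousAt_center (β := fun x => (orbit s x (n + 1)).1)
      (φ := fun x => (orbit s x (n + 1)).1 + (orbit s x (n + 1)).2) h1 (h1.add h2)
      ((hI x hx).isStart hs).sin_dir_pos).continuousWithinAt
  have hTneg : center (orbit s T (n + 1)).1
      ((orbit s T (n + 1)).1 + (orbit s T (n + 1)).2) < 0 := by
    obtain ⟨-, h2, -, -, h3, hst⟩ := h.orbit_bounds hs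
    have h4 : 0 < startParam ((orbit s T (n + 1)).1 + (orbit s T (n + 1)).2) := by
      rw [← sinh_pos_iff, sinh_startParam]
      have h5 : cos ((orbit s T (n + 1)).1 + (orbit s T (n + 1)).2) < 0 := by
        rw [hT]; exact cos_neg_of_pi_div_two_lt_of_lt (by linarith) (by linarith)
      have := div_neg_of_neg_of_pos h5 hst.sin_dir_pos
      linarith
    have h5 := mul_pos hst.neck_pos h4
    rw [center]
    nth_rewrite 1 [hT]
    rw [cos_pi_div_two]
    linarith
  have hεpos : 0 < center (orbit s ε (n + 1)).1
      ((orbit s ε (n + 1)).1 + (orbit s ε (n + 1)).2) := by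
    obtain ⟨h1, h2⟩ := isAdmissible_of_small hs (n + 1) hε hsm
    obtain ⟨h3, h4, -, h5, -, hst⟩ := h1.orbit_bounds hs
    have hpi := pi_gt_three
    have h6 := cos_of_le_quarter (hε.trans_le h3) (h2.trans hsm)
    have h7 := hst.cos_le_center (by linarith)
    linarith
  obtain ⟨x, hx, hx'⟩ := intermediate_value_Icc' hεX hcont ⟨hTneg.le, hεpos.le⟩
  have hxT : x < T := by
    refine lt_of_le_of_ne hx.2 ?_
    rintro rfl
    simp only at hx'
    linarith
  exact ⟨x, hI x hx, hT ▸ (h.comparison hs (hε.trans_le hx.1) hxT).2.1, hx'⟩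

/-- The meridian is symmetric, so `-startParam φ` also gives a point of the unit circle; an arc has
only two end points, so this is the exit. -/
theorem IsStart.arccos_exitHeight_of_center_eq_zero {β φ : ℝ} (h : IsStart β φ) (hβ : β < π / 2)
    (hc : center β φ = 0) : arccos (exitHeight β φ) = π - β := by
  have ha := h.neck_pos
  have harc := h.isArc
  have hcos : 0 < cos β := cos_pos_of_mem_Ioo ⟨by linarith [h.pos, pi_pos], hβ⟩
  have h1 := height_startParam β φ
  rw [hc] at h1 harc
  have h2 : 0 < startParam φ := by
    simp only [height, zero_add] at h1
    by_contra! h3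
    nlinarith
  have h3 : distSq (neck β φ) 0 (-startParam φ) = 1 := by
    rw [← harc.right]; simp [distSq, height]
  have h4 : exitParam β φ = -startParam φ := by
    rcases harc.eq_or_eq h3 with h4 | h4
    · exact h4.symm
    · linarith
  have h5 : exitHeight β φ = -cos β := by
    rw [← h1, exitHeight, hc, h4]; simp [height]
  rw [h5, arccos_neg, arccos_cos h.pos.le (by linarith [pi_pos])]

end CatConf

namespace CatConf

open Real Set Filter Topology

/-! ### Configurations and orbits -/

/-- The unbalancing parameters, indexed from `0`. -/
def shiftSeq (σ : ℕ+ → ℝ) (n : ℕ) : ℝ := σ n.succPNat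

theorem sum_abs_shiftSeq_le (σ : lp (fun _ : ℕ+ => ℝ) 1) (n : ℕ) :
    ∑ j ∈ Finset.range n, |shiftSeq σ j| ≤ ‖σ‖ := by
  have h := lp.sum_rpow_le_norm_rpow (p := 1) (by norm_num) σ
    ((Finset.range n).map ⟨Nat.succPNat, Nat.succPNat_injective⟩)
  simpa [Finset.sum_map, shiftSeq] using h

theorem isSmall_shiftSeq {σ : lp (fun _ : ℕ+ => ℝ) 1} (h : ‖σ‖ < log (7 / 4)) :
    IsSmall (shiftSeq σ) :=
  ⟨‖σ‖, by rwa [← Real.lt_log_iff_exp_lt (by norm_num)], sum_abs_shiftSeq_le σ⟩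

namespace Configuration

variable {W : Configuration} {σ : ℕ+ → ℝ}

theorem annulus_succ (W : Configuration) {n : ℕ} (hn : n < W.order) :
    IsAnnulusBetween (W.a (n + 1)) (W.b (n + 1)) (W.β (n + 1)) (W.β (n + 2)) :=
  W.annulus (n + 1) (by omega) (by omega)

theorem αMinus_one (W : Configuration) : W.αMinus 1 = W.β 1 := if_pos rfl

theorem αMinus_succ (W : Configuration) (n : ℕ) :
    W.αMinus (n + 2) = angleEx (W.a (n + 1)) (W.b (n + 1)) (W.β (n + 2)) :=
  if_neg (by omega)

theorem αMinus_pos (W : Configuration) {n : ℕ} (hn : n ≤ W.order) : 0 < W.αMinus (n + 1) := by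
  cases n with
  | zero => rw [αMinus_one]; exact (W.annulus 1 le_rfl W.one_le_order).pos
  | succ n => rw [αMinus_succ]; exact (W.annulus_succ hn).angleEx_pos

theorem HasUnbalancing.αPlus_eq (h : W.HasUnbalancing σ) {n : ℕ} (hn : n < W.order) :
    W.αPlus (n + 1) = exp (shiftSeq σ n) * W.αMinus (n + 1) := by
  have h1 := h n.succPNat (by simpa using hn)
  have h2 := (W.αMinus_pos hn.le).ne'
  rw [Nat.succPNat_coe] at h1
  rw [shiftSeq, h1]
  exact (div_mul_cancel₀ _ h2).symm

/-- Every configuration is an orbit, with indices shifted by one, so uniqueness becomes a question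
about the single number `β 1`. -/
theorem HasUnbalancing.orbit_eq (h : W.HasUnbalancing σ) {n : ℕ} (hn : n < W.order) :
    orbit (shiftSeq σ) (W.β 1) n = (W.β (n + 1), W.αPlus (n + 1)) := by
  induction n with
  | zero => rw [h.αPlus_eq hn, αMinus_one]; rfl
  | succ n ih =>
    have h1 := W.annulus_succ (show n < W.order by omega)
    rw [h.αPlus_eq hn, αMinus_succ, ← h1.arccos_exitSupport]
    conv_rhs => enter [1]; rw [← h1.arccos_exitHeight]
    simp only [orbit, ih (by omega)]
    rfl

theorem HasUnbalancing.orbit_succ_fst (h : W.HasUnbalancing σ) {n : ℕ} (hn : n < W.order) :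
    (orbit (shiftSeq σ) (W.β 1) (n + 1)).1 = W.β (n + 2) := by
  simp only [orbit, h.orbit_eq hn]
  exact (W.annulus_succ hn).arccos_exitHeight

theorem Generates.isAdmissible {k : ℕ} (h : W.Generates σ k) {n : ℕ} (hn : n < W.order) :
    IsAdmissible (shiftSeq σ) n (W.β 1) := by
  refine ⟨(W.annulus 1 le_rfl W.one_le_order).pos, h.1, fun i hi => ?_⟩
  rw [h.2.1.orbit_eq (by omega)]
  exact (W.β_lt_half_pi (i + 1) (by omega) (by omega)).le

end Configuration

/-- The configuration of order `m` given by an orbit. -/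
noncomputable def orbitConfig (s : ℕ → ℝ) (x : ℝ) (m : ℕ) (hm : 1 ≤ m)
    (hlt : ∀ i < m, (orbit s x i).1 < π / 2)
    (hst : ∀ i < m, IsStart (orbit s x i).1 ((orbit s x i).1 + (orbit s x i).2)) :
    Configuration where
  order := m
  β j := (orbit s x (j - 1)).1
  a j := neck (orbit s x (j - 1)).1 ((orbit s x (j - 1)).1 + (orbit s x (j - 1)).2)
  b j := center (orbit s x (j - 1)).1 ((orbit s x (j - 1)).1 + (orbit s x (j - 1)).2)
  one_le_order := hm
  β_lt_half_pi i hi hi' := hlt _ (by omega)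
  annulus i hi hi' := by
    obtain ⟨n, rfl⟩ : ∃ n, i = n + 1 := ⟨i - 1, by omega⟩
    exact (hst n (by omega)).isAnnulusBetween

theorem orbitConfig_hasUnbalancing {σ : ℕ+ → ℝ} {x : ℝ} {m : ℕ} (hm : 1 ≤ m)
    (hlt : ∀ i < m, (orbit (shiftSeq σ) x i).1 < π / 2)
    (hst : ∀ i < m, IsStart (orbit (shiftSeq σ) x i).1
      ((orbit (shiftSeq σ) x i).1 + (orbit (shiftSeq σ) x i).2)) :
    (orbitConfig (shiftSeq σ) x m hm hlt hst).HasUnbalancing σ := by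
  intro i hi
  obtain ⟨n, rfl⟩ : ∃ n : ℕ, i = n.succPNat := ⟨i.natPred, by simp⟩
  rw [Nat.succPNat_coe] at hi ⊢
  have hn : n < m := hi
  set W := orbitConfig (shiftSeq σ) x m hm hlt hst with hW
  have h1 : W.αPlus (n + 1) = (orbit (shiftSeq σ) x n).2 := by
    have := (hst n hn).angleIn_eq
    rw [add_sub_cancel_left] at this
    exact this
  have h2 : (orbit (shiftSeq σ) x n).2 = exp (shiftSeq σ n) * W.αMinus (n + 1) := by
    cases n with
    | zero => rw [W.αMinus_one]; rfl
    | succ n =>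
      rw [W.αMinus_succ]
      have := (hst n (by omega)).angleEx_eq
      simp only [orbit]
      rw [← this]
      rfl
  rw [Nat.succ_eq_add_one, h1, h2]
  exact (mul_div_cancel_right₀ _ (W.αMinus_pos hn.le).ne').symm

theorem exists_generates {σ : lp (fun _ : ℕ+ => ℝ) 1} (hσ : IsSmall (shiftSeq σ))
    (h : IsAdmissible (shiftSeq σ) 0 baseLat)
    (hX : π / 2 ≤ (orbit (shiftSeq σ) baseLat 1).1) {k : ℕ} (hk : 3 ≤ k) :
    ∃ W : Configuration, W.Generates σ k := by
  rcases Nat.even_or_odd' k with ⟨m, rfl | rfl⟩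
  -- In the even case the symmetric annulus starts at circle `n + 2`, which has orbit index `n + 1`.
  · obtain ⟨n, rfl⟩ : ∃ n, m = n + 2 := ⟨m - 2, by omega⟩
    obtain ⟨T, hT, hT'⟩ := exists_lat_eq_half_pi hσ h hX n
    obtain ⟨x, hx, hx1, hx2⟩ := exists_center_eq_zero hσ hT hT'
    have hlt : ∀ i < n + 2, (orbit (shiftSeq σ) x i).1 < π / 2 := by
      intro i hi
      rcases Nat.lt_succ_iff_lt_or_eq.1 hi with h1 | rfl
      · exact hx.lat_lt hσ h1
      · exact hx1
    have hst : ∀ i < n + 2, IsStart (orbit (shiftSeq σ) x i).1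
        ((orbit (shiftSeq σ) x i).1 + (orbit (shiftSeq σ) x i).2) := fun i hi =>
      (hx.of_le (by omega)).isStart hσ
    refine ⟨orbitConfig (shiftSeq σ) x (n + 2) (by omega) hlt hst, hx.lt,
      orbitConfig_hasUnbalancing _ hlt hst, Or.inr ⟨?_, rfl⟩⟩
    have := (hst (n + 1) (by omega)).arccos_exitHeight_of_center_eq_zero hx1 hx2
    change (orbit (shiftSeq σ) x (n + 2)).1 + (orbit (shiftSeq σ) x (n + 1)).1 = π
    have h2 : (orbit (shiftSeq σ) x (n + 2)).1 = π - (orbit (shiftSeq σ) x (n + 1)).1 := this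
    rw [h2]; ring
  · obtain ⟨n, rfl⟩ : ∃ n, m = n + 1 := ⟨m - 1, by omega⟩
    obtain ⟨T, hT, hT'⟩ := exists_lat_eq_half_pi hσ h hX n
    have hlt : ∀ i < n + 1, (orbit (shiftSeq σ) T i).1 < π / 2 := fun i hi => hT.lat_lt hσ hi
    have hst : ∀ i < n + 1, IsStart (orbit (shiftSeq σ) T i).1
        ((orbit (shiftSeq σ) T i).1 + (orbit (shiftSeq σ) T i).2) := fun i hi =>
      (hT.of_le hi.le).isStart hσ
    exact ⟨orbitConfig (shiftSeq σ) T (n + 1) (by omega) hlt hst, hT.lt,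
      orbitConfig_hasUnbalancing _ hlt hst, Or.inl ⟨hT', rfl⟩⟩

/-! ### Uniqueness -/

theorem IsStart.sinh_div_cosh_startParam {β φ : ℝ} (h : IsStart β φ) :
    sinh (startParam φ) / cosh (startParam φ) = -cos φ := by
  have := h.sin_dir_pos
  rw [sinh_startParam, cosh_startParam this]
  field_simp

/-- On a symmetric catenoid `x sinh x < cosh x` at the end point, if the angle is acute. -/
theorem IsStart.mul_sinh_lt_cosh {β φ : ℝ} (h : IsStart β φ) (hα : φ - β < π / 2)
    (hc : center β φ = 0) : startParam φ * sinh (startParam φ) < cosh (startParam φ) := by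
  have h1 : 0 < cos (φ - β) := cos_pos_of_mem_Ioo ⟨by linarith [h.lt, pi_pos], hα⟩
  have ha := h.neck_pos
  have hC := cosh_pos (startParam φ)
  rw [← support_startParam h.sin_dir_pos, support, hc, height, zero_add] at h1
  have h2 : neck β φ * (startParam φ * sinh (startParam φ)) < neck β φ * cosh (startParam φ) := by
    have h3 := mul_pos h1 hC
    have h4 : (neck β φ - neck β φ * startParam φ * (sinh (startParam φ) / cosh (startParam φ))) *
        cosh (startParam φ) = neck β φ * cosh (startParam φ) -
          neck β φ * (startParam φ * sinh (startParam φ)) := by field_simp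
    linarith
  exact lt_of_mul_lt_mul_left h2 ha.le

/-- Acute symmetric annuli with wider circles have smaller angles. -/
theorem not_lt_of_center_eq_zero {β φ β' φ' : ℝ} (h : IsStart β φ) (h' : IsStart β' φ')
    (hc : center β φ = 0) (hc' : center β' φ' = 0) (hβ : β < β') (hβ' : β' < π / 2)
    (hα : φ - β ≤ φ' - β') (hα' : φ' - β' < π / 2) : False := by
  set t := startParam φ
  set t' := startParam φ'
  have htt' : t < t' := by
    rw [← strictMono_sinh_div_cosh.lt_iff_lt]
    rw [h.sinh_div_cosh_startParam, h'.sinh_div_cosh_startParam]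
    have := cos_lt_cos_of_nonneg_of_le_pi (h.pos.trans h.lt).le h'.lt_pi.le
      (show φ < φ' by linarith)
    linarith
  have hquot : ∀ {β φ : ℝ}, IsStart β φ → center β φ = 0 →
      startParam φ / cosh (startParam φ) = cos β / sin β := by
    intro β φ h hc
    have h1 := h.sin_dir_pos
    have h2 := h.sin_lat_pos
    rw [center, neck] at hc
    rw [cosh_startParam h1]
    field_simp
    linarith
  have ht0 : 0 < t := by
    have h1 := hquot h hc
    have h2 : 0 < cos β / sin β :=
      div_pos (cos_pos_of_mem_Ioo ⟨by linarith [h.pos, pi_pos], by linarith⟩) h.sin_lat_pos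
    rw [← h1] at h2
    exact (div_pos_iff_of_pos_right (cosh_pos _)).1 h2
  have hd : ∀ x, HasDerivAt (fun x => x / cosh x) ((cosh x - x * sinh x) / cosh x ^ 2) x :=
    fun x => ((hasDerivAt_id x).div (Real.hasDerivAt_cosh x) (cosh_pos x).ne').congr_deriv
      (by simp)
  -- On a symmetric catenoid `t / cosh t = cot β` at the end point. The product `x tanh x` increases
  -- and is below one at `t'` by acuteness, so `x / cosh x` increases up to `t'`; thus `t < t'`
  -- would give `cot β ≤ cot β'`, against `β < β'`.
  have hmono : MonotoneOn (fun x => x / cosh x) (Icc 0 t') := by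
    refine monotoneOn_of_hasDerivWithinAt_nonneg (convex_Icc _ _)
      (fun x _ => (hd x).continuousAt.continuousWithinAt)
      (fun x _ => (hd x).hasDerivWithinAt) fun x hx => ?_
    rw [interior_Icc] at hx
    have h1 := strictMono_sinh_div_cosh hx.2
    have h2 := h'.mul_sinh_lt_cosh hα' hc'
    have hC := cosh_pos x
    have hC' := cosh_pos t'
    have h3 : x * (sinh x / cosh x) ≤ 1 := by
      have h4 : t' * (sinh t' / cosh t') < 1 := by
        rw [← mul_div_assoc, div_lt_one hC']; exact h2
      have h5 : 0 ≤ sinh x / cosh x := div_nonneg (sinh_nonneg_iff.2 hx.1.le) hC.le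
      have h6 : x * (sinh x / cosh x) ≤ t' * (sinh t' / cosh t') :=
        mul_le_mul hx.2.le h1.le h5 (hx.1.trans hx.2).le
      linarith
    rw [← mul_div_assoc, div_le_one hC] at h3
    exact div_nonneg (by linarith) (by positivity)
  have h1 := hmono ⟨ht0.le, htt'.le⟩ ⟨(ht0.trans htt').le, le_rfl⟩ htt'.le
  simp only at h1
  rw [hquot h hc, hquot h' hc'] at h1
  rw [div_le_div_iff₀ h.sin_lat_pos h'.sin_lat_pos] at h1
  have h2 : 0 < sin (β' - β) := sin_pos_of_pos_of_lt_pi (by linarith) (by linarith [h.pos])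
  rw [sin_sub] at h2
  linarith

theorem IsAnnulusBetween.center_eq_zero {a b β β' : ℝ} (h : IsAnnulusBetween a b β β')
    (hs : β' + β = π) : b = 0 := by
  have ha := h.neck_pos
  have h1 : β' = π - β := by linarith
  have h2 := h.mem_ex
  have hlt := h.lt
  rw [h1, sin_pi_sub, cos_pi_sub, h.mem_in] at h2
  have h3 := mul_left_cancel₀ ha.ne' h2
  have h4 : |(cos β - b) / a| = |(-cos β - b) / a| :=
    le_antisymm (cosh_le_cosh.1 h3.le) (cosh_le_cosh.1 h3.ge)
  have hcos : 0 < cos β := cos_pos_of_mem_Ioo ⟨by linarith [h.pos, pi_pos], by linarith⟩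
  rcases abs_eq_abs.1 h4 with h5 | h5
  · field_simp at h5; linarith
  · field_simp at h5; linarith

namespace Configuration

variable {W W' : Configuration} {σ : ℕ+ → ℝ} {k : ℕ}

/-- The parity of `k` forces equal orders. For odd `k` two circles on the equator contradict strict
monotonicity; for even `k` the last annuli are symmetric and the larger orbit has the wider circle
and an angle that is no smaller. -/
theorem Generates.not_lt (hσ : IsSmall (shiftSeq σ)) (h : W.Generates σ k)
    (h' : W'.Generates σ k) : ¬W.β 1 < W'.β 1 := by
  intro hlt
  have hpos : 0 < W.β 1 := (W.annulus 1 le_rfl W.one_le_order).pos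
  obtain ⟨n, hn⟩ : ∃ n, W.order = n + 1 := ⟨W.order - 1, by have := W.one_le_order; omega⟩
  rcases h.2.2 with ⟨h1, hk⟩ | ⟨h1, hk⟩ <;> rcases h'.2.2 with ⟨h1', hk'⟩ | ⟨h1', hk'⟩
  · have hn' : W'.order = n + 1 := by omega
    have hadm : IsAdmissible (shiftSeq σ) (n + 1) (W'.β 1) := by
      refine ⟨(W'.annulus 1 le_rfl W'.one_le_order).pos, h'.1, fun i hi => ?_⟩
      rcases Nat.le_succ_iff.1 hi with hi' | rfl
      · exact (h'.isAdmissible (n := n) (by omega)).le i hi'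
      · rw [h'.2.1.orbit_succ_fst (by omega)]
        rw [hn'] at h1'
        exact h1'.le
    have h2 := (hadm.comparison hσ hpos hlt).2.1
    rw [h.2.1.orbit_succ_fst (by omega), h'.2.1.orbit_succ_fst (by omega)] at h2
    rw [hn] at h1
    rw [hn'] at h1'
    linarith
  · omega
  · omega
  · have hn' : W'.order = n + 1 := by omega
    have hadm' := h'.isAdmissible (n := n) (by omega)
    obtain ⟨hadm, h2, h3⟩ := hadm'.comparison hσ hpos hlt
    have e := h.2.1.orbit_eq (n := n) (by omega)
    have e' := h'.2.1.orbit_eq (n := n) (by omega)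
    have hst := hadm.isStart hσ
    obtain ⟨-, -, -, -, h4, hst'⟩ := hadm'.orbit_bounds hσ
    rw [hn] at h1
    rw [hn'] at h1'
    have hA := W.annulus_succ (show n < W.order by omega)
    have hA' := W'.annulus_succ (show n < W'.order by omega)
    have hc := hA.center_eq
    have hc' := hA'.center_eq
    replace hc := hc.trans (hA.center_eq_zero h1)
    replace hc' := hc'.trans (hA'.center_eq_zero h1')
    rw [e] at hst h2 h3
    rw [e'] at hst' h2 h3 h4
    have h5 := W'.β_lt_half_pi (n + 1) (by omega) (by omega)
    exact not_lt_of_center_eq_zero hst hst' hc hc' h2 h5 (by simpa using h3) (by simpa using h4)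

theorem Generates.lat_unique (hσ : IsSmall (shiftSeq σ)) (h : W.Generates σ k)
    (h' : W'.Generates σ k) : W.β 1 = W'.β 1 :=
  le_antisymm (_root_.not_lt.1 (h'.not_lt hσ h)) (_root_.not_lt.1 (h.not_lt hσ h'))

end Configuration

/-- Existence and uniqueness of the first latitude. -/
theorem exists_unique_lat : ∃ δ : ℝ, 0 < δ ∧ δ ≤ log (7 / 4) ∧
    ∀ k : ℕ, 3 ≤ k → ∀ σ : lp (fun _ : ℕ+ => ℝ) 1, ‖σ‖ < δ →
      ∃! x : ℝ, ∃ W : Configuration, W.β 1 = x ∧ W.Generates σ k := by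
  obtain ⟨δ, hδ, h⟩ := exists_base
  refine ⟨min δ (log (7 / 4)), lt_min hδ (log_pos (by norm_num)), min_le_right _ _,
    fun k hk σ hσ => ?_⟩
  have hs := isSmall_shiftSeq (hσ.trans_le (min_le_right _ _))
  have h0 : |shiftSeq σ 0| < δ := by
    have := sum_abs_shiftSeq_le σ 1
    rw [Finset.sum_range_one] at this
    exact this.trans_lt (hσ.trans_le (min_le_left _ _))
  obtain ⟨h1, h2⟩ := h _ hs h0
  obtain ⟨W, hW⟩ := exists_generates hs h1 h2 hk
  refine ⟨W.β 1, ⟨W, rfl, hW⟩, ?_⟩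
  rintro y ⟨W', rfl, hW'⟩
  exact hW'.lat_unique hs hW

end CatConf

namespace CatConf

open Real Set Filter Topology

/-! ### A maximum principle -/

/-- The coordinate Laplacian. -/
noncomputable def flatLaplacian (f : (Fin 2 → ℝ) → ℝ) (q : Fin 2 → ℝ) : ℝ :=
  ∑ i : Fin 2, fderiv ℝ (fun p => fderiv ℝ f p (Pi.single i 1)) q (Pi.single i 1)

section SecondDerivative

variable {E : Type*} [NormedAddCommGroup E] [NormedSpace ℝ E]

theorem differentiableAt_fderiv_apply {g : E → ℝ} {q : E} (hg : ContDiffAt ℝ 2 g q) (e : E) :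
    DifferentiableAt ℝ (fun p => fderiv ℝ g p e) q := by
  have h1 : ContDiffAt ℝ 1 (fderiv ℝ g) q := hg.fderiv_right (by norm_num)
  exact (h1.differentiableAt (by norm_num)).clm_apply (differentiableAt_const e)

/-- Were the second derivative along `e` positive, the point would also be a local minimum on that
line, the function locally constant there, and its second derivative zero. -/
theorem fderiv_fderiv_nonpos_of_isLocalMax {g : E → ℝ} {q : E} (hg : ContDiffAt ℝ 2 g q)
    (hmax : IsLocalMax g q) (e : E) : fderiv ℝ (fun p => fderiv ℝ g p e) q e ≤ 0 := by
  have hl : ∀ s : ℝ, HasDerivAt (fun s : ℝ => q + s • e) e s := fun s =>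
    (((hasDerivAt_id s).smul_const e).const_add q).congr_deriv (one_smul _ _)
  have hl0 : q + (0 : ℝ) • e = q := by simp
  have hlc : Tendsto (fun s : ℝ => q + s • e) (𝓝 0) (𝓝 q) := by
    have := (hl 0).continuousAt.tendsto
    rwa [hl0] at this
  have hev : ∀ᶠ p in 𝓝 q, DifferentiableAt ℝ g p := by
    filter_upwards [hg.eventually (by norm_num)] with p hp
    exact hp.differentiableAt (by norm_num)
  have hd : deriv (fun s : ℝ => g (q + s • e)) =ᶠ[𝓝 0] fun s => fderiv ℝ g (q + s • e) e := by
    filter_upwards [hlc.eventually hev] with s hs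
    exact (hs.hasFDerivAt.comp_hasDerivAt s (hl s)).deriv
  have hd2 : deriv (deriv fun s : ℝ => g (q + s • e)) 0 =
      fderiv ℝ (fun p => fderiv ℝ g p e) q e := by
    rw [hd.deriv_eq]
    have h1 := differentiableAt_fderiv_apply hg e
    have h2 : HasFDerivAt (fun p => fderiv ℝ g p e) (fderiv ℝ (fun p => fderiv ℝ g p e) q)
        (q + (0 : ℝ) • e) := by rw [hl0]; exact h1.hasFDerivAt
    exact (h2.comp_hasDerivAt (0 : ℝ) (hl 0)).deriv
  have hmax' : IsLocalMax (fun s : ℝ => g (q + s • e)) 0 := by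
    have : ∀ᶠ s in 𝓝 (0 : ℝ), g (q + s • e) ≤ g q := hlc.eventually hmax
    simpa [IsLocalMax, IsMaxFilter] using this
  by_contra! hpos
  rw [← hd2] at hpos
  have hmin := isLocalMin_of_deriv_deriv_pos hpos hmax'.deriv_eq_zero (by
    have h2 : ContinuousAt g (q + (0 : ℝ) • e) := by rw [hl0]; exact hg.continuousAt
    exact ContinuousAt.comp (f := fun s : ℝ => q + s • e) h2 (hl 0).continuousAt)
  have hconst : (fun s : ℝ => g (q + s • e)) =ᶠ[𝓝 0] fun _ => g (q + (0 : ℝ) • e) := by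
    filter_upwards [hmax', hmin] with s h1 h2
    exact le_antisymm h1 h2
  have h3 : deriv (fun s : ℝ => g (q + s • e)) =ᶠ[𝓝 0] fun _ => 0 := by
    have := hconst.deriv
    refine this.trans (Eventually.of_forall fun s => ?_)
    simp
  rw [h3.deriv_eq] at hpos
  simp at hpos

theorem fderiv_fderiv_sub_const_mul {f w : E → ℝ} {q : E} (hf : ContDiffAt ℝ 2 f q)
    (hw : ContDiffAt ℝ 2 w q) (c : ℝ) (e : E) :
    fderiv ℝ (fun p => fderiv ℝ (fun p => f p - c * w p) p e) q e =
      fderiv ℝ (fun p => fderiv ℝ f p e) q e - c * fderiv ℝ (fun p => fderiv ℝ w p e) q e := by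
  have hev : (fun p => fderiv ℝ (fun p => f p - c * w p) p e) =ᶠ[𝓝 q]
      fun p => fderiv ℝ f p e - c * fderiv ℝ w p e := by
    filter_upwards [hf.eventually (by norm_num), hw.eventually (by norm_num)] with p h1 h2
    have d1 := (h1.differentiableAt (by norm_num)).hasFDerivAt
    have d2 := (h2.differentiableAt (by norm_num)).hasFDerivAt
    rw [(d1.fun_sub (d2.const_mul c)).fderiv]
    simp
  rw [hev.fderiv_eq]
  have d1 := (differentiableAt_fderiv_apply hf e).hasFDerivAt
  have d2 := (differentiableAt_fderiv_apply hw e).hasFDerivAt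
  rw [(d1.fun_sub (d2.const_mul c)).fderiv]
  simp

end SecondDerivative

/-- A solution cannot be positive somewhere if it vanishes on the boundary and there is a positive
strict supersolution. -/
theorem nonpos_of_supersolution {S B : Set E3} (hS : IsCompact S) {U : Set (Fin 2 → ℝ)}
    (hU : IsOpen U) {F : (Fin 2 → ℝ) → E3} (hF : S \ B ⊆ F '' U) (hFU : MapsTo F U S)
    {u w : E3 → ℝ} (hu : ContinuousOn u S) (hB : ∀ p ∈ B, u p = 0)
    (hw : ContinuousOn w S) (hwpos : ∀ p ∈ S, 0 < w p)
    (hu2 : ContDiffOn ℝ 2 (fun q => u (F q)) U) (hw2 : ContDiffOn ℝ 2 (fun q => w (F q)) U)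
    {V : (Fin 2 → ℝ) → ℝ}
    (hueq : ∀ q ∈ U, flatLaplacian (fun q => u (F q)) q + V q * u (F q) = 0)
    (hweq : ∀ q ∈ U, flatLaplacian (fun q => w (F q)) q + V q * w (F q) < 0) :
    ∀ p ∈ S, u p ≤ 0 := by
  intro p hp
  by_contra! hpos
  obtain ⟨p₀, hp₀, hmax⟩ := hS.exists_isMaxOn ⟨p, hp⟩
    (hu.div hw fun x hx => (hwpos x hx).ne')
  set v := u p₀ / w p₀ with hv
  have hvpos : 0 < v := (div_pos hpos (hwpos p hp)).trans_le (hmax hp)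
  have hle : ∀ x ∈ S, u x ≤ v * w x := fun x hx => by
    rw [← div_le_iff₀ (hwpos x hx)]; exact hmax hx
  have hp₀B : p₀ ∉ B := fun h => by
    rw [hv, hB p₀ h, zero_div] at hvpos; exact lt_irrefl _ hvpos
  obtain ⟨q, hq, rfl⟩ := hF ⟨hp₀, hp₀B⟩
  have heq : u (F q) = v * w (F q) := by
    rw [hv]; field_simp [(hwpos _ hp₀).ne']
  have h1 := hu2.contDiffAt (hU.mem_nhds hq)
  have h2 := hw2.contDiffAt (hU.mem_nhds hq)
  -- At the maximum of `u / w` the function `u - v w` vanishes and is nonpositive nearby, so its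
  -- Laplacian is at most zero; the equation and the strict supersolution inequality make it
  -- positive.
  have hloc : IsLocalMax (fun q => u (F q) - v * w (F q)) q := by
    filter_upwards [hU.mem_nhds hq] with x hx
    have := hle _ (hFU hx)
    rw [heq]; linarith
  have h3 : flatLaplacian (fun q => u (F q)) q ≤ v * flatLaplacian (fun q => w (F q)) q := by
    unfold flatLaplacian
    rw [Finset.mul_sum]
    refine Finset.sum_le_sum fun i _ => ?_
    have := fderiv_fderiv_nonpos_of_isLocalMax (h1.sub (contDiffAt_const.mul h2)) hloc
      (Pi.single i 1)
    rw [fderiv_fderiv_sub_const_mul h1 h2] at this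
    linarith
  have h4 := hueq q hq
  have h5 := mul_neg_of_pos_of_neg hvpos (hweq q hq)
  rw [heq] at h4
  nlinarith

theorem flatLaplacian_neg (f : (Fin 2 → ℝ) → ℝ) (q : Fin 2 → ℝ) :
    flatLaplacian (fun q => -f q) q = -flatLaplacian f q := by
  simp [flatLaplacian, fderiv_fun_neg, add_comm]

theorem eq_zero_of_supersolution {S B : Set E3} (hS : IsCompact S) {U : Set (Fin 2 → ℝ)}
    (hU : IsOpen U) {F : (Fin 2 → ℝ) → E3} (hF : S \ B ⊆ F '' U) (hFU : MapsTo F U S)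
    {u w : E3 → ℝ} (hu : ContinuousOn u S) (hB : ∀ p ∈ B, u p = 0)
    (hw : ContinuousOn w S) (hwpos : ∀ p ∈ S, 0 < w p)
    (hu2 : ContDiffOn ℝ 2 (fun q => u (F q)) U) (hw2 : ContDiffOn ℝ 2 (fun q => w (F q)) U)
    {V : (Fin 2 → ℝ) → ℝ}
    (hueq : ∀ q ∈ U, flatLaplacian (fun q => u (F q)) q + V q * u (F q) = 0)
    (hweq : ∀ q ∈ U, flatLaplacian (fun q => w (F q)) q + V q * w (F q) < 0) :
    ∀ p ∈ S, u p = 0 := by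
  intro p hp
  refine le_antisymm (nonpos_of_supersolution hS hU hF hFU hu hB hw hwpos hu2 hw2 hueq hweq p hp) ?_
  have := nonpos_of_supersolution (u := fun p => -u p) hS hU hF hFU hu.neg
    (fun p hp => by simp [hB p hp]) hw hwpos hu2.neg hw2 (fun q hq => by
      rw [flatLaplacian_neg]; linarith [hueq q hq]) hweq p hp
  linarith

/-! ### The Jacobi operator in conformal coordinates -/

section Conformal

variable {F : (Fin 2 → ℝ) → E3} {E : (Fin 2 → ℝ) → ℝ}

theorem areaDensity_of_conformal {q : Fin 2 → ℝ} (hE : 0 < E q)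
    (h : firstForm F q = E q • (1 : Matrix (Fin 2) (Fin 2) ℝ)) : areaDensity F q = E q := by
  rw [areaDensity, h, Matrix.det_smul, Matrix.det_one, mul_one, Fintype.card_fin, sqrt_sq hE.le]

theorem firstForm_inv_of_conformal {q : Fin 2 → ℝ} (hE : 0 < E q)
    (h : firstForm F q = E q • (1 : Matrix (Fin 2) (Fin 2) ℝ)) :
    (firstForm F q)⁻¹ = (E q)⁻¹ • (1 : Matrix (Fin 2) (Fin 2) ℝ) := by
  rw [h]
  apply Matrix.inv_eq_right_inv
  rw [smul_mul_smul_comm, mul_one, mul_inv_cancel₀ hE.ne', one_smul]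

/-- In dimension two the area density cancels the conformal factor of the inverse metric, so only
the prefactor remains. -/
theorem laplaceBeltrami_of_conformal (hE : ∀ q, 0 < E q)
    (h : ∀ q, firstForm F q = E q • (1 : Matrix (Fin 2) (Fin 2) ℝ))
    (f : (Fin 2 → ℝ) → ℝ) (q : Fin 2 → ℝ) :
    laplaceBeltrami F f q = (E q)⁻¹ * flatLaplacian f q := by
  rw [laplaceBeltrami, areaDensity_of_conformal (hE q) (h q), flatLaplacian]
  congr 1
  refine Finset.sum_congr rfl fun i _ => ?_
  congr 2
  funext p
  rw [areaDensity_of_conformal (hE p) (h p), firstForm_inv_of_conformal (hE p) (h p)]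
  have hp := (hE p).ne'
  fin_cases i <;> simp [Matrix.one_apply, hp]

theorem normSqA_of_conformal {q : Fin 2 → ℝ} (hE : 0 < E q)
    (h : firstForm F q = E q • (1 : Matrix (Fin 2) (Fin 2) ℝ)) :
    normSqA F q = (E q)⁻¹ ^ 2 * (secondForm F q * secondForm F q).trace := by
  rw [normSqA, firstForm_inv_of_conformal hE h]
  simp only [smul_mul_assoc, one_mul, mul_smul_comm, Matrix.trace_smul, smul_eq_mul]
  ring

theorem linearIndependent_of_conformal {q : Fin 2 → ℝ} (hE : 0 < E q)
    (h : firstForm F q = E q • (1 : Matrix (Fin 2) (Fin 2) ℝ)) :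
    LinearIndependent ℝ fun i => tangentVec F i q := by
  have hij : ∀ i j, inner ℝ (tangentVec F i q) (tangentVec F j q) =
      (E q • (1 : Matrix (Fin 2) (Fin 2) ℝ)) i j := fun i j => by rw [← h]; rfl
  refine linearIndependent_of_ne_zero_of_inner_eq_zero (𝕜 := ℝ) (fun i h0 => ?_) fun i j hne => ?_
  · have := hij i i
    rw [h0, inner_zero_left] at this
    simp at this
    exact hE.ne this
  · change inner ℝ (tangentVec F i q) (tangentVec F j q) = 0
    rw [hij]; simp [hne]

end Conformal

/-! ### Parametrizations in which the variables are separated -/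

/-- The map whose components are products of functions of one coordinate. -/
noncomputable def sepMap (A₀ B₀ A₁ B₁ A₂ B₂ : ℝ → ℝ) (q : Fin 2 → ℝ) : E3 :=
  !₂[A₀ (q 0) * B₀ (q 1), A₁ (q 0) * B₁ (q 1), A₂ (q 0) * B₂ (q 1)]

theorem hasFDerivAt_mul_coord {A B : ℝ → ℝ} {A' B' : ℝ} {q : Fin 2 → ℝ}
    (hA : HasDerivAt A A' (q 0)) (hB : HasDerivAt B B' (q 1)) :
    HasFDerivAt (fun q : Fin 2 → ℝ => A (q 0) * B (q 1))
      ((A (q 0) * B') • ContinuousLinearMap.proj (R := ℝ) (φ := fun _ : Fin 2 => ℝ) 1 +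
        (B (q 1) * A') • ContinuousLinearMap.proj (R := ℝ) (φ := fun _ : Fin 2 => ℝ) 0) q := by
  have h0 : HasFDerivAt (fun q : Fin 2 → ℝ => q 0)
    (ContinuousLinearMap.proj (R := ℝ) (φ := fun _ : Fin 2 => ℝ) 0) q := hasFDerivAt_apply 0 q
  have h1 : HasFDerivAt (fun q : Fin 2 → ℝ => q 1)
    (ContinuousLinearMap.proj (R := ℝ) (φ := fun _ : Fin 2 => ℝ) 1) q := hasFDerivAt_apply 1 q
  have := (hA.comp_hasFDerivAt q h0).mul (hB.comp_hasFDerivAt q h1)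
  refine this.congr_fderiv ?_
  ext v
  simp
  ring

theorem fderiv_sepMap {A₀ B₀ A₁ B₁ A₂ B₂ : ℝ → ℝ} {a₀ b₀ a₁ b₁ a₂ b₂ : ℝ} {q : Fin 2 → ℝ}
    (hA₀ : HasDerivAt A₀ a₀ (q 0)) (hB₀ : HasDerivAt B₀ b₀ (q 1))
    (hA₁ : HasDerivAt A₁ a₁ (q 0)) (hB₁ : HasDerivAt B₁ b₁ (q 1))
    (hA₂ : HasDerivAt A₂ a₂ (q 0)) (hB₂ : HasDerivAt B₂ b₂ (q 1)) :
    fderiv ℝ (sepMap A₀ B₀ A₁ B₁ A₂ B₂) q (Pi.single 0 1) =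
        !₂[a₀ * B₀ (q 1), a₁ * B₁ (q 1), a₂ * B₂ (q 1)] ∧
      fderiv ℝ (sepMap A₀ B₀ A₁ B₁ A₂ B₂) q (Pi.single 1 1) =
        !₂[A₀ (q 0) * b₀, A₁ (q 0) * b₁, A₂ (q 0) * b₂] := by
  have h0 := hasFDerivAt_mul_coord hA₀ hB₀
  have h1 := hasFDerivAt_mul_coord hA₁ hB₁
  have h2 := hasFDerivAt_mul_coord hA₂ hB₂
  have hd : DifferentiableAt ℝ (sepMap A₀ B₀ A₁ B₁ A₂ B₂) q := by
    rw [differentiableAt_euclidean]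
    intro i
    fin_cases i
    · exact h0.differentiableAt
    · exact h1.differentiableAt
    · exact h2.differentiableAt
  have hc : ∀ i, HasFDerivAt (fun q => sepMap A₀ B₀ A₁ B₁ A₂ B₂ q i)
      ((EuclideanSpace.proj (𝕜 := ℝ) i).comp (fderiv ℝ (sepMap A₀ B₀ A₁ B₁ A₂ B₂) q)) q :=
    fun i => (EuclideanSpace.proj (𝕜 := ℝ) i).hasFDerivAt.comp q hd.hasFDerivAt
  have e0 := (hc 0).unique h0
  have e1 := (hc 1).unique h1
  have e2 := (hc 2).unique h2
  have key : ∀ v, fderiv ℝ (sepMap A₀ B₀ A₁ B₁ A₂ B₂) q v =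
      !₂[A₀ (q 0) * b₀ * v 1 + B₀ (q 1) * a₀ * v 0, A₁ (q 0) * b₁ * v 1 + B₁ (q 1) * a₁ * v 0,
        A₂ (q 0) * b₂ * v 1 + B₂ (q 1) * a₂ * v 0] := by
    intro v
    have k0 := DFunLike.congr_fun e0 v
    have k1 := DFunLike.congr_fun e1 v
    have k2 := DFunLike.congr_fun e2 v
    ext i
    fin_cases i
    · simpa using k0
    · simpa using k1
    · simpa using k2
  constructor <;> rw [key] <;> simp [mul_comm]

end CatConf

namespace CatConf

open Real Set Filter Topology

/-! ### The catenoid -/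

/-- The conformal parametrization of a catenoid. -/
noncomputable def catParam (a b : ℝ) : (Fin 2 → ℝ) → E3 :=
  sepMap (fun x => a * cosh x) cos (height a b) (fun _ => 1) (fun x => a * cosh x) sin

theorem inner_vec3 (x y z x' y' z' : ℝ) :
    inner ℝ (!₂[x, y, z] : E3) !₂[x', y', z'] = x * x' + y * y' + z * z' := by
  simp [PiLp.inner_apply, Fin.sum_univ_three, mul_comm]

theorem norm_vec3 (x y z : ℝ) : ‖(!₂[x, y, z] : E3)‖ = √(x ^ 2 + y ^ 2 + z ^ 2) := by
  rw [EuclideanSpace.norm_eq, Fin.sum_univ_three]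
  simp

theorem tangentVec_catParam_zero (a b : ℝ) : tangentVec (catParam a b) 0 =
    sepMap (fun x => a * sinh x) cos (fun _ => a) (fun _ => 1) (fun x => a * sinh x) sin := by
  funext q
  exact (fderiv_sepMap ((Real.hasDerivAt_cosh _).const_mul a) (hasDerivAt_cos _)
    (hasDerivAt_height a b _) (hasDerivAt_const _ _) ((Real.hasDerivAt_cosh _).const_mul a)
    (hasDerivAt_sin _)).1

theorem tangentVec_catParam_one (a b : ℝ) : tangentVec (catParam a b) 1 =
    sepMap (fun x => a * cosh x) (fun θ => -sin θ) (height a b) (fun _ => 0)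
      (fun x => a * cosh x) cos := by
  funext q
  exact (fderiv_sepMap ((Real.hasDerivAt_cosh _).const_mul a) (hasDerivAt_cos _)
    (hasDerivAt_height a b _) (hasDerivAt_const _ _) ((Real.hasDerivAt_cosh _).const_mul a)
    (hasDerivAt_sin _)).2

theorem firstForm_catParam (a b : ℝ) (q : Fin 2 → ℝ) :
    firstForm (catParam a b) q = (a * cosh (q 0)) ^ 2 • (1 : Matrix (Fin 2) (Fin 2) ℝ) := by
  have h1 := sin_sq_add_cos_sq (q 1)
  have h2 := cosh_sq_eq (q 0)
  ext i j
  simp only [firstForm, Matrix.of_apply]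
  fin_cases i <;> fin_cases j <;>
    simp only [Fin.zero_eta, Fin.mk_one, tangentVec_catParam_zero, tangentVec_catParam_one, sepMap,
      inner_vec3, Matrix.smul_apply, Matrix.one_apply_eq, smul_eq_mul, mul_one, ne_eq,
      zero_ne_one, one_ne_zero, not_false_eq_true, Matrix.one_apply_ne, mul_zero]
  · linear_combination a ^ 2 * sinh (q 0) ^ 2 * h1 - a ^ 2 * h2
  · ring
  · ring
  · linear_combination a ^ 2 * cosh (q 0) ^ 2 * h1

theorem unitNormal_catParam {a : ℝ} (b : ℝ) (ha : 0 < a) (q : Fin 2 → ℝ) :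
    unitNormal (catParam a b) q =
      !₂[cos (q 1) / cosh (q 0), -(sinh (q 0) / cosh (q 0)), sin (q 1) / cosh (q 0)] := by
  have h1 := sin_sq_add_cos_sq (q 1)
  have h2 := cosh_sq_eq (q 0)
  have hc := cosh_pos (q 0)
  have hn : (WithLp.toLp 2 (crossProduct (WithLp.ofLp (tangentVec (catParam a b) 0 q))
      (WithLp.ofLp (tangentVec (catParam a b) 1 q))) : E3) =
      !₂[a ^ 2 * cosh (q 0) * cos (q 1), -(a ^ 2 * cosh (q 0) * sinh (q 0)),
        a ^ 2 * cosh (q 0) * sin (q 1)] := by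
    rw [tangentVec_catParam_zero, tangentVec_catParam_one, sepMap, sepMap, cross_apply]
    ext i
    fin_cases i <;> simp
    · ring
    · linear_combination -(a ^ 2 * cosh (q 0) * sinh (q 0)) * h1
    · ring
  have hnorm : ‖(!₂[a ^ 2 * cosh (q 0) * cos (q 1), -(a ^ 2 * cosh (q 0) * sinh (q 0)),
        a ^ 2 * cosh (q 0) * sin (q 1)] : E3)‖ = a ^ 2 * cosh (q 0) ^ 2 := by
    rw [norm_vec3, ← sqrt_sq (show 0 ≤ a ^ 2 * cosh (q 0) ^ 2 by positivity)]
    congr 1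
    linear_combination (a ^ 2 * cosh (q 0)) ^ 2 * h1 - (a ^ 2 * cosh (q 0)) ^ 2 * h2
  rw [unitNormal]
  simp only [hn, hnorm]
  ext i
  fin_cases i <;> simp <;> field_simp

theorem secondForm_catParam {a : ℝ} (b : ℝ) (ha : 0 < a) (q : Fin 2 → ℝ) :
    secondForm (catParam a b) q = !![a, 0; 0, -a] := by
  have h1 := sin_sq_add_cos_sq (q 1)
  have hc := (cosh_pos (q 0)).ne'
  obtain ⟨d00, d10⟩ := fderiv_sepMap (q := q) ((Real.hasDerivAt_sinh (q 0)).const_mul a)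
    (hasDerivAt_cos (q 1)) (hasDerivAt_const (q 0) a) (hasDerivAt_const (q 1) (1 : ℝ))
    ((Real.hasDerivAt_sinh (q 0)).const_mul a) (hasDerivAt_sin (q 1))
  obtain ⟨d01, d11⟩ := fderiv_sepMap (q := q) ((Real.hasDerivAt_cosh (q 0)).const_mul a)
    (show HasDerivAt (fun θ => -sin θ) (-cos (q 1)) (q 1) from (hasDerivAt_sin (q 1)).neg)
    (hasDerivAt_height a b (q 0)) (hasDerivAt_const (q 1) (0 : ℝ))
    ((Real.hasDerivAt_cosh (q 0)).const_mul a) (hasDerivAt_cos (q 1))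
  have e00 : secondDeriv (catParam a b) 0 0 q =
      fderiv ℝ (tangentVec (catParam a b) 0) q (Pi.single 0 1) := rfl
  rw [tangentVec_catParam_zero, d00] at e00
  have e10 : secondDeriv (catParam a b) 1 0 q =
      fderiv ℝ (tangentVec (catParam a b) 0) q (Pi.single 1 1) := rfl
  rw [tangentVec_catParam_zero, d10] at e10
  have e01 : secondDeriv (catParam a b) 0 1 q =
      fderiv ℝ (tangentVec (catParam a b) 1) q (Pi.single 0 1) := rfl
  rw [tangentVec_catParam_one, d01] at e01
  have e11 : secondDeriv (catParam a b) 1 1 q =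
      fderiv ℝ (tangentVec (catParam a b) 1) q (Pi.single 1 1) := rfl
  rw [tangentVec_catParam_one, d11] at e11
  ext i j
  simp only [secondForm, Matrix.of_apply, unitNormal_catParam b ha]
  fin_cases i <;> fin_cases j <;>
    simp only [Fin.zero_eta, Fin.mk_one, e00, e01, e10, e11, inner_vec3, Matrix.cons_val_zero,
      Matrix.cons_val_one, Matrix.cons_val', Matrix.cons_val_fin_one]
  · field_simp
    linear_combination a * cosh (q 0) * h1
  · field_simp
    ring
  · field_simp
    ring
  · field_simp
    linear_combination -(a * cosh (q 0)) * h1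

theorem normSqA_catParam {a : ℝ} (b : ℝ) (ha : 0 < a) (q : Fin 2 → ℝ) :
    normSqA (catParam a b) q = 2 / (a * cosh (q 0) ^ 2) ^ 2 := by
  have hc := cosh_pos (q 0)
  rw [normSqA_of_conformal (E := fun q => (a * cosh (q 0)) ^ 2) (by positivity)
    (firstForm_catParam a b q), secondForm_catParam b ha, Matrix.trace_fin_two]
  simp [Matrix.mul_apply, Fin.sum_univ_two]
  field_simp
  ring

theorem jacobiOperator_catParam {a : ℝ} (b : ℝ) (ha : 0 < a) (f : (Fin 2 → ℝ) → ℝ)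
    (q : Fin 2 → ℝ) : jacobiOperator (catParam a b) f q =
      ((a * cosh (q 0)) ^ 2)⁻¹ * (flatLaplacian f q + 2 / cosh (q 0) ^ 2 * f q) := by
  have hc := cosh_pos (q 0)
  rw [jacobiOperator, laplaceBeltrami_of_conformal (E := fun q => (a * cosh (q 0)) ^ 2)
    (fun q => by have := cosh_pos (q 0); positivity) (firstForm_catParam a b),
    normSqA_catParam b ha]
  field_simp

theorem norm_sq_eq (p : E3) : ‖p‖ ^ 2 = p 0 ^ 2 + p 1 ^ 2 + p 2 ^ 2 := by
  rw [EuclideanSpace.norm_sq_eq, Fin.sum_univ_three]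
  simp

theorem catParam_apply (a b : ℝ) (q : Fin 2 → ℝ) :
    catParam a b q 0 = a * cosh (q 0) * cos (q 1) ∧ catParam a b q 1 = height a b (q 0) ∧
      catParam a b q 2 = a * cosh (q 0) * sin (q 1) := by
  refine ⟨rfl, ?_, rfl⟩
  simp [catParam, sepMap]

theorem norm_catParam_sq (a b : ℝ) (q : Fin 2 → ℝ) : ‖catParam a b q‖ ^ 2 = distSq a b (q 0) := by
  obtain ⟨h0, h1, h2⟩ := catParam_apply a b q
  rw [norm_sq_eq, h0, h1, h2, distSq]
  linear_combination (a * cosh (q 0)) ^ 2 * sin_sq_add_cos_sq (q 1)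

theorem catParam_mem {a : ℝ} (b : ℝ) (ha : 0 < a) (q : Fin 2 → ℝ) :
    catParam a b q ∈ catenoid a b := by
  obtain ⟨h0, h1, h2⟩ := catParam_apply a b q
  have hc := cosh_pos (q 0)
  have hq : (height a b (q 0) - b) / a = q 0 := by unfold height; field_simp; ring
  rw [catenoid, mem_ofPred_eq, h0, h1, h2, hq]
  rw [← sqrt_sq (show 0 ≤ a * cosh (q 0) by positivity)]
  congr 1
  rw [sqrt_sq (show 0 ≤ a * cosh (q 0) by positivity)]
  linear_combination (a * cosh (q 0)) ^ 2 * sin_sq_add_cos_sq (q 1)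

theorem exists_catParam_eq {a b : ℝ} (ha : 0 < a) {p : E3} (hp : p ∈ catenoid a b) :
    ∃ q, catParam a b q = p ∧ q 0 = (p 1 - b) / a := by
  set x := (p 1 - b) / a with hx
  set z : ℂ := ⟨p 0, p 2⟩ with hz
  have hnorm : ‖z‖ = a * cosh x := by
    rw [← hp, Complex.norm_def, Complex.normSq_apply]
    congr 1
    simp only [hz]; ring
  have h0 := Complex.norm_mul_cos_arg z
  have h2 := Complex.norm_mul_sin_arg z
  rw [hnorm] at h0 h2
  refine ⟨![x, Complex.arg z], ?_, rfl⟩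
  obtain ⟨k0, k1, k2⟩ := catParam_apply a b ![x, Complex.arg z]
  ext i
  fin_cases i
  · exact k0.trans h0
  · refine k1.trans ?_
    simp only [Matrix.cons_val_zero, hx, height]
    field_simp
    simp
  · exact k2.trans h2

theorem contDiff_catParam (a b : ℝ) : ContDiff ℝ ∞ (catParam a b) := by
  rw [contDiff_euclidean]
  have h0 : ContDiff ℝ ∞ fun q : Fin 2 → ℝ => q 0 := contDiff_apply ℝ ℝ 0
  have h1 : ContDiff ℝ ∞ fun q : Fin 2 → ℝ => q 1 := contDiff_apply ℝ ℝ 1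
  intro i
  fin_cases i
  · exact (contDiff_const.mul (Real.contDiff_cosh.comp h0)).mul (Real.contDiff_cos.comp h1)
  · exact (contDiff_const.add (contDiff_const.mul h0)).mul contDiff_const
  · exact (contDiff_const.mul (Real.contDiff_cosh.comp h0)).mul (Real.contDiff_sin.comp h1)

theorem isCompact_catenoid_inter (a b : ℝ) : IsCompact (catenoid a b ∩ unitBall) := by
  have h : IsClosed (catenoid a b) := by
    have hi : ∀ i : Fin 3, Continuous fun p : E3 => p i := fun i =>
      (EuclideanSpace.proj (𝕜 := ℝ) i).continuous
    have h0 := hi 0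
    have h1 := hi 1
    have h2 := hi 2
    exact isClosed_eq (by fun_prop) (continuous_const.mul
      (Real.continuous_cosh.comp ((h1.sub continuous_const).div_const a)))
  exact (isCompact_closedBall 0 1).inter_left h

theorem mem_unitBall_iff {p : E3} : p ∈ unitBall ↔ ‖p‖ ^ 2 ≤ 1 := by
  rw [unitBall, mem_closedBall_zero_iff, sq_le_one_iff₀ (norm_nonneg _)]

theorem mem_unitSphere_iff {p : E3} : p ∈ unitSphere ↔ ‖p‖ ^ 2 = 1 := by
  rw [unitSphere, mem_sphere_zero_iff_norm,
    pow_eq_one_iff_of_nonneg (norm_nonneg p) two_ne_zero]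

/-- The function differentiated is `support'`, so this is the Jacobi equation `f'' + 2 f / cosh ^ 2
= 0` for the support function. -/
theorem hasDerivAt_radial_div_sq (a b s : ℝ) :
    HasDerivAt (fun s => -(radial a b s / cosh s ^ 2)) (-(2 / cosh s ^ 2 * support a b s)) s := by
  have hc := (cosh_pos s).ne'
  refine (((hasDerivAt_radial a b s).div ((Real.hasDerivAt_cosh s).pow 2)
    (by simpa using hc)).neg).congr_deriv ?_
  have h2 : a * cosh s ^ 2 = a + a * sinh s ^ 2 := by rw [cosh_sq_eq]; ring
  simp only [radial, support, Pi.pow_apply]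
  push_cast
  field_simp
  linear_combination -cosh s * h2

/-- The flat Laplacian of a function of the first coordinate. -/
theorem flatLaplacian_comp_zero {g g' : ℝ → ℝ} {g'' : ℝ} {q : Fin 2 → ℝ}
    (hg : ∀ s, HasDerivAt g (g' s) s) (hg' : HasDerivAt g' g'' (q 0)) :
    flatLaplacian (fun q => g (q 0)) q = g'' := by
  have h : ∀ (i : Fin 2) (p : Fin 2 → ℝ), fderiv ℝ (fun q : Fin 2 → ℝ => g (q 0)) p
      (Pi.single i 1) = g' (p 0) * (Pi.single i 1 : Fin 2 → ℝ) 0 := fun i p => by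
    have e : HasFDerivAt (fun q : Fin 2 → ℝ => g (q 0)) _ p :=
      (hg (p 0)).comp_hasFDerivAt p (hasFDerivAt_apply (𝕜 := ℝ) 0 p)
    rw [e.fderiv]
    simp
  rw [flatLaplacian, Fin.sum_univ_two]
  simp only [h]
  have h2 : (Pi.single 1 1 : Fin 2 → ℝ) 0 = 0 := by simp
  have h1 : (Pi.single 0 1 : Fin 2 → ℝ) 0 = 1 := by simp
  simp only [h1, h2, mul_one, mul_zero]
  have e : HasFDerivAt (fun q : Fin 2 → ℝ => g' (q 0)) _ q :=
    hg'.comp_hasFDerivAt q (hasFDerivAt_apply (𝕜 := ℝ) 0 q)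
  rw [e.fderiv]
  simp

/-- If the support function is bounded below by `m > 0` then there is no Dirichlet eigenvalue of
absolute value less than `m * a ^ 2`. -/
theorem catenoid_not_isDirichletEigenvalue {a b m lam : ℝ} (ha : 0 < a) (hm : 0 < m)
    (hsup : ∀ s, distSq a b s ≤ 1 → m ≤ support a b s) (hlam : |lam| < m * a ^ 2) :
    ¬IsDirichletEigenvalue (catenoid a b ∩ unitBall) (catenoid a b ∩ unitBall ∩ unitSphere)
      lam := by
  rintro ⟨u, hu, hB, ⟨p, hp, hpu⟩, hF⟩
  set S := catenoid a b ∩ unitBall with hS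
  set U : Set (Fin 2 → ℝ) := {q | distSq a b (q 0) < 1} with hU
  have hUo : IsOpen U := isOpen_lt ((continuous_distSq a b).comp (continuous_apply 0))
    continuous_const
  have hmaps : MapsTo (catParam a b) U (S \ (S ∩ unitSphere)) := by
    intro q hq
    have h1 := norm_catParam_sq a b q
    have hq' : distSq a b (q 0) < 1 := hq
    refine ⟨⟨catParam_mem b ha q, mem_unitBall_iff.2 (h1 ▸ hq'.le)⟩, fun h2 => ?_⟩
    have := mem_unitSphere_iff.1 h2.2
    linarith
  have hparam : IsLocalParam (S \ (S ∩ unitSphere)) U (catParam a b) :=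
    ⟨hUo, (contDiff_catParam a b).contDiffOn, fun q _ => linearIndependent_of_conformal
      (E := fun q => (a * cosh (q 0)) ^ 2) (by have := cosh_pos (q 0); positivity)
      (firstForm_catParam a b q), hmaps⟩
  obtain ⟨hu2, hueq⟩ := hF U _ hparam
  have hdist : ∀ p ∈ S, distSq a b ((p 1 - b) / a) ≤ 1 := by
    intro p hp
    obtain ⟨q, rfl, hq⟩ := exists_catParam_eq ha hp.1
    rw [← hq, ← norm_catParam_sq]
    exact mem_unitBall_iff.1 hp.2
  have hheight : ∀ q, (catParam a b q 1 - b) / a = q 0 := by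
    intro q
    rw [(catParam_apply a b q).2.1]; unfold height; field_simp; ring
  have hdsup : ∀ s, HasDerivAt (fun s => support a b s - m / 2) (-(radial a b s / cosh s ^ 2)) s :=
    fun s => (hasDerivAt_support a b s).sub_const _
  -- The support function solves the Jacobi equation exactly; subtracting half of its lower bound
  -- keeps it positive and makes it a strict supersolution. In `V`, `lam` is multiplied by the
  -- conformal factor.
  refine hpu (eq_zero_of_supersolution (S := S) (B := S ∩ unitSphere)
    (isCompact_catenoid_inter a b) hUo (F := catParam a b)
    (w := fun p => support a b ((p 1 - b) / a) - m / 2)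
    (V := fun q => 2 / cosh (q 0) ^ 2 + lam * (a * cosh (q 0)) ^ 2) ?_
    (fun q hq => (hmaps hq).1) hu hB ?_ ?_ hu2 ?_ ?_ ?_ p hp)
  · rintro p ⟨hp1, hp2⟩
    obtain ⟨q, rfl, hq⟩ := exists_catParam_eq ha hp1.1
    refine ⟨q, ?_, rfl⟩
    have h1 := norm_catParam_sq a b q
    refine lt_of_le_of_ne (h1 ▸ mem_unitBall_iff.1 hp1.2) fun h2 => hp2 ⟨hp1, ?_⟩
    rw [mem_unitSphere_iff, h1, h2]
  · have h1 : Continuous fun p : E3 => p 1 := (EuclideanSpace.proj (𝕜 := ℝ) 1).continuous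
    exact (((continuous_support a b).comp ((h1.sub continuous_const).div_const a)).sub
      continuous_const).continuousOn
  · intro p hp
    have := hsup _ (hdist p hp)
    linarith
  · simp only [hheight]
    have h0 : ContDiff ℝ 2 fun q : Fin 2 → ℝ => q 0 := contDiff_apply ℝ ℝ 0
    have h1 : ContDiff ℝ 2 (support a b) := by
      have : ∀ s, cosh s ≠ 0 := fun s => (cosh_pos s).ne'
      unfold support height
      have hs := Real.contDiff_sinh (n := 2)
      have hc := Real.contDiff_cosh (n := 2)
      fun_prop (disch := assumption)
    exact ((h1.comp h0).sub contDiff_const).contDiffOn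
  · intro q hq
    have h1 := hueq q hq
    rw [jacobiOperator_catParam b ha] at h1
    have hc := cosh_pos (q 0)
    field_simp at h1 ⊢
    linarith
  · intro q hq
    simp only [hheight]
    rw [flatLaplacian_comp_zero hdsup (hasDerivAt_radial_div_sq a b (q 0))]
    have hq' : distSq a b (q 0) < 1 := hq
    have hsq := support_sq_add_radial_sq a b (q 0)
    have hs := hsup _ hq'.le
    have hc := cosh_pos (q 0)
    have hr : a * cosh (q 0) ≤ 1 := by
      unfold distSq at hq'
      nlinarith [sq_nonneg (height a b (q 0)), mul_pos ha hc]
    have hs1 : support a b (q 0) ≤ 1 := by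
      nlinarith [sq_nonneg (radial a b (q 0) / cosh (q 0))]
    set y := support a b (q 0)
    set C := cosh (q 0)
    -- The gain `m * a ^ 2` competes with `lam * (a * C) ^ 4 * (y - m / 2)`, and inside the ball `a
    -- * C ≤ 1` and `y ≤ 1`.
    have h1 : -(2 / C ^ 2 * y) + (2 / C ^ 2 + lam * (a * C) ^ 2) * (y - m / 2) =
        (lam * (a * C) ^ 4 * (y - m / 2) - m * a ^ 2) / (a ^ 2 * C ^ 2) := by
      field_simp; ring
    rw [h1]
    refine div_neg_of_neg_of_pos ?_ (by positivity)
    have h2 : (a * C) ^ 4 * (y - m / 2) ≤ 1 :=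
      mul_le_one₀ (pow_le_one₀ (by positivity) hr) (by linarith) (by linarith)
    have h3 : 0 ≤ (a * C) ^ 4 * (y - m / 2) := mul_nonneg (by positivity) (by linarith)
    have h4 : lam * ((a * C) ^ 4 * (y - m / 2)) ≤ |lam| * 1 :=
      mul_le_mul (le_abs_self _) h2 h3 (abs_nonneg _)
    linarith

/-! ### The disc -/

/-- The parametrization of the plane at height `h`. -/
noncomputable def discParam (h : ℝ) : (Fin 2 → ℝ) → E3 :=
  sepMap id (fun _ => 1) (fun _ => h) (fun _ => 1) (fun _ => 1) id

theorem tangentVec_discParam (h : ℝ) (i : Fin 2) (q : Fin 2 → ℝ) :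
    tangentVec (discParam h) i q = if i = 0 then !₂[1, 0, 0] else !₂[0, 0, 1] := by
  obtain ⟨h0, h1⟩ := fderiv_sepMap (q := q) (hasDerivAt_id (q 0)) (hasDerivAt_const (q 1) (1 : ℝ))
    (hasDerivAt_const (q 0) h) (hasDerivAt_const (q 1) (1 : ℝ))
    (hasDerivAt_const (q 0) (1 : ℝ)) (hasDerivAt_id (q 1))
  fin_cases i
  · exact h0.trans (by simp)
  · exact h1.trans (by simp)

theorem firstForm_discParam (h : ℝ) (q : Fin 2 → ℝ) :
    firstForm (discParam h) q = (1 : ℝ) • (1 : Matrix (Fin 2) (Fin 2) ℝ) := by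
  ext i j
  simp only [firstForm, Matrix.of_apply, tangentVec_discParam]
  fin_cases i <;> fin_cases j <;> simp [inner_vec3, norm_vec3]

theorem jacobiOperator_discParam (h : ℝ) (f : (Fin 2 → ℝ) → ℝ) (q : Fin 2 → ℝ) :
    jacobiOperator (discParam h) f q = flatLaplacian f q := by
  have h1 : secondForm (discParam h) q = 0 := by
    ext i j
    have : tangentVec (discParam h) j = fun _ => if j = 0 then !₂[1, 0, 0] else !₂[0, 0, 1] :=
      funext (tangentVec_discParam h j)
    simp [secondForm, secondDeriv, this]
  rw [jacobiOperator, laplaceBeltrami_of_conformal (E := fun _ => 1) (fun _ => one_pos)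
    (firstForm_discParam h), normSqA_of_conformal (E := fun _ => 1) one_pos
    (firstForm_discParam h q), h1]
  simp

theorem discParam_apply (h : ℝ) (q : Fin 2 → ℝ) :
    discParam h q 0 = q 0 ∧ discParam h q 1 = h ∧ discParam h q 2 = q 1 := by
  simp [discParam, sepMap]

theorem contDiff_discParam (h : ℝ) : ContDiff ℝ ∞ (discParam h) := by
  rw [contDiff_euclidean]
  have h0 : ContDiff ℝ ∞ fun q : Fin 2 → ℝ => q 0 := contDiff_apply ℝ ℝ 0
  have h1 : ContDiff ℝ ∞ fun q : Fin 2 → ℝ => q 1 := contDiff_apply ℝ ℝ 1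
  intro i
  fin_cases i
  · exact h0.mul contDiff_const
  · exact contDiff_const.mul contDiff_const
  · exact contDiff_const.mul h1

theorem flatLaplacian_sub_sq_sub_sq (c : ℝ) (q : Fin 2 → ℝ) :
    flatLaplacian (fun q => c - q 0 ^ 2 - q 1 ^ 2) q = -4 := by
  have hd : ∀ (i : Fin 2) (p : Fin 2 → ℝ), HasFDerivAt (fun q : Fin 2 → ℝ => q i)
    (ContinuousLinearMap.proj (R := ℝ) (φ := fun _ : Fin 2 => ℝ) i) p := fun i p =>
      hasFDerivAt_apply i p
  have h : ∀ (i : Fin 2) (p : Fin 2 → ℝ), fderiv ℝ (fun q : Fin 2 → ℝ => c - q 0 ^ 2 - q 1 ^ 2) p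
      (Pi.single i 1) = -2 * p i := fun i p => by
    have h1 : HasFDerivAt (fun q : Fin 2 → ℝ => c - q 0 ^ 2 - q 1 ^ 2) _ p :=
      (((hd 0 p).pow 2).const_sub c).sub ((hd 1 p).pow 2)
    rw [h1.fderiv]
    fin_cases i <;> simp
  rw [flatLaplacian, Fin.sum_univ_two]
  simp only [h]
  rw [((hd 0 q).const_mul (-2)).fderiv, ((hd 1 q).const_mul (-2)).fderiv]
  simp
  norm_num

theorem disc_not_isDirichletEigenvalue {h lam : ℝ} (hlam : |lam| < 2) :
    ¬IsDirichletEigenvalue ({p : E3 | p 1 = h} ∩ unitBall)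
      ({p : E3 | p 1 = h} ∩ unitBall ∩ unitSphere) lam := by
  rintro ⟨u, hu, hB, ⟨p, hp, hpu⟩, hF⟩
  set S := {p : E3 | p 1 = h} ∩ unitBall with hS
  set U : Set (Fin 2 → ℝ) := {q | q 0 ^ 2 + h ^ 2 + q 1 ^ 2 < 1} with hU
  have hi : ∀ i : Fin 3, Continuous fun p : E3 => p i := fun i =>
    (EuclideanSpace.proj (𝕜 := ℝ) i).continuous
  have hcomp : IsCompact S :=
    (isCompact_closedBall 0 1).inter_left (isClosed_eq (hi 1) continuous_const)
  have hUo : IsOpen U := isOpen_lt (by fun_prop) continuous_const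
  have hnorm : ∀ q, ‖discParam h q‖ ^ 2 = q 0 ^ 2 + h ^ 2 + q 1 ^ 2 := fun q => by
    obtain ⟨h0, h1, h2⟩ := discParam_apply h q
    rw [norm_sq_eq, h0, h1, h2]
  have hmaps : MapsTo (discParam h) U (S \ (S ∩ unitSphere)) := by
    intro q hq
    have hq' : q 0 ^ 2 + h ^ 2 + q 1 ^ 2 < 1 := hq
    rw [← hnorm] at hq'
    exact ⟨⟨(discParam_apply h q).2.1, mem_unitBall_iff.2 hq'.le⟩,
      fun h2 => hq'.ne (mem_unitSphere_iff.1 h2.2)⟩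
  have hparam : IsLocalParam (S \ (S ∩ unitSphere)) U (discParam h) :=
    ⟨hUo, (contDiff_discParam h).contDiffOn, fun q _ => linearIndependent_of_conformal
      (E := fun _ => 1) one_pos (firstForm_discParam h q), hmaps⟩
  obtain ⟨hu2, hueq⟩ := hF U _ hparam
  have hw : ∀ q, 2 - discParam h q 0 ^ 2 - discParam h q 2 ^ 2 = 2 - q 0 ^ 2 - q 1 ^ 2 := fun q => by
    obtain ⟨h0, -, h2⟩ := discParam_apply h q
    rw [h0, h2]
  -- This `w` has Laplacian `-4` and values at most `2`, whence the threshold `|lam| < 2`.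
  refine hpu (eq_zero_of_supersolution (S := S) (B := S ∩ unitSphere) hcomp hUo
    (F := discParam h) (w := fun p => 2 - p 0 ^ 2 - p 2 ^ 2) (V := fun _ => lam) ?_
    (fun q hq => (hmaps hq).1) hu hB ?_ ?_ hu2 ?_ ?_ ?_ p hp)
  · rintro p ⟨hp1, hp2⟩
    have hpe : discParam h ![p 0, p 2] = p := by
      obtain ⟨h0, h1, h2⟩ := discParam_apply h ![p 0, p 2]
      ext i
      fin_cases i
      · exact h0
      · exact h1.trans hp1.1.symm
      · exact h2
    refine ⟨![p 0, p 2], ?_, hpe⟩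
    have h1 := hnorm ![p 0, p 2]
    rw [hpe] at h1
    refine lt_of_le_of_ne (h1 ▸ mem_unitBall_iff.1 hp1.2) fun h2 => hp2 ⟨hp1, ?_⟩
    rw [mem_unitSphere_iff, h1, h2]
  · have h0 := hi 0
    have h2 := hi 2
    exact ((continuous_const.sub (h0.pow 2)).sub (h2.pow 2)).continuousOn
  · intro p hp
    have := mem_unitBall_iff.1 hp.2
    rw [norm_sq_eq] at this
    nlinarith [sq_nonneg (p 1)]
  · simp only [hw]
    have h0 : ContDiff ℝ 2 fun q : Fin 2 → ℝ => q 0 := contDiff_apply ℝ ℝ 0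
    have h1 : ContDiff ℝ 2 fun q : Fin 2 → ℝ => q 1 := contDiff_apply ℝ ℝ 1
    exact ((contDiff_const.sub (h0.pow 2)).sub (h1.pow 2)).contDiffOn
  · intro q hq
    have h1 := hueq q hq
    rwa [jacobiOperator_discParam] at h1
  · intro q hq
    simp only [hw]
    rw [flatLaplacian_sub_sq_sub_sq]
    have hq' : q 0 ^ 2 + h ^ 2 + q 1 ^ 2 < 1 := hq
    have h1 : 0 ≤ 2 - q 0 ^ 2 - q 1 ^ 2 := by nlinarith [sq_nonneg h]
    have h2 : 2 - q 0 ^ 2 - q 1 ^ 2 ≤ 2 := by nlinarith [sq_nonneg (q 0), sq_nonneg (q 1)]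
    have h3 : lam * (2 - q 0 ^ 2 - q 1 ^ 2) ≤ |lam| * 2 :=
      mul_le_mul (le_abs_self _) h2 h1 (abs_nonneg _)
    linarith

end CatConf

namespace CatConf

open Real Set Filter Topology

/-! ### Uniform bounds for configurations of given total order -/

theorem abs_shiftSeq_le (σ : lp (fun _ : ℕ+ => ℝ) 1) (n : ℕ) : |shiftSeq σ n| ≤ ‖σ‖ := by
  have := lp.norm_apply_le_norm one_ne_zero σ n.succPNat
  simpa [shiftSeq] using this

/-- A lower bound for the angle at the lower end point. -/
theorem IsStart.le_arccos_exitSupport {β φ : ℝ} (h : IsStart β φ) (hα : φ - β < π / 2) :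
    neck β φ ^ 2 * (φ - β) / 2 ≤ arccos (exitSupport β φ) := by
  have harc := h.isArc
  have ha := h.neck_pos
  have hα0 : 0 < φ - β := by linarith [h.lt]
  have h1 := sin_le h.arccos_exitSupport_pos.le
  have h2 : (φ - β) / 2 ≤ sin (φ - β) := by
    have h3 := mul_le_sin hα0.le hα.le
    have h4 : 1 / 2 ≤ 2 / π := by
      rw [div_le_div_iff₀ two_pos pi_pos]; linarith [pi_le_four]
    nlinarith
  have h3 := harc.sin_arccos_left
  have h4 := harc.neck_mul_radial_le
  have h5 := harc.neck_mul_cosh_le ⟨le_rfl, harc.lt.le⟩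
  have h6 : sin (φ - β) ≤ radial (neck β φ) (center β φ) (startParam φ) := by
    rw [radial_startParam h.sin_dir_pos, le_div_iff₀ h.sin_dir_pos]
    have := sin_le_one φ
    have := h.sin_sub_pos
    nlinarith
  have hc := cosh_pos (exitParam β φ)
  -- One factor of the neck comes from `a * radial s₀ ≤ -radial s₁`, the other from `1 / cosh s₁ ≥
  -- a`.
  have h7 : neck β φ ^ 2 * sin (φ - β) ≤ sin (arccos (exitSupport β φ)) := by
    rw [exitSupport, h3, le_div_iff₀ hc]
    calc neck β φ ^ 2 * sin (φ - β) * cosh (exitParam β φ)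
        = (neck β φ * cosh (exitParam β φ)) * (neck β φ * sin (φ - β)) := by ring
      _ ≤ 1 * (neck β φ * sin (φ - β)) :=
        mul_le_mul_of_nonneg_right h5 (mul_pos ha h.sin_sub_pos).le
      _ ≤ neck β φ * radial (neck β φ) (center β φ) (startParam φ) := by
        rw [one_mul]; exact mul_le_mul_of_nonneg_left h6 ha.le
      _ ≤ _ := h4
  have h8 : neck β φ ^ 2 * (φ - β) / 2 ≤ neck β φ ^ 2 * sin (φ - β) := by
    have := mul_le_mul_of_nonneg_left h2 (sq_nonneg (neck β φ))
    linarith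
  linarith

theorem support_neg_center (a b s : ℝ) : support a (-b) s = support a b (-s) := by
  simp only [support, height, sinh_neg, cosh_neg]; ring

theorem distSq_neg_center (a b s : ℝ) : distSq a (-b) s = distSq a b (-s) := by
  simp only [distSq, height, cosh_neg]; ring

/-- On a symmetric arc the support function is minimal at the end points. -/
theorem IsArc.support_le_of_symmetric {a s₁ s₀ : ℝ} (h : IsArc a 0 s₁ s₀) (h0 : 0 < s₀) {s : ℝ}
    (hs : distSq a 0 s ≤ 1) : support a 0 s₀ ≤ support a 0 s := by
  have ha := h.pos
  have hneg : distSq a 0 (-s) ≤ 1 := by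
    rw [← distSq_neg_center, neg_zero]; exact hs
  have k1 := ((h.mem_Icc_iff _).1 hs).2
  have k2 := ((h.mem_Icc_iff _).1 hneg).2
  have key : ∀ u, 0 ≤ u → u ≤ s₀ → support a 0 s₀ ≤ support a 0 u := by
    intro u hu hus
    have h1 : sinh u / cosh u ≤ sinh s₀ / cosh s₀ := strictMono_sinh_div_cosh.monotone hus
    have h2 : 0 ≤ sinh u / cosh u := div_nonneg (sinh_nonneg_iff.2 hu) (cosh_pos u).le
    have h3 : u * (sinh u / cosh u) ≤ s₀ * (sinh s₀ / cosh s₀) := mul_le_mul hus h1 h2 h0.le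
    have h4 := mul_le_mul_of_nonneg_left h3 ha.le
    simp only [support, height, zero_add]
    linarith
  rcases le_total 0 s with h1 | h1
  · exact key s h1 k1
  · have := key (-s) (by linarith) k2
    rwa [← support_neg_center, neg_zero] at this

theorem sin_le_sin_of_mem {x t : ℝ} (hx : 0 ≤ x) (h1 : x ≤ t) (h2 : t ≤ π - x) :
    sin x ≤ sin t := by
  rcases le_total t (π / 2) with h | h
  · exact sin_le_sin_of_le_of_le_pi_div_two (by linarith [pi_pos]) h h1
  · rw [← sin_pi_sub t]
    exact sin_le_sin_of_le_of_le_pi_div_two (by linarith [pi_pos]) (by linarith) (by linarith)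

namespace Configuration

variable {W : Configuration} {k : ℕ}

theorem HasTotalOrder.order_eq (h : W.HasTotalOrder k) : k / 2 = W.order := by
  rcases h with ⟨-, h⟩ | ⟨-, h⟩ <;> omega

theorem HasTotalOrder.half_pi_le (h : W.HasTotalOrder k) : π / 2 ≤ W.β (W.order + 1) := by
  rcases h with ⟨h, -⟩ | ⟨h, -⟩
  · exact h.ge
  · have := W.β_lt_half_pi W.order W.one_le_order le_rfl
    linarith

/-- A lower bound for the first latitude. -/
theorem Generates.lat_lower {σ : ℕ+ → ℝ} (hσ : IsSmall (shiftSeq σ)) (h : W.Generates σ k) :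
    1 / 4 < (4 * W.order + 1) * W.β 1 := by
  by_contra! hle
  have h1 := (isAdmissible_of_small hσ W.order (W.annulus 1 le_rfl W.one_le_order).pos hle).2
  obtain ⟨n, hn⟩ : ∃ n, W.order = n + 1 := ⟨W.order - 1, by have := W.one_le_order; omega⟩
  have h2 := h.2.2.half_pi_le
  rw [hn] at h1 h2 hle
  rw [h.2.1.orbit_succ_fst (by omega)] at h1
  linarith [pi_gt_three]

/-- The bounds on a configuration in terms of a lower bound `x` on the first latitude. -/
structure Bounds (W : Configuration) (x : ℝ) : Prop where
  pos : 0 < x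
  le_lat : ∀ n < W.order, x ≤ W.β (n + 1)
  angle_le : ∀ n < W.order, W.αPlus (n + 1) ≤ 5 * π / 14
  x_le : x ≤ 1 / 4

/-- The bound `log (5 / 4)` keeps the angles uniformly acute: `5 / 4 * (2π / 7) = 5π / 14`. The
latitude bound is `Generates.lat_lower` with the order replaced by the larger `k`. -/
theorem Generates.bounds {σ : lp (fun _ : ℕ+ => ℝ) 1} (hσ : ‖σ‖ ≤ log (5 / 4))
    (h : W.Generates σ k) {x : ℝ} (hx : 0 < x) (hxk : (4 * k + 1) * x ≤ 1 / 4) : W.Bounds x := by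
  have hlog : log (5 / 4) < log (7 / 4) := log_lt_log (by norm_num) (by norm_num)
  have hs := isSmall_shiftSeq (hσ.trans_lt hlog)
  have hord := h.2.2.order_eq
  have hk : (W.order : ℝ) ≤ k := by exact_mod_cast (by omega : W.order ≤ k)
  have hk0 : (0 : ℝ) ≤ k := k.cast_nonneg
  have h1 := h.lat_lower hs
  have hxβ : x ≤ W.β 1 := by
    by_contra! hlt
    have h2 : (4 * (W.order : ℝ) + 1) * W.β 1 ≤ (4 * k + 1) * x :=
      mul_le_mul (by linarith) hlt.le (W.annulus 1 le_rfl W.one_le_order).pos.le (by linarith)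
    linarith
  refine ⟨hx, fun n hn => ?_, fun n hn => ?_, by nlinarith⟩
  · have := (h.isAdmissible hn).orbit_bounds hs
    rw [h.2.1.orbit_eq hn] at this
    exact hxβ.trans this.1
  · have := ((h.isAdmissible hn).orbit_bounds hs).2.2.1
    rw [h.2.1.orbit_eq hn] at this
    have h2 : exp (∑ j ∈ Finset.range (n + 1), |shiftSeq σ j|) ≤ 5 / 4 := by
      rw [← Real.le_log_iff_exp_le (by norm_num)]
      exact (sum_abs_shiftSeq_le σ _).trans hσ
    have h3 := h.1
    have h4 := (W.annulus 1 le_rfl W.one_le_order).pos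
    calc _ ≤ _ := this
      _ ≤ 5 / 4 * (2 * π / 7) := mul_le_mul h2 h3.le h4.le (by norm_num)
      _ = _ := by ring

namespace Bounds

variable {x : ℝ}

theorem sin_pos (h : W.Bounds x) : 0 < sin x :=
  sin_pos_of_pos_of_lt_pi h.pos (by linarith [h.x_le, pi_gt_three])

theorem isStart (_h : W.Bounds x) {n : ℕ} (hn : n < W.order) :
    IsStart (W.β (n + 1)) (W.β (n + 1) + W.αPlus (n + 1)) := (W.annulus_succ hn).isStart

/-- The neck is `sin β * sin (β + α)` with both arguments in `[x, π - x]`: the direction is below `π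
/ 2 + 5π / 14 = 6π / 7`, and `x ≤ 1 / 4 < π / 7`. -/
theorem le_neck (h : W.Bounds x) {n : ℕ} (hn : n < W.order) : sin x ^ 2 ≤ W.a (n + 1) := by
  have h1 := (W.annulus_succ hn).neck_eq
  have h2 := h.le_lat n hn
  have h3 := h.angle_le n hn
  have h4 := W.β_lt_half_pi (n + 1) (by omega) (by omega)
  have h5 := (W.annulus_succ hn).angleIn_pos
  have h6 := h.pos
  have h7 := h.x_le
  have h8 := pi_gt_three
  have k1 : sin x ≤ sin (W.β (n + 1)) := sin_le_sin_of_mem h6.le h2 (by linarith)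
  have k2 : sin x ≤ sin (W.β (n + 1) + angleIn (W.a (n + 1)) (W.b (n + 1)) (W.β (n + 1))) := by
    change W.αPlus (n + 1) ≤ _ at h3
    unfold αPlus at h3
    exact sin_le_sin_of_mem h6.le (by linarith) (by linarith)
  rw [← h1, neck, sq]
  exact mul_le_mul k1 k2 h.sin_pos.le (h.sin_pos.le.trans k1)

theorem le_cos (h : W.Bounds x) {n : ℕ} (hn : n < W.order) : sin x ^ 2 ≤ cos (W.αPlus (n + 1)) := by
  have h3 := h.angle_le n hn
  have h7 := h.x_le
  have h8 := pi_gt_three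
  have h9 : 0 < W.αPlus (n + 1) := (W.annulus_succ hn).angleIn_pos
  have h1 : sin x ≤ cos (W.αPlus (n + 1)) := by
    rw [← sin_pi_div_two_sub]
    exact sin_le_sin_of_mem h.pos.le (by linarith) (by linarith)
  have h2 := sin_le_one x
  have h4 := h.sin_pos
  nlinarith

theorem angle_lt (h : W.Bounds x) {n : ℕ} (hn : n < W.order) : W.αPlus (n + 1) < π / 2 := by
  have := h.angle_le n hn
  linarith [pi_pos]

theorem le_αMinus_succ (h : W.Bounds x) {n : ℕ} (hn : n < W.order) :
    sin x ^ 4 / 2 * W.αPlus (n + 1) ≤ W.αMinus (n + 2) := by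
  have hst := h.isStart hn
  have hA := W.annulus_succ hn
  have h1 := hst.le_arccos_exitSupport (by rw [add_sub_cancel_left]; exact h.angle_lt hn)
  have h2 : neck (W.β (n + 1)) (W.β (n + 1) + W.αPlus (n + 1)) = W.a (n + 1) := hA.neck_eq
  have h3 : arccos (exitSupport (W.β (n + 1)) (W.β (n + 1) + W.αPlus (n + 1))) =
      W.αMinus (n + 2) := by rw [αMinus_succ]; exact hA.arccos_exitSupport
  rw [h2, h3, add_sub_cancel_left] at h1
  have h4 := h.le_neck hn
  have h5 := h.sin_pos
  have h6 : sin x ^ 4 ≤ W.a (n + 1) ^ 2 := by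
    calc sin x ^ 4 = (sin x ^ 2) ^ 2 := by ring
      _ ≤ _ := pow_le_pow_left₀ (by positivity) h4 2
  have h7 : 0 < W.αPlus (n + 1) := hA.angleIn_pos
  nlinarith

theorem αMinus_succ_le (h : W.Bounds x) {n : ℕ} (hn : n < W.order) (hy : W.β (n + 2) ≤ π / 2) :
    W.αMinus (n + 2) ≤ W.αPlus (n + 1) := by
  have hst := h.isStart hn
  have hA := W.annulus_succ hn
  have h2 : exitHeight (W.β (n + 1)) (W.β (n + 1) + W.αPlus (n + 1)) = cos (W.β (n + 2)) :=
    hA.exitHeight_eq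
  have hpos : 0 < W.β (n + 2) := hA.pos.trans hA.lt
  have h1 := hst.arccos_exitSupport_le (by rw [add_sub_cancel_left]; exact h.angle_lt hn) (by
    rw [h2]; exact cos_nonneg_of_mem_Icc ⟨by linarith [pi_pos], hy⟩)
  have h3 : arccos (exitSupport (W.β (n + 1)) (W.β (n + 1) + W.αPlus (n + 1))) =
      W.αMinus (n + 2) := by rw [W.αMinus_succ]; exact hA.arccos_exitSupport
  rwa [h3, add_sub_cancel_left] at h1

theorem αMinus_le (h : W.Bounds x) (h0 : W.β 1 < 2 * π / 7) {n : ℕ} (hn : n ≤ W.order)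
    (hy : W.β (n + 1) ≤ π / 2) : W.αMinus (n + 1) ≤ 5 * π / 14 := by
  cases n with
  | zero => rw [αMinus_one]; linarith [pi_pos]
  | succ n => exact (h.αMinus_succ_le hn hy).trans (h.angle_le n hn)

/-- The lower bound on the angles. -/
theorem le_angle (h : W.Bounds x) {σ : ℕ+ → ℝ} (hW : W.HasUnbalancing σ)
    (hσ : ∀ n, 1 / 2 ≤ exp (shiftSeq σ n)) {n : ℕ} (hn : n ≤ W.order) :
    (sin x ^ 4 / 4) ^ n * x ≤ W.αMinus (n + 1) ∧
      (n < W.order → (sin x ^ 4 / 4) ^ n * (x / 2) ≤ W.αPlus (n + 1)) := by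
  have hsin := h.sin_pos
  have hx := h.pos
  have hplus : ∀ n, (sin x ^ 4 / 4) ^ n * x ≤ W.αMinus (n + 1) → n < W.order →
      (sin x ^ 4 / 4) ^ n * (x / 2) ≤ W.αPlus (n + 1) := by
    intro n h1 hn'
    rw [hW.αPlus_eq hn']
    have h2 := hσ n
    have h3 : 0 ≤ (sin x ^ 4 / 4) ^ n * x := by positivity
    nlinarith
  suffices h0 : (sin x ^ 4 / 4) ^ n * x ≤ W.αMinus (n + 1) from ⟨h0, hplus n h0⟩
  induction n with
  | zero => rw [αMinus_one]; simpa using h.le_lat 0 W.one_le_order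
  | succ n ih =>
    have h1 := hplus n (ih (by omega)) hn
    have h2 := h.le_αMinus_succ (n := n) hn
    calc _ = sin x ^ 4 / 2 * ((sin x ^ 4 / 4) ^ n * (x / 2)) := by rw [pow_succ]; ring
      _ ≤ sin x ^ 4 / 2 * W.αPlus (n + 1) := mul_le_mul_of_nonneg_left h1 (by positivity)
      _ ≤ _ := h2

theorem le_angle_uniform (h : W.Bounds x) {σ : ℕ+ → ℝ} (hW : W.HasUnbalancing σ)
    (hσ : ∀ n, 1 / 2 ≤ exp (shiftSeq σ n)) (hk : W.order ≤ k) {n : ℕ} (hn : n ≤ W.order) :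
    (sin x ^ 4 / 4) ^ k * (x / 2) ≤ W.αMinus (n + 1) ∧
      (n < W.order → (sin x ^ 4 / 4) ^ k * (x / 2) ≤ W.αPlus (n + 1)) := by
  have hsin := h.sin_pos
  have hx := h.pos
  have h1 : sin x ^ 4 / 4 ≤ 1 := by
    have := pow_le_one₀ (n := 4) hsin.le (sin_le_one x); linarith
  have h2 : (sin x ^ 4 / 4) ^ k ≤ (sin x ^ 4 / 4) ^ n :=
    pow_le_pow_of_le_one (by positivity) h1 (by omega)
  have h3 : (sin x ^ 4 / 4) ^ k * (x / 2) ≤ (sin x ^ 4 / 4) ^ n * (x / 2) :=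
    mul_le_mul_of_nonneg_right h2 (by linarith)
  have h4 : 0 ≤ (sin x ^ 4 / 4) ^ n * (x / 2) := by positivity
  obtain ⟨h5, h6⟩ := h.le_angle hW hσ hn
  exact ⟨by nlinarith, fun hn' => h3.trans (h6 hn')⟩

/-- The support function of each catenoid is bounded below inside the ball. -/
theorem le_support (h : W.Bounds x) (hk : W.HasTotalOrder k) {n : ℕ} (hn : n < W.order) {s : ℝ}
    (hs : distSq (W.a (n + 1)) (W.b (n + 1)) s ≤ 1) :
    sin x ^ 2 ≤ support (W.a (n + 1)) (W.b (n + 1)) s := by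
  have hA := W.annulus_succ hn
  have harc := hA.isArc
  have h1 : sin x ^ 2 ≤ support (W.a (n + 1)) (W.b (n + 1))
      ((cos (W.β (n + 1)) - W.b (n + 1)) / W.a (n + 1)) := by
    rw [← harc.cos_arccos_right, ← hA.angleIn_eq]
    exact h.le_cos hn
  have hlt := W.β_lt_half_pi (n + 1) (by omega) (by omega)
  rcases le_or_gt (W.β (n + 2)) (π / 2) with hy | hy
  · have hpos : 0 < W.β (n + 2) := hA.pos.trans hA.lt
    refine (le_min (h.le_neck hn) h1).trans
      (harc.min_le_support ?_ ((harc.mem_Icc_iff s).1 hs))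
    rw [hA.height_ex]
    exact cos_nonneg_of_mem_Icc ⟨by linarith [pi_pos], hy⟩
  -- Only the last annulus can end in the southern hemisphere, and only for even total order, when
  -- it is symmetric.
  · have hn' : W.order = n + 1 := by
      by_contra hne
      have := W.β_lt_half_pi (n + 2) (by omega) (by omega)
      linarith
    rcases hk with ⟨h2, -⟩ | ⟨h2, -⟩
    · rw [hn'] at h2; linarith
    · rw [hn'] at h2
      have hb := hA.center_eq_zero h2
      rw [hb] at h1 harc hs ⊢
      have hc : 0 < cos (W.β (n + 1)) := cos_pos_of_mem_Ioo ⟨by linarith [hA.pos, pi_pos], hlt⟩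
      exact h1.trans (harc.support_le_of_symmetric
        (div_pos (by linarith) hA.neck_pos) hs)

end Bounds

end Configuration

/-! ### Reflected pieces -/

theorem reflectY_apply (p : E3) : reflectY p 0 = p 0 ∧ reflectY p 1 = -p 1 ∧
    reflectY p 2 = p 2 := by
  simp [reflectY]

theorem reflectY_reflectY (p : E3) : reflectY (reflectY p) = p := by
  obtain ⟨h0, h1, h2⟩ := reflectY_apply p
  obtain ⟨k0, k1, k2⟩ := reflectY_apply (reflectY p)
  ext i
  fin_cases i
  · exact k0.trans h0
  · exact k1.trans ((congrArg Neg.neg h1).trans (neg_neg _))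
  · exact k2.trans h2

theorem mem_image_reflectY_iff {S : Set E3} {p : E3} : p ∈ reflectY '' S ↔ reflectY p ∈ S := by
  constructor
  · rintro ⟨q, hq, rfl⟩; rwa [reflectY_reflectY]
  · intro h; exact ⟨_, h, reflectY_reflectY p⟩

theorem reflectY_mem_unitBall_iff {p : E3} : reflectY p ∈ unitBall ↔ p ∈ unitBall := by
  obtain ⟨h0, h1, h2⟩ := reflectY_apply p
  rw [mem_unitBall_iff, mem_unitBall_iff, norm_sq_eq, norm_sq_eq, h0, h1, h2, neg_sq]

theorem image_reflectY_disc (h : ℝ) : reflectY '' ({p : E3 | p 1 = h} ∩ unitBall) =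
    {p : E3 | p 1 = -h} ∩ unitBall := by
  ext p
  rw [mem_image_reflectY_iff, mem_inter_iff, mem_inter_iff, reflectY_mem_unitBall_iff,
    mem_ofPred_eq, mem_ofPred_eq, (reflectY_apply p).2.1, neg_eq_iff_eq_neg]

theorem image_reflectY_catenoid (a b : ℝ) : reflectY '' (catenoid a b ∩ unitBall) =
    catenoid a (-b) ∩ unitBall := by
  ext p
  obtain ⟨h0, h1, h2⟩ := reflectY_apply p
  rw [mem_image_reflectY_iff, mem_inter_iff, mem_inter_iff, reflectY_mem_unitBall_iff,
    catenoid, catenoid, mem_ofPred_eq, mem_ofPred_eq, h0, h1, h2,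
    show (-p 1 - b) / a = -((p 1 - -b) / a) by ring, cosh_neg]

/-! ### Eigenvalues, necks and angles of the extended configuration -/

namespace Configuration

variable {W : Configuration} {k : ℕ} {x : ℝ}

/-- The exponent is `6 = 2 + 2 * 2`: the support function and the neck are both at least `sin x ^
2`, and the threshold is `m * a ^ 2`. A reflection only changes the sign of `b`. -/
theorem Bounds.not_isDirichletEigenvalue (h : W.Bounds x) (hk : W.HasTotalOrder k) {j : ℕ}
    (hj : j ≤ k) {lam : ℝ} (hlam : |lam| < sin x ^ 6) :
    ¬IsDirichletEigenvalue (W.extPiece k j) (W.extPiece k j ∩ unitSphere) lam := by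
  have hord := hk.order_eq
  have hsin := h.sin_pos
  have h1 : sin x ^ 6 ≤ 1 := pow_le_one₀ hsin.le (sin_le_one x)
  have hneck : ∀ n < W.order, 0 < W.a (n + 1) ∧ |lam| < sin x ^ 2 * W.a (n + 1) ^ 2 := by
    intro n hn
    have h2 := h.le_neck hn
    have h3 : (sin x ^ 2) ^ 2 ≤ W.a (n + 1) ^ 2 := pow_le_pow_left₀ (by positivity) h2 2
    refine ⟨(W.annulus_succ hn).neck_pos, hlam.trans_le ?_⟩
    calc sin x ^ 6 = sin x ^ 2 * (sin x ^ 2) ^ 2 := by ring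
      _ ≤ _ := mul_le_mul_of_nonneg_left h3 (by positivity)
  rw [extPiece]
  split_ifs with hjk
  · rcases j with _ | n
    · rw [piece, if_pos rfl]
      exact disc_not_isDirichletEigenvalue (by linarith)
    · rw [piece, if_neg n.succ_ne_zero]
      have hn : n < W.order := by omega
      exact catenoid_not_isDirichletEigenvalue (hneck n hn).1 (by positivity)
        (fun s hs => h.le_support hk hn hs) (hneck n hn).2
  · obtain hkj | ⟨n, hkj⟩ : k - j = 0 ∨ ∃ n, k - j = n + 1 := by
      rcases k - j with _ | n
      · exact Or.inl rfl
      · exact Or.inr ⟨n, rfl⟩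
    · rw [hkj, piece, if_pos rfl, image_reflectY_disc]
      exact disc_not_isDirichletEigenvalue (by linarith)
    · rw [hkj, piece, if_neg n.succ_ne_zero, image_reflectY_catenoid]
      have hn : n < W.order := by omega
      refine catenoid_not_isDirichletEigenvalue (hneck n hn).1 (by positivity)
        (fun s hs => ?_) (hneck n hn).2
      rw [support_neg_center]
      rw [distSq_neg_center] at hs
      exact h.le_support hk hn hs

theorem Bounds.lt_extNeck (h : W.Bounds x) (hk : W.HasTotalOrder k) {i : ℕ} (hi : 1 ≤ i)
    (hik : i ≤ k - 1) : sin x ^ 2 ≤ W.extNeck k i := by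
  have hord := hk.order_eq
  rw [extNeck]
  split_ifs with hlt
  · obtain ⟨n, rfl⟩ : ∃ n, i = n + 1 := ⟨i - 1, by omega⟩
    exact h.le_neck (by omega)
  · obtain ⟨n, hn⟩ : ∃ n, k - i = n + 1 := ⟨k - i - 1, by omega⟩
    rw [hn]
    exact h.le_neck (by omega)

/-- The factor `4` comes from `α⁻ - α⁺ = (exp (-σ) - 1) α⁺`, with `|exp (-σ) - 1| ≤ 2 |σ|` and `α⁺ ≤
2`. -/
theorem Bounds.ext_angles (h : W.Bounds x) {σ : lp (fun _ : ℕ+ => ℝ) 1} {δ : ℝ}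
    (hW : W.Generates σ k) (hσ : ‖σ‖ ≤ log (5 / 4)) (hσ1 : ‖σ‖ ≤ 1) (hδ : 4 * ‖σ‖ ≤ δ) {i : ℕ}
    (hi : 1 ≤ i) (hik : i ≤ k) :
    W.extαPlus k i ∈ Icc ((sin x ^ 4 / 4) ^ k * (x / 2)) (5 * π / 14) ∧
      |W.extαMinus k i - W.extαPlus k i| ≤ δ := by
  have hord := hW.2.2.order_eq
  have hexp : ∀ n, 1 / 2 ≤ exp (shiftSeq σ n) := by
    intro n
    have h1 := neg_le_of_abs_le ((abs_shiftSeq_le σ n).trans hσ)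
    have h2 := exp_le_exp.2 h1
    rw [Real.exp_neg, Real.exp_log (by norm_num)] at h2
    norm_num at h2 ⊢
    linarith
  have hlow := fun n hn => h.le_angle_uniform (k := k) hW.2.1 hexp (by omega) (n := n) hn
  have hdiff : ∀ n < W.order, |W.αMinus (n + 1) - W.αPlus (n + 1)| ≤ δ := by
    intro n hn
    have h1 : W.αMinus (n + 1) - W.αPlus (n + 1) =
        (exp (-shiftSeq σ n) - 1) * W.αPlus (n + 1) := by
      rw [hW.2.1.αPlus_eq hn, sub_mul, ← mul_assoc, ← Real.exp_add]; simp
    have h2 : |exp (-shiftSeq σ n) - 1| ≤ 2 * |shiftSeq σ n| := by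
      have := Real.abs_exp_sub_one_le (x := -shiftSeq σ n)
        (by rw [abs_neg]; exact (abs_shiftSeq_le σ n).trans hσ1)
      rwa [abs_neg] at this
    have h3 : 0 < W.αPlus (n + 1) := (W.annulus_succ hn).angleIn_pos
    have h4 : W.αPlus (n + 1) ≤ 2 := by
      have := h.angle_lt hn; linarith [pi_le_four]
    rw [h1, abs_mul, abs_of_pos h3]
    have h5 := abs_shiftSeq_le σ n
    have h6 : |exp (-shiftSeq σ n) - 1| * W.αPlus (n + 1) ≤ (2 * |shiftSeq σ n|) * 2 :=
      mul_le_mul h2 h4 h3.le (by positivity)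
    linarith
  have hδ0 : 0 ≤ δ := by linarith [norm_nonneg σ]
  rw [extαPlus, extαMinus]
  split_ifs with h1 h2 h3
  · obtain ⟨n, rfl⟩ : ∃ n, i = n + 1 := ⟨i - 1, by omega⟩
    have hn : n < W.order := by omega
    exact ⟨⟨(hlow n hn.le).2 hn, h.angle_le n hn⟩, hdiff n hn⟩
  · omega
  -- The circle on the equator, present only for odd `k`: both angles are the same `αMinus`.
  · have hodd : W.β (W.order + 1) = π / 2 ∧ k = 2 * W.order + 1 := by
      rcases hW.2.2 with h4 | ⟨-, h4⟩
      · exact h4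
      · omega
    have hi' : i = W.order + 1 := by omega
    have hki : k + 1 - i = W.order + 1 := by omega
    rw [hki, hi', sub_self, abs_zero]
    exact ⟨⟨(hlow _ le_rfl).1, h.αMinus_le hW.1 le_rfl hodd.1.le⟩, hδ0⟩
  · obtain ⟨n, hn⟩ : ∃ n, k + 1 - i = n + 1 := ⟨k - i, by omega⟩
    have hn' : n < W.order := by omega
    rw [hn]
    refine ⟨⟨(hlow n hn'.le).1, h.αMinus_le hW.1 hn'.le
      (W.β_lt_half_pi (n + 1) (by omega) (by omega)).le⟩, ?_⟩
    rw [abs_sub_comm]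
    exact hdiff n hn'

end Configuration

end CatConf

/-! ### Choice of the constants -/

open CatConf
theorem mainTheorem4 :
    ∃ δ₀ : ℝ, 0 < δ₀ ∧
      (∀ k : ℕ, 3 ≤ k → ∀ σ : lp (fun _ : ℕ+ => ℝ) 1, ‖σ‖ < δ₀ →
        ∃! βhat : ℝ, ∃ W : Configuration, W.β 1 = βhat ∧ W.Generates σ k) ∧
      ∃ K : ℕ, ∀ k : ℕ, K ≤ k → ∃ δσ c δθ : ℝ, 0 < δσ ∧ δσ < δ₀ ∧ 0 < c ∧ 0 < δθ ∧
        ∀ σ : lp (fun _ : ℕ+ => ℝ) 1, ‖σ‖ ≤ δσ →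
          ∀ W : Configuration, W.Generates σ k →
            (∀ i : ℕ, 1 ≤ i → i ≤ k →
              W.extαPlus k i ∈ Set.Icc (30 * δθ) (Real.pi / 2 - 30 * δθ) ∧
              |W.extαMinus k i - W.extαPlus k i| ≤ δθ) ∧
            (∀ i : ℕ, 1 ≤ i → i ≤ k - 1 → δθ < W.extNeck k i) ∧
            (∀ j : ℕ, j ≤ k → ∀ lam ∈ Set.Icc (-c) c,
              ¬ IsDirichletEigenvalue (W.extPiece k j) (W.extPiece k j ∩ unitSphere) lam) := by
  obtain ⟨δ₀, hδ₀, -, hex⟩ := exists_unique_lat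
  refine ⟨δ₀, hδ₀, hex, 3, fun k _ => ?_⟩
  have hk0 : (0 : ℝ) ≤ k := k.cast_nonneg
  -- The largest value with `(4 * k + 1) * x ≤ 1 / 4`, hence a lower bound for the latitudes.
  set x : ℝ := 1 / (4 * (4 * k + 1)) with hx
  have hxpos : 0 < x := by positivity
  have hxk : (4 * k + 1) * x ≤ 1 / 4 := by rw [hx]; apply le_of_eq; field_simp
  have hsin : 0 < Real.sin x :=
    Real.sin_pos_of_pos_of_lt_pi hxpos (by nlinarith [Real.pi_gt_three])
  set l : ℝ := (Real.sin x ^ 4 / 4) ^ k * (x / 2) with hl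
  have hlpos : 0 < l := by positivity
  obtain ⟨δθ, hθ, h1, h2, h3⟩ : ∃ δθ : ℝ, 0 < δθ ∧ δθ ≤ 1 / 100 ∧ 30 * δθ ≤ l ∧
      δθ < Real.sin x ^ 2 := by
    -- The entry `1 / 100` serves the upper angle bound, as `30 / 100 < π / 7 = π / 2 - 5π / 14`; `l
    -- / 30` serves the lower one, and the last entry the necks.
    refine ⟨min (1 / 100) (min (l / 30) (Real.sin x ^ 2 / 2)), by positivity, min_le_left _ _,
      ?_, ?_⟩
    · have := (min_le_right (1 / 100) (min (l / 30) (Real.sin x ^ 2 / 2))).trans (min_le_left _ _)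
      linarith
    · have := (min_le_right (1 / 100) (min (l / 30) (Real.sin x ^ 2 / 2))).trans (min_le_right _ _)
      have : 0 < Real.sin x ^ 2 := by positivity
      linarith
  have hlog : 0 < Real.log (5 / 4) := Real.log_pos (by norm_num)
  -- `δθ / 4` compensates the factor `4` in `Bounds.ext_angles`; halving `δ₀` and `sin x ^ 6` makes
  -- the required inequalities strict.
  refine ⟨min (δ₀ / 2) (min (Real.log (5 / 4)) (δθ / 4)), Real.sin x ^ 6 / 2, δθ,
    by positivity, (min_le_left _ _).trans_lt (by linarith), by positivity, hθ,
    fun σ hσ W hW => ?_⟩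
  have hσ1 : ‖σ‖ ≤ Real.log (5 / 4) := hσ.trans ((min_le_right _ _).trans (min_le_left _ _))
  have hσ2 : ‖σ‖ ≤ δθ / 4 := hσ.trans ((min_le_right _ _).trans (min_le_right _ _))
  have hB := hW.bounds hσ1 hxpos hxk
  have hpi := Real.pi_gt_three
  refine ⟨fun i hi hik => ?_, fun i hi hik => h3.trans_le (hB.lt_extNeck hW.2.2 hi hik),
    fun j hj lam hlam => hB.not_isDirichletEigenvalue hW.2.2 hj ?_⟩
  · obtain ⟨h4, h5⟩ := hB.ext_angles (δ := δθ) hW hσ1 (by linarith) (by linarith) hi hik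
    exact ⟨⟨h2.trans h4.1, h4.2.trans (by linarith)⟩, h5⟩
  · have h6 : 0 < Real.sin x ^ 6 := by positivity
    have h7 := abs_le.2 hlam
    linarith
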